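/- Let $\lambda=\pm1$, $L>0$, $0<T<\infty$. Let $g_0,h_0\in C^2([0,T))$ and $g_1,h_1\in C^1([0,T))$ be complex-valued with $g_0(0)=h_0(0)=0$ (compatibility with zero initial data). In particular these may be the boundary values $q(0,t),q(L,t),q_x(0,t),q_x(L,t)$ of a sufficiently smooth solution of $iq_t+q_{xx}-2\lambda|q|^2q=0$, $0<x<L$, $0<t<T$, with $q(x,0)=0$. For $k\in\mathbb C$ let $\Phi_j(t,k)$ be the solution, continuous in $t\in[0,T)$, of $$\Phi_1(t,k)=\int_0^te^{4ik^2(t'-t)}\bigl[-i\lambda|g_0|^2\Phi_1+(2kg_0+ig_1)\Phi_2\bigr](t',k)\,dt',\quad \Phi_2(t,k)=1+\lambda\int_0^t\bigl[(2k\bar g_0-i\bar g_1)\Phi_1+i|g_0|^2\Phi_2\bigr](t',k)\,dt',$$ and let $\varphi_1,\varphi_2$ be the solution of the same system with $(g_0,g_1)$ replaced by $(h_0,h_1)$. Let $L_j(t,s),M_j(t,s)$, $j=1,2$, be a $C^1$ solution on $\{-t\le s\le t,\ 0\le t<T\}$ of the Goursat problem $$L_{1t}-L_{1s}=ig_1L_2+\alpha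 M_1+\beta M_2,\qquad L_{2t}+L_{2s}=-i\lambda\bar g_1L_1-\alpha M_2+\lambda\bar\beta M_1,$$ $$M_{1t}-M_{1s}=2g_0L_2+ig_1M_2,\qquad M_{2t}+M_{2s}=2\lambda\bar g_0L_1-i\lambda\bar g_1M_1,$$ $$L_1(t,t)=\tfrac i2g_1(t),\quad M_1(t,t)=g_0(t),\quad L_2(t,-t)=M_2(t,-t)=0,$$ where $\alpha=\frac\lambda2(g_0\bar g_1-\bar g_0g_1)$ and $\beta=\frac12(ig_0'-\lambda|g_0|^2g_0)$; let $\mathcal L_j,\mathcal M_j$ solve the same problem with $(g_0,g_1)$ replaced by $(h_0,h_1)$. Notation: $\hat f(t,k)=\int_{-t}^te^{2ik^2(s-t)}f(t,s)\,ds$; $f_\pm(k)=f(k)\pm f(-k)$; a bar over a function of $k$ denotes $\overline{f(\bar k)}$; $\Delta=e^{2ikL}-e^{-2ikL}$, $\Sigma=e^{2ikL}+e^{-2ikL}$; and $$F=\tfrac i2h_0e^{2ikL}\hat{\mathcal M}_2-\tfrac i2g_0\hat M_2+\bigl(\overline{\hat{\mathcal L}_2}-\tfrac{i\lambda}{2}h_0\overline{\hat{\mathcal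 M}_1}+k\overline{\hat{\mathcal M}_2}\bigr)\bigl(\hat L_1-\tfrac i2g_0\hat M_2+k\hat M_1\bigr)-e^{2ikL}\bigl(\overline{\hat L_2}-\tfrac{i\lambda}{2}g_0\overline{\hat M_1}+k\overline{\hat M_2}\bigr)\bigl(\hat{\mathcal L}_1-\tfrac i2h_0\hat{\mathcal M}_2+k\hat{\mathcal M}_1\bigr).$$ Let $\delta\in C^1(\mathbb R)$ be real-valued, with $c\le(1+x)\delta(x)\le C$ and $|\delta'(x)|\le C$ for all $x\ge0$ and some $c,C>0$. The contour $\partial D_1^0$ runs from $i\infty$ down the imaginary axis to $i\delta(0)$ and then along $x+i\delta(x)$, $0\le x<\infty$; $\partial D_3^0=-\partial D_1^0$ is its image under $k\mapsto-k$ (so it passes below the zeros of $\Delta$ in $(-\infty,0]$). Integrals over these contours are limits, as $R\to\infty$, of the integrals over the parts with imaginary-axis arm cut at $|\mathrm{Im}\,k|=R$ and other arm cut at $|\mathrm{Re}\,k|=R$. Then for every $t\in(0,T)$ and every such $\delta$ all integrals below converge, and the following four equalities hold (arguments $t,k$ suppressed). (1) (Two formulas for $g_1$) $$\frac4{i\pi}\int_{\partial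 D_1^0}\Bigl\{-\frac{2k^2}\Delta\Bigl[\hat{\mathcal M}_1-\frac{h_0}{2ik^2}\Bigr]+\frac{k^2\Sigma}\Delta\Bigl[\hat M_1-\frac{g_0}{2ik^2}\Bigr]+\frac k\Delta(e^{-2ikL}F)_-+\frac{ig_0}2k\hat M_2+\frac{kg_0}{2i}\overline{\hat{\mathcal M}_2}\Bigr\}dk$$ $$=\frac4{\pi i}\int_{\partial D_3^0}\Bigl\{\frac\Sigma{2\Delta}[k\Phi_{1-}+ig_0]-\frac1\Delta[k\varphi_{1-}+ih_0]+\frac{g_0}{4i}\varphi_{2-}+\frac{ig_0}2\Phi_{2-}+\frac k\Delta\bigl[(\bar\varphi_2-1)\Phi_1e^{-2ikL}-\varphi_1(\bar\Phi_2-1)\bigr]_-\Bigr\}dk.$$ (2) (Two formulas for $h_1$) $$\frac4{i\pi}\int_{\partial D_1^0}\Bigl\{\frac{2k^2}\Delta\Bigl[\hat M_1-\frac{g_0}{2ik^2}\Bigr]-\frac{k^2\Sigma}\Delta\Bigl[\hat{\mathcal M}_1-\frac{h_0}{2ik^2}\Bigr]+\frac k\Delta F_-+\frac{ih_0}2k\hat{\mathcal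 M}_2+\frac{kh_0}{2i}\overline{\hat M_2}\Bigr\}dk$$ $$=\frac4{\pi i}\int_{\partial D_3^0}\Bigl\{-\frac\Sigma{2\Delta}[k\varphi_{1-}+ih_0]+\frac1\Delta[k\Phi_{1-}+ig_0]+\frac{h_0}{4i}\Phi_{2-}+\frac{ih_0}2\varphi_{2-}+\frac k\Delta\bigl[(\bar\varphi_2-1)\Phi_1-\varphi_1(\bar\Phi_2-1)e^{2ikL}\bigr]_-\Bigr\}dk.$$ (3) (Two formulas for $g_0$) $$\frac2\pi\int_{\partial D_1^0}\frac1\Delta\bigl\{\Sigma\hat L_1-2\hat{\mathcal L}_1+(e^{-2ikL}F)_+\bigr\}dk=\frac2\pi\int_{\partial D_3^0}\frac1\Delta\Bigl\{\frac\Sigma2\Phi_{1+}-\varphi_{1+}+\bigl[\Phi_1(\bar\varphi_2-1)e^{-2ikL}-(\bar\Phi_2-1)\varphi_1\bigr]_+\Bigr\}dk.$$ (4) (Two formulas for $h_0$) $$\frac2\pi\int_{\partial D_1^0}\frac1\Delta\bigl\{-\Sigma\hat{\mathcal L}_1+2\hat L_1+F_+\bigr\}dk=\frac2\pi\int_{\partial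 D_3^0}\frac1\Delta\Bigl\{-\frac\Sigma2\varphi_{1+}+\Phi_{1+}+\bigl[(\bar\varphi_2-1)\Phi_1-e^{2ikL}(\bar\Phi_2-1)\varphi_1\bigr]_+\Bigr\}dk.$$ -/

import Mathlib

open Complex Filter Topology Set

noncomputable section

namespace NLSInterval

/-- `f_+(k) = f(k) + f(-k)`. -/
def plusPart (f : ℂ → ℂ) (k : ℂ) : ℂ := f k + f (-k)

/-- `f_-(k) = f(k) - f(-k)`. -/
def minusPart (f : ℂ → ℂ) (k : ℂ) : ℂ := f k - f (-k)

/-- The Schwarz conjugate `k ↦ conj (f (conj k))`, the meaning of a bar over a function of `k`. -/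
def bar (f : ℂ → ℂ) (k : ℂ) : ℂ := starRingEnd ℂ (f (starRingEnd ℂ k))

/-- `Δ(k) = e^{2ikL} - e^{-2ikL}`. -/
def Del (L : ℝ) (k : ℂ) : ℂ := exp (2 * I * k * L) - exp (-2 * I * k * L)

/-- `Σ(k) = e^{2ikL} + e^{-2ikL}`. -/
def Sig (L : ℝ) (k : ℂ) : ℂ := exp (2 * I * k * L) + exp (-2 * I * k * L)

/-- `(Φ₁, Φ₂)` is the (unique) continuous solution, for every spectral parameter `k`, of the
Volterra equations of the `t`-part of the Lax pair with Dirichlet value `a` and Neumann value `b`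
on `[0, T)`:
`Φ₁ = ∫₀ᵗ e^{4ik²(t'-t)} [-iλ|a|² Φ₁ + (2ka + ib) Φ₂] dt'`,
`Φ₂ = 1 + λ ∫₀ᵗ [(2k ā - i b̄) Φ₁ + i|a|² Φ₂] dt'`. -/
structure IsEigenpair (lam T : ℝ) (a b : ℝ → ℂ) (Φ₁ Φ₂ : ℝ → ℂ → ℂ) : Prop where
  continuousOn_fst : ∀ k, ContinuousOn (fun t => Φ₁ t k) (Ico 0 T)
  continuousOn_snd : ∀ k, ContinuousOn (fun t => Φ₂ t k) (Ico 0 T)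
  volterra_fst : ∀ k, ∀ t ∈ Ico 0 T,
    Φ₁ t k = ∫ τ in (0 : ℝ)..t, exp (4 * I * k ^ 2 * (τ - t)) *
      (-I * lam * (‖a τ‖ ^ 2 : ℝ) * Φ₁ τ k + (2 * k * a τ + I * b τ) * Φ₂ τ k)
  volterra_snd : ∀ k, ∀ t ∈ Ico 0 T,
    Φ₂ t k = 1 + lam * ∫ τ in (0 : ℝ)..t,
      ((2 * k * starRingEnd ℂ (a τ) - I * starRingEnd ℂ (b τ)) * Φ₁ τ k
        + I * (‖a τ‖ ^ 2 : ℝ) * Φ₂ τ k)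

/-- The four kernels `L₁, L₂, M₁, M₂`, functions of `(t, s)` with `-t ≤ s ≤ t`. -/
structure GLMKernels where
  L₁ : ℝ → ℝ → ℂ
  L₂ : ℝ → ℝ → ℂ
  M₁ : ℝ → ℝ → ℂ
  M₂ : ℝ → ℝ → ℂ

/-- The triangle `{(t, s) : 0 ≤ t < T, -t ≤ s ≤ t}`. -/
def triangle (T : ℝ) : Set (ℝ × ℝ) := {p | 0 ≤ p.1 ∧ p.1 < T ∧ |p.2| ≤ p.1}

/-- `α = (λ/2)(a b̄ - ā b)`. -/
def goursatAlpha (lam : ℝ) (a b : ℝ → ℂ) (t : ℝ) : ℂ :=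
  lam / 2 * (a t * starRingEnd ℂ (b t) - starRingEnd ℂ (a t) * b t)

/-- `β = (1/2)(i a' - λ |a|² a)`. -/
def goursatBeta (lam : ℝ) (a : ℝ → ℂ) (t : ℝ) : ℂ :=
  1 / 2 * (I * deriv a t - lam * (‖a t‖ ^ 2 : ℝ) * a t)

/-- The kernels form a classical (`C¹` up to the boundary) solution of the Goursat problem of the
Gelfand-Levitan-Marchenko representation with Dirichlet value `a` and Neumann value `b`. -/
structure GLMKernels.Solves (K : GLMKernels) (lam T : ℝ) (a b : ℝ → ℂ) : Prop where
  contDiffOn_L₁ : ContDiffOn ℝ 1 (fun p : ℝ × ℝ => K.L₁ p.1 p.2) (triangle T)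
  contDiffOn_L₂ : ContDiffOn ℝ 1 (fun p : ℝ × ℝ => K.L₂ p.1 p.2) (triangle T)
  contDiffOn_M₁ : ContDiffOn ℝ 1 (fun p : ℝ × ℝ => K.M₁ p.1 p.2) (triangle T)
  contDiffOn_M₂ : ContDiffOn ℝ 1 (fun p : ℝ × ℝ => K.M₂ p.1 p.2) (triangle T)
  eq_L₁ : ∀ t s : ℝ, t < T → |s| < t →
    deriv (fun τ => K.L₁ τ s) t - deriv (fun σ => K.L₁ t σ) s =
      I * b t * K.L₂ t s + goursatAlpha lam a b t * K.M₁ t s + goursatBeta lam a t * K.M₂ t s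
  eq_L₂ : ∀ t s : ℝ, t < T → |s| < t →
    deriv (fun τ => K.L₂ τ s) t + deriv (fun σ => K.L₂ t σ) s =
      -I * lam * starRingEnd ℂ (b t) * K.L₁ t s - goursatAlpha lam a b t * K.M₂ t s
        + lam * starRingEnd ℂ (goursatBeta lam a t) * K.M₁ t s
  eq_M₁ : ∀ t s : ℝ, t < T → |s| < t →
    deriv (fun τ => K.M₁ τ s) t - deriv (fun σ => K.M₁ t σ) s =
      2 * a t * K.L₂ t s + I * b t * K.M₂ t s
  eq_M₂ : ∀ t s : ℝ, t < T → |s| < t →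
    deriv (fun τ => K.M₂ τ s) t + deriv (fun σ => K.M₂ t σ) s =
      2 * lam * starRingEnd ℂ (a t) * K.L₁ t s - I * lam * starRingEnd ℂ (b t) * K.M₁ t s
  init_L₁ : ∀ t ∈ Ico 0 T, K.L₁ t t = I / 2 * b t
  init_M₁ : ∀ t ∈ Ico 0 T, K.M₁ t t = a t
  init_L₂ : ∀ t ∈ Ico 0 T, K.L₂ t (-t) = 0
  init_M₂ : ∀ t ∈ Ico 0 T, K.M₂ t (-t) = 0

/-- `f̂(t, k) = ∫_{-t}^{t} e^{2ik²(s-t)} f(t, s) ds`. -/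
def hat (f : ℝ → ℝ → ℂ) (t : ℝ) (k : ℂ) : ℂ :=
  ∫ s in (-t)..t, exp (2 * I * k ^ 2 * (s - t)) * f t s

/-! ### The contours

The deformed contour `∂D₃⁰` runs from `-i∞` up the imaginary axis to `-i δ(0)` and then along
`k = -x - i δ(x)`, `0 ≤ x < ∞`, i.e. below the real axis and hence below all zeros of `Δ`. The
depth `δ(x)` is comparable to `1/(1+x)`, so that `e^{-4ik²t}` stays bounded on the contour;
`∂D₁⁰ = -∂D₃⁰`. Integrals over these contours are limits as `R → ∞` of the integrals over the
parts with `|Re k| ≤ R` and `|Im k| ≤ R`. -/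

structure IsDepth (δ : ℝ → ℝ) : Prop where
  contDiff : ContDiff ℝ 1 δ
  bounds : ∃ c C : ℝ, 0 < c ∧ ∀ x : ℝ, 0 ≤ x →
    c ≤ (1 + x) * δ x ∧ (1 + x) * δ x ≤ C ∧ |deriv δ x| ≤ C

/-- `∫ f dk` over `∂D₃⁰` from `-iR` via `-iδ(0)` to `-R - iδ(R)`. -/
def integralD₃ (δ : ℝ → ℝ) (f : ℂ → ℂ) (R : ℝ) : ℂ :=
  (∫ y in R..(δ 0), f (-(I * y)) * (-I))
    + ∫ x in (0 : ℝ)..R, f (-(x + I * δ x)) * (-(1 + I * deriv δ x))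

/-- `∫ f dk` over `∂D₁⁰` from `iR` via `iδ(0)` to `R + iδ(R)`. -/
def integralD₁ (δ : ℝ → ℝ) (f : ℂ → ℂ) (R : ℝ) : ℂ :=
  (∫ y in R..(δ 0), f (I * y) * I)
    + ∫ x in (0 : ℝ)..R, f (x + I * δ x) * (1 + I * deriv δ x)

/-- `c ∫_{∂D₃⁰} f dk = v`. -/
def HasIntegralD₃ (δ : ℝ → ℝ) (c : ℂ) (f : ℂ → ℂ) (v : ℂ) : Prop :=
  Tendsto (fun R : ℝ => c * integralD₃ δ f R) atTop (𝓝 v)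

/-- `c ∫_{∂D₁⁰} f dk = v`. -/
def HasIntegralD₁ (δ : ℝ → ℝ) (c : ℂ) (f : ℂ → ℂ) (v : ℂ) : Prop :=
  Tendsto (fun R : ℝ => c * integralD₁ δ f R) atTop (𝓝 v)

/-! ### Integrands of the direct formulas

Here `t` is fixed, `Φⱼ`, `φⱼ` are functions of `k`, and `g₀`, `h₀` are the Dirichlet values at
time `t`. -/

section Direct

variable (L : ℝ) (g₀ h₀ : ℂ) (Φ₁ Φ₂ φ₁ φ₂ : ℂ → ℂ)

def directG₁ (k : ℂ) : ℂ :=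
  Sig L k / (2 * Del L k) * (k * minusPart Φ₁ k + I * g₀)
    - 1 / Del L k * (k * minusPart φ₁ k + I * h₀)
    + g₀ / (4 * I) * minusPart φ₂ k + I * g₀ / 2 * minusPart Φ₂ k
    + k / Del L k * minusPart (fun z => (bar φ₂ z - 1) * Φ₁ z * exp (-2 * I * z * L)
        - φ₁ z * (bar Φ₂ z - 1)) k

def directH₁ (k : ℂ) : ℂ :=
  -(Sig L k / (2 * Del L k)) * (k * minusPart φ₁ k + I * h₀)
    + 1 / Del L k * (k * minusPart Φ₁ k + I * g₀)
    + h₀ / (4 * I) * minusPart Φ₂ k + I * h₀ / 2 * minusPart φ₂ k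
    + k / Del L k * minusPart (fun z => (bar φ₂ z - 1) * Φ₁ z
        - φ₁ z * (bar Φ₂ z - 1) * exp (2 * I * z * L)) k

def directG₀ (k : ℂ) : ℂ :=
  1 / Del L k * (Sig L k / 2 * plusPart Φ₁ k - plusPart φ₁ k
    + plusPart (fun z => Φ₁ z * (bar φ₂ z - 1) * exp (-2 * I * z * L)
        - (bar Φ₂ z - 1) * φ₁ z) k)

def directH₀ (k : ℂ) : ℂ :=
  1 / Del L k * (-(Sig L k / 2) * plusPart φ₁ k + plusPart Φ₁ k
    + plusPart (fun z => (bar φ₂ z - 1) * Φ₁ z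
        - exp (2 * I * z * L) * (bar Φ₂ z - 1) * φ₁ z) k)

end Direct

/-! ### Integrands of the GLM formulas

`K` holds the kernels at `x = 0`, `N` those at `x = L`; `g₀`, `h₀` are functions of `t`. -/

section GLM

variable (lam L : ℝ) (g₀ h₀ : ℝ → ℂ) (K N : GLMKernels) (t : ℝ)

def glmF (k : ℂ) : ℂ :=
  I / 2 * h₀ t * exp (2 * I * k * L) * hat N.M₂ t k - I / 2 * g₀ t * hat K.M₂ t k
    + (bar (hat N.L₂ t) k - I * lam * (h₀ t / 2) * bar (hat N.M₁ t) k + k * bar (hat N.M₂ t) k)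
      * (hat K.L₁ t k - I / 2 * g₀ t * hat K.M₂ t k + k * hat K.M₁ t k)
    - exp (2 * I * k * L)
      * (bar (hat K.L₂ t) k - I * lam * (g₀ t / 2) * bar (hat K.M₁ t) k + k * bar (hat K.M₂ t) k)
      * (hat N.L₁ t k - I / 2 * h₀ t * hat N.M₂ t k + k * hat N.M₁ t k)

def glmG₁ (k : ℂ) : ℂ :=
  -(2 * k ^ 2 / Del L k) * (hat N.M₁ t k - h₀ t / (2 * I * k ^ 2))
    + k ^ 2 * Sig L k / Del L k * (hat K.M₁ t k - g₀ t / (2 * I * k ^ 2))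
    + k / Del L k * minusPart (fun z => exp (-2 * I * z * L) * glmF lam L g₀ h₀ K N t z) k
    + I * g₀ t / 2 * k * hat K.M₂ t k + k * g₀ t / (2 * I) * bar (hat N.M₂ t) k

def glmH₁ (k : ℂ) : ℂ :=
  2 * k ^ 2 / Del L k * (hat K.M₁ t k - g₀ t / (2 * I * k ^ 2))
    - k ^ 2 * Sig L k / Del L k * (hat N.M₁ t k - h₀ t / (2 * I * k ^ 2))
    + k / Del L k * minusPart (glmF lam L g₀ h₀ K N t) k
    + I * h₀ t / 2 * k * hat N.M₂ t k + k * h₀ t / (2 * I) * bar (hat K.M₂ t) k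

def glmG₀ (k : ℂ) : ℂ :=
  1 / Del L k * (Sig L k * hat K.L₁ t k - 2 * hat N.L₁ t k
    + plusPart (fun z => exp (-2 * I * z * L) * glmF lam L g₀ h₀ K N t z) k)

def glmH₀ (k : ℂ) : ℂ :=
  1 / Del L k * (-(Sig L k) * hat N.L₁ t k + 2 * hat K.L₁ t k
    + plusPart (glmF lam L g₀ h₀ K N t) k)

end GLM

end NLSInterval

end

namespace NLSInterval

open MeasureTheory
open scoped Interval

/-! The theorem rests on one representation. Under the transform in `s` the Goursat problem becomes
a linear ODE system in `t`, and the combinations L̂₁ - (i/2)g₀M̂₂ + kM̂₁ and 1 + L̂₂ + (iλ/2)ḡ₀M̂₁ +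
kM̂₂ satisfy the differential equations and initial conditions of Φ₁ and Φ₂. Gronwall's inequality
identifies them (`IsEigenpair.eq_hat`). Each transform depends on `k` only through k², so this
separates Φ₁ and the Schwarz conjugate of Φ₂ into even and odd parts.

After substitution every direct integrand takes the form (Σ/Δ)X + Y/Δ + Z. The GLM integrand for
`g₀` or `h₀` is then the same function; the one for `g₁` or `h₁` differs from it by a constant
multiple of k·bar M̂₂ - k·M̂₂, with M̂₂ taken at the opposite endpoint. The direct integrands are
odd in `k`, so for each cutoff `R` their integrals over the two contours agree. Two analytic facts
remain.

Convergence. One integration by parts makes all transforms O(k⁻²); the ODEs sharpen this to M̂₁ =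
g₀/(2ik²) + O(k⁻⁴), where g₀(0) = 0 is needed, and M̂₂ = ic/k² + O(k⁻⁴) with `c` real
(`isBigO_hat_M₁`, `isBigO_hat_M₂`). Hence X and Y are O(k⁻²), and Z is e/k + O(k⁻²). Near the zeros
of Δ, the factor 1/Δ is controlled by the geometric mean of two lower bounds for |Δ|, which leaves
an integrable weight (`integralD₁_converges`). The term e/k converges only conditionally and is
integrated by the logarithm.

The correction. The function kM̂₂ is odd and entire, so it has an even primitive F, and F(iR) may be
replaced by F(-iR). This moves the computation to the fourth quadrant, where the exponentials are
bounded: a quarter circle yields the limit -cπ/2. The Schwarz conjugate yields the complex conjugate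
value, which is the same because `c` is real. The correction therefore integrates to zero
(`tendsto_integralD₁_entire`). -/

@[fun_prop]
theorem continuousOn_ofReal_comp {X : Type*} [TopologicalSpace X] {f : X → ℝ} {s : Set X}
    (hf : ContinuousOn f s) : ContinuousOn (fun x => (f x : ℂ)) s :=
  Complex.continuous_ofReal.comp_continuousOn hf

@[fun_prop]
theorem continuousOn_conj_comp {X : Type*} [TopologicalSpace X] {f : X → ℂ} {s : Set X}
    (hf : ContinuousOn f s) : ContinuousOn (fun x => starRingEnd ℂ (f x)) s :=
  Complex.continuous_conj.comp_continuousOn hf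

/-! ### Kernels of class `C¹` on the triangle and their transforms -/

theorem convex_triangle (T : ℝ) : Convex ℝ (triangle T) := by
  rintro ⟨x₁, x₂⟩ ⟨hx0, hxT, hx⟩ ⟨y₁, y₂⟩ ⟨hy0, hyT, hy⟩ a b ha hb hab
  simp only at hx0 hxT hx hy0 hyT hy
  have h := abs_le.1 hx
  have h' := abs_le.1 hy
  refine ⟨?_, ?_, abs_le.2 ⟨?_, ?_⟩⟩ <;>
    simp only [Prod.smul_mk, Prod.mk_add_mk, smul_eq_mul]
  · positivity
  · have hb' : b = 1 - a := by linarith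
    subst hb'
    rcases ha.eq_or_lt with h0 | h0
    · subst h0; simpa using hyT
    · nlinarith
  · nlinarith [mul_le_mul_of_nonneg_left h.1 ha, mul_le_mul_of_nonneg_left h'.1 hb]
  · nlinarith [mul_le_mul_of_nonneg_left h.2 ha, mul_le_mul_of_nonneg_left h'.2 hb]

theorem triangle_mem_nhds {T t s : ℝ} (hs : |s| < t) (ht : t < T) :
    triangle T ∈ 𝓝 (t, s) := by
  have h1 : IsOpen {p : ℝ × ℝ | |p.2| < p.1 ∧ p.1 < T} :=
    (isOpen_lt continuous_snd.abs continuous_fst).inter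
      (isOpen_lt continuous_fst continuous_const)
  refine mem_of_superset (h1.mem_nhds ⟨hs, ht⟩) ?_
  rintro ⟨x, y⟩ ⟨h, h'⟩
  exact ⟨(abs_nonneg _).trans h.le, h', h.le⟩

theorem isCompact_subtriangle (t : ℝ) : IsCompact {p : ℝ × ℝ | 0 ≤ p.1 ∧ p.1 ≤ t ∧ |p.2| ≤ p.1} := by
  refine (isCompact_Icc (a := ((0 : ℝ), -t)) (b := (t, t))).of_isClosed_subset ?_ ?_
  · exact (isClosed_le continuous_const continuous_fst).inter
      ((isClosed_le continuous_fst continuous_const).inter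
        (isClosed_le continuous_snd.abs continuous_fst))
  · rintro ⟨x, y⟩ ⟨h0, h1, h2⟩
    simp only at h0 h1 h2
    have := abs_le.1 h2
    exact ⟨⟨h0, by simp only; linarith⟩, ⟨h1, by simp only; linarith⟩⟩

/-- `f` is continuously differentiable up to the boundary of the triangle, with partial
derivatives `ft` and `fs`. -/
structure HasPartials (T : ℝ) (f ft fs : ℝ → ℝ → ℂ) : Prop where
  cont : ContinuousOn (fun p : ℝ × ℝ => f p.1 p.2) (triangle T)
  cont_t : ContinuousOn (fun p : ℝ × ℝ => ft p.1 p.2) (triangle T)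
  cont_s : ContinuousOn (fun p : ℝ × ℝ => fs p.1 p.2) (triangle T)
  deriv_t : ∀ t s, |s| < t → t < T → HasDerivAt (fun τ => f τ s) (ft t s) t
  deriv_s : ∀ t s, |s| < t → t < T → HasDerivAt (f t) (fs t s) s
  deriv_ray : ∀ t v, |t * v| < t → t < T →
    HasDerivAt (fun τ => f τ (τ * v)) (ft t (t * v) + v * fs t (t * v)) t

/-- The triangle is convex with nonempty interior, hence a set of unique differentiability, so the
derivative within it is continuous up to the boundary. At interior points it is the full derivative
and supplies the partial and radial ones. -/
theorem exists_hasPartials {T : ℝ} (hT : 0 < T) {f : ℝ → ℝ → ℂ}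
    (hf : ContDiffOn ℝ 1 (fun p : ℝ × ℝ => f p.1 p.2) (triangle T)) :
    ∃ ft fs, HasPartials T f ft fs := by
  have hU : UniqueDiffOn ℝ (triangle T) := by
    refine uniqueDiffOn_convex (convex_triangle T) ⟨(T / 2, 0), ?_⟩
    rw [mem_interior_iff_mem_nhds]
    exact triangle_mem_nhds (by simpa using hT) (by linarith)
  set D := fderivWithin ℝ (fun p : ℝ × ℝ => f p.1 p.2) (triangle T) with hD
  have hDc : ContinuousOn D (triangle T) := hf.continuousOn_fderivWithin hU le_rfl
  have hDd : ∀ t s, |s| < t → t < T →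
      HasFDerivAt (fun p : ℝ × ℝ => f p.1 p.2) (D (t, s)) (t, s) := by
    intro t s hs ht
    have hm := triangle_mem_nhds hs ht
    exact ((hf.differentiableOn one_ne_zero (t, s) (mem_of_mem_nhds hm)).hasFDerivWithinAt).hasFDerivAt hm
  refine ⟨fun t s => D (t, s) (1, 0), fun t s => D (t, s) (0, 1), hf.continuousOn, ?_, ?_, ?_, ?_, ?_⟩
  · exact hDc.clm_apply continuousOn_const
  · exact hDc.clm_apply continuousOn_const
  · intro t s hs ht
    have h1 : HasDerivAt (fun τ : ℝ => (τ, s)) ((1 : ℝ), (0 : ℝ)) t :=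
      (hasDerivAt_id t).prodMk (hasDerivAt_const t s)
    exact (hDd t s hs ht).comp_hasDerivAt t h1
  · intro t s hs ht
    have h1 : HasDerivAt (fun σ : ℝ => (t, σ)) ((0 : ℝ), (1 : ℝ)) s :=
      (hasDerivAt_const s t).prodMk (hasDerivAt_id s)
    exact (hDd t s hs ht).comp_hasDerivAt s h1
  · intro t v hs ht
    have h1 : HasDerivAt (fun τ : ℝ => (τ, τ * v)) ((1 : ℝ), v) t := by
      have := (hasDerivAt_id t).prodMk ((hasDerivAt_id t).mul_const v)
      simpa using this
    have h2 := (hDd t (t * v) hs ht).comp_hasDerivAt t h1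
    refine h2.congr_deriv ?_
    have : ((1 : ℝ), v) = (1, 0) + v • ((0 : ℝ), (1 : ℝ)) := by simp
    rw [this, map_add, map_smul, real_smul]

theorem slice_mem_triangle {T t s : ℝ} (ht : 0 ≤ t) (htT : t < T) (hs : s ∈ Icc (-t) t) :
    (t, s) ∈ triangle T := ⟨ht, htT, abs_le.2 hs⟩

theorem continuousOn_slice {T t : ℝ} {f : ℝ → ℝ → ℂ}
    (hf : ContinuousOn (fun p : ℝ × ℝ => f p.1 p.2) (triangle T)) (ht : 0 ≤ t) (htT : t < T) :
    ContinuousOn (f t) (Icc (-t) t) :=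
  hf.comp (f := fun s => (t, s)) (by fun_prop) fun _ hs => slice_mem_triangle ht htT hs

theorem exists_bound_subtriangle {T t : ℝ} {f : ℝ → ℝ → ℂ}
    (hf : ContinuousOn (fun p : ℝ × ℝ => f p.1 p.2) (triangle T)) (htT : t < T) :
    ∃ C, 0 ≤ C ∧ ∀ τ s, 0 ≤ τ → τ ≤ t → |s| ≤ τ → ‖f τ s‖ ≤ C := by
  obtain ⟨C, hC⟩ := (isCompact_subtriangle t).exists_bound_of_continuousOn
    (hf.mono fun p hp => ⟨hp.1, hp.2.1.trans_lt htT, hp.2.2⟩)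
  exact ⟨max C 0, le_max_right _ _, fun τ s h0 h1 h2 =>
    (hC (τ, s) ⟨h0, h1, h2⟩).trans (le_max_left _ _)⟩

/-- The substitution s = tv fixes the interval of integration. Differentiation in `t` then takes
place along rays, which stay inside the open triangle for |v| < 1. -/
theorem hat_eq_scaled (f : ℝ → ℝ → ℂ) (t : ℝ) (k : ℂ) :
    hat f t k = ∫ v in (-1 : ℝ)..1,
      (t : ℂ) * (exp (2 * I * k ^ 2 * ((t * v : ℝ) - t)) * f t (t * v)) := by
  have := intervalIntegral.smul_integral_comp_mul_left (a := -1) (b := 1)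
    (fun s : ℝ => exp (2 * I * k ^ 2 * ((s : ℝ) - t)) * f t s) t
  rw [hat, intervalIntegral.integral_const_mul]
  simpa using this.symm

theorem hasDerivAt_hat_scaled {T t : ℝ} {f ft fs : ℝ → ℝ → ℂ} (h : HasPartials T f ft fs)
    (ht : t ∈ Ioo 0 T) (k : ℂ) :
    IntervalIntegrable (fun v : ℝ => exp (2 * I * k ^ 2 * ((t * v : ℝ) - t)) *
        ((1 + 2 * I * k ^ 2 * t * (v - 1)) * f t (t * v)
          + t * (ft t (t * v) + v * fs t (t * v)))) volume (-1) 1 ∧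
    HasDerivAt (fun τ => hat f τ k) (∫ v in (-1 : ℝ)..1,
      exp (2 * I * k ^ 2 * ((t * v : ℝ) - t)) * ((1 + 2 * I * k ^ 2 * t * (v - 1)) * f t (t * v)
        + t * (ft t (t * v) + v * fs t (t * v)))) t := by
  obtain ⟨ht0, htT⟩ := ht
  set F' : ℝ → ℝ → ℂ := fun τ v => exp (2 * I * k ^ 2 * ((τ * v : ℝ) - τ)) *
    ((1 + 2 * I * k ^ 2 * τ * (v - 1)) * f τ (τ * v) + τ * (ft τ (τ * v) + v * fs τ (τ * v)))
    with hF'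
  obtain ⟨t', htt', ht'T⟩ := exists_between htT
  have hmaps : ∀ τ, 0 ≤ τ → τ < T →
      MapsTo (fun v : ℝ => (τ, τ * v)) (Icc (-1) 1) (triangle T) := by
    intro τ h0 h1 v hv
    refine ⟨h0, h1, ?_⟩
    simp only [abs_mul, abs_of_nonneg h0]
    exact mul_le_of_le_one_right h0 (abs_le.2 hv)
  have hray : ∀ {g : ℝ → ℝ → ℂ}, ContinuousOn (fun p : ℝ × ℝ => g p.1 p.2) (triangle T) →
      ∀ τ, 0 ≤ τ → τ < T → ContinuousOn (fun v => g τ (τ * v)) (Icc (-1) 1) := by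
    intro g hg τ h0 h1
    exact hg.comp (f := fun v : ℝ => (τ, τ * v)) (by fun_prop) (hmaps τ h0 h1)
  have hray2 : ∀ {g : ℝ → ℝ → ℂ}, ContinuousOn (fun p : ℝ × ℝ => g p.1 p.2) (triangle T) →
      ContinuousOn (fun p : ℝ × ℝ => g p.1 (p.1 * p.2)) (Icc 0 t' ×ˢ Icc (-1) 1) := by
    intro g hg
    refine hg.comp (f := fun p : ℝ × ℝ => (p.1, p.1 * p.2)) (by fun_prop) ?_
    rintro ⟨τ, v⟩ ⟨hτ, hv⟩
    exact hmaps τ hτ.1 (hτ.2.trans_lt ht'T) hv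
  have hbd : ContinuousOn (fun p : ℝ × ℝ => F' p.1 p.2) (Icc 0 t' ×ˢ Icc (-1) 1) := by
    have h1 := hray2 h.cont
    have h2 := hray2 h.cont_t
    have h3 := hray2 h.cont_s
    simp only [hF']
    repeat' first | assumption | fun_prop | apply ContinuousOn.mul | apply ContinuousOn.add
  obtain ⟨C, hC⟩ := (isCompact_Icc.prod isCompact_Icc).exists_bound_of_continuousOn hbd
  have hu : Ι (-1 : ℝ) 1 ⊆ Icc (-1) 1 := by
    rw [uIoc_of_le (by norm_num)]; exact Ioc_subset_Icc_self
  have hs : Ioo 0 t' ∈ 𝓝 t := Ioo_mem_nhds ht0 htt'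
  have hFc : ∀ τ ∈ Ioo 0 t', ContinuousOn (fun v : ℝ =>
      (τ : ℂ) * (exp (2 * I * k ^ 2 * ((τ * v : ℝ) - τ)) * f τ (τ * v))) (Icc (-1) 1) := by
    intro τ hτ
    have := hray h.cont τ hτ.1.le (hτ.2.trans ht'T)
    repeat' first | assumption | fun_prop | apply ContinuousOn.mul
  have hF'c : ContinuousOn (F' t) (Icc (-1) 1) := by
    have h1 := hray h.cont t ht0.le htT
    have h2 := hray h.cont_t t ht0.le htT
    have h3 := hray h.cont_s t ht0.le htT
    simp only [hF']
    repeat' first | assumption | fun_prop | apply ContinuousOn.mul | apply ContinuousOn.add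
  have key := intervalIntegral.hasDerivAt_integral_of_dominated_loc_of_deriv_le (μ := volume)
    (a := (-1 : ℝ)) (b := 1) (F' := F') (bound := fun _ => C) (s := Ioo 0 t') (x₀ := t)
    (F := fun (τ v : ℝ) => (τ : ℂ) * (exp (2 * I * k ^ 2 * ((τ * v : ℝ) - τ)) * f τ (τ * v)))
    hs ?_ ?_ ?_ ?_ ?_ ?_
  · refine ⟨key.1, ?_⟩
    refine key.2.congr_of_eventuallyEq ?_
    exact Eventually.of_forall fun τ => hat_eq_scaled f τ k
  · filter_upwards [hs] with τ hτ
    exact ((hFc τ hτ).mono hu).aestronglyMeasurable measurableSet_uIoc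
  · refine ContinuousOn.intervalIntegrable ?_
    rw [uIcc_of_le (by norm_num)]
    exact hFc t ⟨ht0, htt'⟩
  · exact (hF'c.mono hu).aestronglyMeasurable measurableSet_uIoc
  · refine Eventually.of_forall fun v hv τ hτ => ?_
    exact hC (τ, v) ⟨⟨hτ.1.le, hτ.2.le⟩, hu hv⟩
  · exact intervalIntegrable_const
  -- The ray v = 1 runs along the boundary of the triangle, where no two-sided derivative is
  -- available; v = -1 is already absent from the half-open interval.
  · have h1 : ∀ᵐ v : ℝ, v ≠ 1 := by
      simp [ae_iff]
    filter_upwards [h1] with v hv1 hv τ hτ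
    rw [uIoc_of_le (by norm_num)] at hv
    have hvlt : |v| < 1 := abs_lt.2 ⟨hv.1, lt_of_le_of_ne hv.2 hv1⟩
    have hlt : |τ * v| < τ := by
      rw [abs_mul, abs_of_pos hτ.1]; exact mul_lt_of_lt_one_right hτ.1 hvlt
    have d1 := h.deriv_ray τ v hlt (hτ.2.trans ht'T)
    have d2 : HasDerivAt (fun τ : ℝ => (τ : ℂ)) 1 τ := (hasDerivAt_id τ).ofReal_comp
    have d3 : HasDerivAt (fun τ : ℝ => exp (2 * I * k ^ 2 * ((τ * v : ℝ) - τ)))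
        (exp (2 * I * k ^ 2 * ((τ * v : ℝ) - τ)) * (2 * I * k ^ 2 * (v - 1))) τ := by
      have h0 : HasDerivAt (fun τ : ℝ => 2 * I * k ^ 2 * (((τ * v : ℝ) : ℂ) - τ))
          (2 * I * k ^ 2 * (v - 1)) τ := by
        have := ((d2.mul_const (v : ℂ)).sub d2).const_mul (2 * I * k ^ 2)
        simpa using this
      exact h0.cexp
    refine (d2.mul (d3.mul d1)).congr_deriv ?_
    simp only [hF', Pi.mul_apply]
    ring

theorem hasDerivAt_ofReal (v : ℝ) : HasDerivAt (fun v : ℝ => (v : ℂ)) 1 v :=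
  (hasDerivAt_id v).ofReal_comp

theorem hasDerivAt_scaled_slice {T t v : ℝ} {f ft fs : ℝ → ℝ → ℂ} (h : HasPartials T f ft fs)
    (ht : t ∈ Ioo 0 T) (k : ℂ) (hv : v ∈ Ioo (-1 : ℝ) 1) :
    HasDerivAt (fun v : ℝ => exp (2 * I * k ^ 2 * ((t * v : ℝ) - t)) * f t (t * v))
      (exp (2 * I * k ^ 2 * ((t * v : ℝ) - t)) *
        (2 * I * k ^ 2 * t * f t (t * v) + t * fs t (t * v))) v := by
  have hlt : |t * v| < t := by
    rw [abs_mul, abs_of_pos ht.1]; exact mul_lt_of_lt_one_right ht.1 (abs_lt.2 hv)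
  have d0 : HasDerivAt (fun v : ℝ => t * v) t v := by
    simpa using (hasDerivAt_id v).const_mul t
  have d1 := (h.deriv_s t (t * v) hlt ht.2).scomp v d0
  have d2 : HasDerivAt (fun v : ℝ => exp (2 * I * k ^ 2 * ((t * v : ℝ) - t)))
      (exp (2 * I * k ^ 2 * ((t * v : ℝ) - t)) * (2 * I * k ^ 2 * t)) v := by
    refine HasDerivAt.cexp ?_
    have := ((d0.ofReal_comp).sub_const (t : ℂ)).const_mul (2 * I * k ^ 2)
    simpa using this
  refine (d2.mul d1).congr_deriv ?_
  simp only [Function.comp_apply, real_smul]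
  ring

theorem continuousOn_scaled_slice {T t : ℝ} {f : ℝ → ℝ → ℂ}
    (hf : ContinuousOn (fun p : ℝ × ℝ => f p.1 p.2) (triangle T)) (ht : t ∈ Ioo 0 T) :
    ContinuousOn (fun v => f t (t * v)) (Icc (-1) 1) := by
  refine hf.comp (f := fun v : ℝ => (t, t * v)) (by fun_prop) fun v hv => ?_
  refine slice_mem_triangle ht.1.le ht.2 ⟨?_, ?_⟩ <;> nlinarith [hv.1, hv.2, ht.1]

/-- The scaled derivative contains `ft + v fs`. Subtracting the total `v`-derivative of (1 +
v)·exp·f leaves the characteristic derivative `ft - fs`. The weight 1 + v vanishes at v = -1, so the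
only boundary contribution is 2f(t,t), from s = t. -/
theorem hasDerivAt_hat_of_incoming {T t : ℝ} {f ft fs : ℝ → ℝ → ℂ} (h : HasPartials T f ft fs)
    (ht : t ∈ Ioo 0 T) (k : ℂ) :
    HasDerivAt (fun τ => hat f τ k)
      (2 * f t t - 4 * I * k ^ 2 * hat f t k + hat (fun t s => ft t s - fs t s) t k) t := by
  obtain ⟨hi, hd⟩ := hasDerivAt_hat_scaled h ht k
  have c0 := continuousOn_scaled_slice h.cont ht
  have c1 := continuousOn_scaled_slice h.cont_t ht
  have c2 := continuousOn_scaled_slice h.cont_s ht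
  have e1 : uIcc (-1 : ℝ) 1 = Icc (-1) 1 := uIcc_of_le (by norm_num)
  convert hd using 1
  rw [hat_eq_scaled, hat_eq_scaled]
  have hG : ∫ v in (-1 : ℝ)..1, (exp (2 * I * k ^ 2 * ((t * v : ℝ) - t)) *
      ((1 + 2 * I * k ^ 2 * t * (1 + v)) * f t (t * v) + t * (1 + v) * fs t (t * v))) =
      2 * f t t := by
    have := intervalIntegral.integral_eq_sub_of_hasDerivAt_of_le (a := -1) (b := 1) (by norm_num)
      (f := fun v : ℝ => (1 + (v : ℂ)) * (exp (2 * I * k ^ 2 * ((t * v : ℝ) - t)) * f t (t * v)))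
      (f' := fun v : ℝ => exp (2 * I * k ^ 2 * ((t * v : ℝ) - t)) *
        ((1 + 2 * I * k ^ 2 * t * (1 + v)) * f t (t * v) + t * (1 + v) * fs t (t * v)))
      ?_ ?_ ?_
    · rw [this]; simp; left; norm_num
    · repeat' first | assumption | fun_prop | apply ContinuousOn.mul
    · intro v hv
      refine (((hasDerivAt_ofReal v).const_add 1).mul (hasDerivAt_scaled_slice h ht k hv)).congr_deriv ?_
      ring
    · refine ContinuousOn.intervalIntegrable ?_
      rw [e1]
      repeat' first | assumption | fun_prop | apply ContinuousOn.mul | apply ContinuousOn.add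
  rw [← hG, ← intervalIntegral.integral_const_mul, ← intervalIntegral.integral_sub,
    ← intervalIntegral.integral_add]
  · refine intervalIntegral.integral_congr fun v _ => ?_
    ring
  all_goals
    refine ContinuousOn.intervalIntegrable ?_
    rw [e1]
    repeat' first | assumption | fun_prop | apply ContinuousOn.mul | apply ContinuousOn.add | apply ContinuousOn.sub

/-- Here the weight v - 1 produces `ft + fs`. It vanishes at s = t, and the boundary term at s = -t
is removed by the Goursat condition `h0`. -/
theorem hasDerivAt_hat_of_outgoing {T t : ℝ} {f ft fs : ℝ → ℝ → ℂ} (h : HasPartials T f ft fs)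
    (ht : t ∈ Ioo 0 T) (k : ℂ) (h0 : f t (-t) = 0) :
    HasDerivAt (fun τ => hat f τ k) (hat (fun t s => ft t s + fs t s) t k) t := by
  obtain ⟨hi, hd⟩ := hasDerivAt_hat_scaled h ht k
  have c0 := continuousOn_scaled_slice h.cont ht
  have c1 := continuousOn_scaled_slice h.cont_t ht
  have c2 := continuousOn_scaled_slice h.cont_s ht
  have e1 : uIcc (-1 : ℝ) 1 = Icc (-1) 1 := uIcc_of_le (by norm_num)
  convert hd using 1
  rw [hat_eq_scaled]
  have hG : ∫ v in (-1 : ℝ)..1, (exp (2 * I * k ^ 2 * ((t * v : ℝ) - t)) *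
      ((1 + 2 * I * k ^ 2 * t * (v - 1)) * f t (t * v) + t * (v - 1) * fs t (t * v))) = 0 := by
    have := intervalIntegral.integral_eq_sub_of_hasDerivAt_of_le (a := -1) (b := 1) (by norm_num)
      (f := fun v : ℝ => ((v : ℂ) - 1) * (exp (2 * I * k ^ 2 * ((t * v : ℝ) - t)) * f t (t * v)))
      (f' := fun v : ℝ => exp (2 * I * k ^ 2 * ((t * v : ℝ) - t)) *
        ((1 + 2 * I * k ^ 2 * t * (v - 1)) * f t (t * v) + t * (v - 1) * fs t (t * v)))
      ?_ ?_ ?_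
    · rw [this]; simp [h0]
    · repeat' first | assumption | fun_prop | apply ContinuousOn.mul
    · intro v hv
      refine (((hasDerivAt_ofReal v).sub_const 1).mul (hasDerivAt_scaled_slice h ht k hv)).congr_deriv ?_
      ring
    · refine ContinuousOn.intervalIntegrable ?_
      rw [e1]
      repeat' first | assumption | fun_prop | apply ContinuousOn.mul | apply ContinuousOn.add
  rw [← add_zero (∫ v in (-1 : ℝ)..1, _), ← hG, ← intervalIntegral.integral_add]
  · refine intervalIntegral.integral_congr fun v _ => ?_
    ring
  all_goals
    refine ContinuousOn.intervalIntegrable ?_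
    rw [e1]
    repeat' first | assumption | fun_prop | apply ContinuousOn.mul | apply ContinuousOn.add

/-- The Goursat equations hold only for |s| < t; the two endpoints are a null set. -/
theorem hat_congr {f g : ℝ → ℝ → ℂ} {t : ℝ} (ht : 0 < t) (k : ℂ)
    (h : ∀ s, |s| < t → f t s = g t s) : hat f t k = hat g t k := by
  have ht' : -t ≤ t := by linarith
  rw [hat, hat, intervalIntegral.integral_of_le ht', intervalIntegral.integral_of_le ht',
    integral_Ioc_eq_integral_Ioo, integral_Ioc_eq_integral_Ioo]
  exact setIntegral_congr_fun measurableSet_Ioo fun s hs => by rw [h s (abs_lt.2 hs)]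

theorem hat_intervalIntegrable {f : ℝ → ℝ → ℂ} {t : ℝ} (ht : 0 ≤ t) (k : ℂ)
    (hf : ContinuousOn (f t) (Icc (-t) t)) :
    IntervalIntegrable (fun s : ℝ => exp (2 * I * k ^ 2 * (s - t)) * f t s) volume (-t) t := by
  refine ContinuousOn.intervalIntegrable ?_
  rw [uIcc_of_le (by linarith)]
  fun_prop

theorem hat_add {f g : ℝ → ℝ → ℂ} {t : ℝ} (ht : 0 ≤ t) (k : ℂ)
    (hf : ContinuousOn (f t) (Icc (-t) t)) (hg : ContinuousOn (g t) (Icc (-t) t)) :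
    hat (fun t s => f t s + g t s) t k = hat f t k + hat g t k := by
  simp only [hat, mul_add]
  exact intervalIntegral.integral_add (hat_intervalIntegrable ht k hf)
    (hat_intervalIntegrable ht k hg)

theorem hat_const_mul (f : ℝ → ℝ → ℂ) (c : ℝ → ℂ) (t : ℝ) (k : ℂ) :
    hat (fun t s => c t * f t s) t k = c t * hat f t k := by
  simp only [hat]
  rw [← intervalIntegral.integral_const_mul]
  congr 1; ext s; ring

theorem hat_even (f : ℝ → ℝ → ℂ) (t : ℝ) (k : ℂ) : hat f t (-k) = hat f t k := by
  simp [hat]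

end NLSInterval

/-! ### Bounds for the transforms and their evolution in `t` -/

namespace NLSInterval

open MeasureTheory
open scoped Interval

/-- The exponent has real part 2 Im(k²)(τ - s), and 0 ≤ τ - s ≤ 2t. -/
theorem norm_exp_kernel_le {k : ℂ} {C t τ s : ℝ} (hC : 0 ≤ C) (hk : (k ^ 2).im ≤ C) (hτt : τ ≤ t)
    (hs : |s| ≤ τ) : ‖exp (2 * I * k ^ 2 * (s - τ))‖ ≤ Real.exp (4 * C * t) := by
  have h := abs_le.1 hs
  have h0 : 0 ≤ t := ((abs_nonneg s).trans hs).trans hτt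
  rw [norm_exp, Real.exp_le_exp]
  have : (2 * I * k ^ 2 * ((s : ℂ) - τ)).re = 2 * (k ^ 2).im * (τ - s) := by
    have : 2 * I * k ^ 2 * ((s : ℂ) - τ) = (((s - τ : ℝ)) : ℂ) * (2 * (I * k ^ 2)) := by
      push_cast; ring
    rw [this, re_ofReal_mul]
    simp
    ring
  rw [this]
  nlinarith [mul_le_mul_of_nonneg_right hk (by linarith : 0 ≤ τ - s)]

theorem norm_hat_le {k : ℂ} {C t τ M : ℝ} {f : ℝ → ℝ → ℂ} (hC : 0 ≤ C) (hk : (k ^ 2).im ≤ C)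
    (hτ0 : 0 ≤ τ) (hτt : τ ≤ t) (hf : ∀ s, |s| ≤ τ → ‖f τ s‖ ≤ M) :
    ‖hat f τ k‖ ≤ Real.exp (4 * C * t) * M * (2 * τ) := by
  have hM : 0 ≤ M := (norm_nonneg _).trans (hf 0 (by simpa using hτ0))
  have := intervalIntegral.norm_integral_le_of_norm_le_const (a := -τ) (b := τ)
    (f := fun s : ℝ => exp (2 * I * k ^ 2 * (s - τ)) * f τ s) (C := Real.exp (4 * C * t) * M) ?_
  · refine this.trans_eq ?_
    rw [abs_of_nonneg (by linarith)]
    ring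
  · intro s hs
    rw [uIoc_of_le (by linarith)] at hs
    have hs' : |s| ≤ τ := abs_le.2 ⟨hs.1.le, hs.2⟩
    rw [norm_mul]
    exact mul_le_mul (norm_exp_kernel_le hC hk hτt hs') (hf s hs') (norm_nonneg _)
      (Real.exp_pos _).le

theorem tendsto_hat_zero {T : ℝ} {f : ℝ → ℝ → ℂ} (hT : 0 < T)
    (hf : ContinuousOn (fun p : ℝ × ℝ => f p.1 p.2) (triangle T)) (k : ℂ) :
    Tendsto (fun τ => hat f τ k) (𝓝[>] 0) (𝓝 0) := by
  obtain ⟨M, hM0, hM⟩ := exists_bound_subtriangle (t := T / 2) hf (by linarith)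
  have h1 : Tendsto (fun τ : ℝ => Real.exp (4 * ‖k ^ 2‖ * (T / 2)) * M * (2 * τ)) (𝓝[>] 0) (𝓝 0) := by
    have : ContinuousAt (fun τ : ℝ => Real.exp (4 * ‖k ^ 2‖ * (T / 2)) * M * (2 * τ)) 0 := by fun_prop
    have h := this.tendsto
    simp only [mul_zero] at h
    exact h.mono_left nhdsWithin_le_nhds
  refine squeeze_zero_norm' ?_ h1
  filter_upwards [Ioo_mem_nhdsGT (half_pos hT)] with τ hτ
  exact norm_hat_le (norm_nonneg _) ((le_abs_self _).trans (abs_im_le_norm _)) hτ.1.le hτ.2.le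
    fun s hs => hM τ s hτ.1.le hτ.2.le hs

section Solves

variable {lam T : ℝ} {a b : ℝ → ℂ} {K : GLMKernels}

theorem GLMKernels.Solves.hasDerivAt_hat_L₁ (hK : K.Solves lam T a b) {t : ℝ} (ht : t ∈ Ioo 0 T)
    (k : ℂ) : HasDerivAt (fun τ => hat K.L₁ τ k)
      (I * b t - 4 * I * k ^ 2 * hat K.L₁ t k + (I * b t * hat K.L₂ t k
        + goursatAlpha lam a b t * hat K.M₁ t k + goursatBeta lam a t * hat K.M₂ t k)) t := by
  have hT : 0 < T := ht.1.trans ht.2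
  obtain ⟨ft, fs, h⟩ := exists_hasPartials hT hK.contDiffOn_L₁
  have c2 := continuousOn_slice hK.contDiffOn_L₂.continuousOn ht.1.le ht.2
  have c3 := continuousOn_slice hK.contDiffOn_M₁.continuousOn ht.1.le ht.2
  have c4 := continuousOn_slice hK.contDiffOn_M₂.continuousOn ht.1.le ht.2
  refine (hasDerivAt_hat_of_incoming h ht k).congr_deriv ?_
  have e : hat (fun t s => ft t s - fs t s) t k = hat (fun t s => (I * b t) * K.L₂ t s
      + goursatAlpha lam a b t * K.M₁ t s + goursatBeta lam a t * K.M₂ t s) t k :=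
    hat_congr ht.1 k fun s hs => by
      rw [← hK.eq_L₁ t s ht.2 hs, (h.deriv_t t s hs ht.2).deriv, (h.deriv_s t s hs ht.2).deriv]
  rw [e, hat_add ht.1.le k (by fun_prop) (by fun_prop), hat_add ht.1.le k (by fun_prop)
    (by fun_prop), hat_const_mul _ (fun t => I * b t), hat_const_mul, hat_const_mul,
    hK.init_L₁ t ⟨ht.1.le, ht.2⟩]
  ring

theorem GLMKernels.Solves.hasDerivAt_hat_M₁ (hK : K.Solves lam T a b) {t : ℝ} (ht : t ∈ Ioo 0 T)
    (k : ℂ) : HasDerivAt (fun τ => hat K.M₁ τ k)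
      (2 * a t - 4 * I * k ^ 2 * hat K.M₁ t k + (2 * a t * hat K.L₂ t k
        + I * b t * hat K.M₂ t k)) t := by
  have hT : 0 < T := ht.1.trans ht.2
  obtain ⟨ft, fs, h⟩ := exists_hasPartials hT hK.contDiffOn_M₁
  have c2 := continuousOn_slice hK.contDiffOn_L₂.continuousOn ht.1.le ht.2
  have c4 := continuousOn_slice hK.contDiffOn_M₂.continuousOn ht.1.le ht.2
  refine (hasDerivAt_hat_of_incoming h ht k).congr_deriv ?_
  have e : hat (fun t s => ft t s - fs t s) t k = hat (fun t s => (2 * a t) * K.L₂ t s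
      + (I * b t) * K.M₂ t s) t k :=
    hat_congr ht.1 k fun s hs => by
      rw [← hK.eq_M₁ t s ht.2 hs, (h.deriv_t t s hs ht.2).deriv, (h.deriv_s t s hs ht.2).deriv]
  rw [e, hat_add ht.1.le k (by fun_prop) (by fun_prop), hat_const_mul _ (fun t => 2 * a t),
    hat_const_mul _ (fun t => I * b t), hK.init_M₁ t ⟨ht.1.le, ht.2⟩]

theorem GLMKernels.Solves.hasDerivAt_hat_L₂ (hK : K.Solves lam T a b) {t : ℝ} (ht : t ∈ Ioo 0 T)
    (k : ℂ) : HasDerivAt (fun τ => hat K.L₂ τ k)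
      (-I * lam * starRingEnd ℂ (b t) * hat K.L₁ t k - goursatAlpha lam a b t * hat K.M₂ t k
        + lam * starRingEnd ℂ (goursatBeta lam a t) * hat K.M₁ t k) t := by
  have hT : 0 < T := ht.1.trans ht.2
  obtain ⟨ft, fs, h⟩ := exists_hasPartials hT hK.contDiffOn_L₂
  have c2 := continuousOn_slice hK.contDiffOn_L₁.continuousOn ht.1.le ht.2
  have c3 := continuousOn_slice hK.contDiffOn_M₁.continuousOn ht.1.le ht.2
  have c4 := continuousOn_slice hK.contDiffOn_M₂.continuousOn ht.1.le ht.2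
  refine (hasDerivAt_hat_of_outgoing h ht k (hK.init_L₂ t ⟨ht.1.le, ht.2⟩)).congr_deriv ?_
  have e : hat (fun t s => ft t s + fs t s) t k =
      hat (fun t s => (-I * lam * starRingEnd ℂ (b t)) * K.L₁ t s
      + (-goursatAlpha lam a b t) * K.M₂ t s
      + (lam * starRingEnd ℂ (goursatBeta lam a t)) * K.M₁ t s) t k :=
    hat_congr ht.1 k fun s hs => by
      have := hK.eq_L₂ t s ht.2 hs
      rw [(h.deriv_t t s hs ht.2).deriv, (h.deriv_s t s hs ht.2).deriv] at this
      rw [this]; ring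
  rw [e, hat_add ht.1.le k (by fun_prop) (by fun_prop), hat_add ht.1.le k (by fun_prop)
    (by fun_prop), hat_const_mul _ (fun t => -I * lam * starRingEnd ℂ (b t)),
    hat_const_mul _ (fun t => -goursatAlpha lam a b t),
    hat_const_mul _ (fun t => lam * starRingEnd ℂ (goursatBeta lam a t))]
  ring

theorem GLMKernels.Solves.hasDerivAt_hat_M₂ (hK : K.Solves lam T a b) {t : ℝ} (ht : t ∈ Ioo 0 T)
    (k : ℂ) : HasDerivAt (fun τ => hat K.M₂ τ k)
      (2 * lam * starRingEnd ℂ (a t) * hat K.L₁ t k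
        - I * lam * starRingEnd ℂ (b t) * hat K.M₁ t k) t := by
  have hT : 0 < T := ht.1.trans ht.2
  obtain ⟨ft, fs, h⟩ := exists_hasPartials hT hK.contDiffOn_M₂
  have c2 := continuousOn_slice hK.contDiffOn_L₁.continuousOn ht.1.le ht.2
  have c3 := continuousOn_slice hK.contDiffOn_M₁.continuousOn ht.1.le ht.2
  refine (hasDerivAt_hat_of_outgoing h ht k (hK.init_M₂ t ⟨ht.1.le, ht.2⟩)).congr_deriv ?_
  have e : hat (fun t s => ft t s + fs t s) t k =
      hat (fun t s => (2 * lam * starRingEnd ℂ (a t)) * K.L₁ t s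
      + (-(I * lam * starRingEnd ℂ (b t))) * K.M₁ t s) t k :=
    hat_congr ht.1 k fun s hs => by
      have := hK.eq_M₂ t s ht.2 hs
      rw [(h.deriv_t t s hs ht.2).deriv, (h.deriv_s t s hs ht.2).deriv] at this
      rw [this]; ring
  rw [e, hat_add ht.1.le k (by fun_prop) (by fun_prop),
    hat_const_mul _ (fun t => 2 * lam * starRingEnd ℂ (a t)),
    hat_const_mul _ (fun t => -(I * lam * starRingEnd ℂ (b t)))]
  ring

end Solves

/-! ### The Gelfand-Levitan-Marchenko representation -/

theorem hasDerivAt_primitive {T t : ℝ} {g : ℝ → ℂ} (hg : ContinuousOn g (Ico 0 T))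
    (ht : t ∈ Ioo 0 T) : HasDerivAt (fun u => ∫ τ in (0 : ℝ)..u, g τ) (g t) t := by
  have hg' : ContinuousOn g (Ioo 0 T) := hg.mono Ioo_subset_Ico_self
  refine intervalIntegral.integral_hasDerivAt_right ?_
    (hg'.stronglyMeasurableAtFilter isOpen_Ioo t ht) (hg'.continuousAt (isOpen_Ioo.mem_nhds ht))
  refine ContinuousOn.intervalIntegrable ?_
  rw [uIcc_of_le ht.1.le]
  exact hg.mono fun x hx => ⟨hx.1, hx.2.trans_lt ht.2⟩

theorem hasDerivAt_conj {f : ℝ → ℂ} {f' : ℂ} {t : ℝ} (hf : HasDerivAt f f' t) :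
    HasDerivAt (fun τ => starRingEnd ℂ (f τ)) (starRingEnd ℂ f') t := by
  exact (conjCLE.toContinuousLinearMap.hasFDerivAt (x := f t)).comp_hasDerivAt t hf

theorem mul_conj_eq_norm_sq (z : ℂ) : z * starRingEnd ℂ z = ((‖z‖ ^ 2 : ℝ) : ℂ) := by
  rw [mul_conj, normSq_eq_norm_sq]

/-- Gronwall's inequality started at ε > 0, followed by ε → 0: differentiability is known only on
the open side of 0, so the initial value enters as a limit. -/
theorem eq_zero_of_norm_deriv_le {E : Type*} [NormedAddCommGroup E] [NormedSpace ℝ E]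
    {w w' : ℝ → E} {t C : ℝ} (ht : 0 < t) (hw : ∀ τ ∈ Ioc 0 t, HasDerivAt w (w' τ) τ)
    (hb : ∀ τ ∈ Ioc 0 t, ‖w' τ‖ ≤ C * ‖w τ‖) (h0 : Tendsto w (𝓝[>] 0) (𝓝 0)) : w t = 0 := by
  have hC : ∀ ε ∈ Ioo 0 t, ‖w t‖ ≤ ‖w ε‖ * Real.exp (|C| * t) := by
    intro ε hε
    have := norm_le_gronwallBound_of_norm_deriv_right_le (f := w) (f' := w') (δ := ‖w ε‖)
      (K := C) (ε := 0) (a := ε) (b := t)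
      (fun x hx => (hw x ⟨hε.1.trans_le hx.1, hx.2⟩).continuousAt.continuousWithinAt)
      (fun x hx => (hw x ⟨hε.1.trans_le hx.1, hx.2.le⟩).hasDerivWithinAt) le_rfl
      (fun x hx => by simpa using hb x ⟨hε.1.trans_le hx.1, hx.2.le⟩) t ⟨hε.2.le, le_rfl⟩
    rw [gronwallBound_ε0] at this
    refine this.trans ?_
    gcongr
    · linarith [hε.2]
    · exact le_abs_self C
    · linarith [hε.1]
  have h1 : Tendsto (fun ε => ‖w ε‖ * Real.exp (|C| * t)) (𝓝[>] 0) (𝓝 0) := by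
    simpa using h0.norm.mul_const (Real.exp (|C| * t))
  have h2 : ‖w t‖ ≤ 0 := ge_of_tendsto h1 (by
    filter_upwards [Ioo_mem_nhdsGT ht] with ε hε using hC ε hε)
  exact norm_le_zero_iff.1 h2

theorem IsEigenpair.hasDerivAt_fst {lam T : ℝ} {a b : ℝ → ℂ} {Φ₁ Φ₂ : ℝ → ℂ → ℂ}
    (hΦ : IsEigenpair lam T a b Φ₁ Φ₂) (ha : ContinuousOn a (Ico 0 T))
    (hb : ContinuousOn b (Ico 0 T)) (k : ℂ) {t : ℝ} (ht : t ∈ Ioo 0 T) :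
    HasDerivAt (fun τ => Φ₁ τ k) (-4 * I * k ^ 2 * Φ₁ t k + (-I * lam * (‖a t‖ ^ 2 : ℝ) * Φ₁ t k
      + (2 * k * a t + I * b t) * Φ₂ t k)) t := by
  have c1 := hΦ.continuousOn_fst k
  have c2 := hΦ.continuousOn_snd k
  have hna : ContinuousOn (fun τ => (‖a τ‖ ^ 2 : ℝ)) (Ico 0 T) := by fun_prop
  set g : ℝ → ℂ := fun τ => -I * lam * (‖a τ‖ ^ 2 : ℝ) * Φ₁ τ k
      + (2 * k * a τ + I * b τ) * Φ₂ τ k with hg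
  -- The Volterra kernel depends on the upper limit `t` only through the factor e^{-4ik²t}. With
  -- that factor pulled out, the product rule and the fundamental theorem of calculus apply.
  have hgc : ContinuousOn (fun τ : ℝ => exp (4 * I * k ^ 2 * τ) * g τ) (Ico 0 T) := by
    simp only [hg]; fun_prop
  have h1 := hasDerivAt_primitive hgc ht
  have h2 : HasDerivAt (fun τ : ℝ => exp (-4 * I * k ^ 2 * τ))
      (exp (-4 * I * k ^ 2 * t) * (-4 * I * k ^ 2)) t := by
    refine HasDerivAt.cexp ?_
    simpa only [mul_one] using (hasDerivAt_ofReal t).const_mul (-4 * I * k ^ 2)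
  have h3 := h2.mul h1
  have heq : (fun τ => Φ₁ τ k) =ᶠ[𝓝 t] (fun τ : ℝ => exp (-4 * I * k ^ 2 * τ)) *
      fun u => ∫ τ in (0 : ℝ)..u, exp (4 * I * k ^ 2 * τ) * g τ := by
    filter_upwards [isOpen_Ioo.mem_nhds ht] with u hu
    rw [hΦ.volterra_fst k u ⟨hu.1.le, hu.2⟩, Pi.mul_apply, ← intervalIntegral.integral_const_mul]
    refine intervalIntegral.integral_congr fun τ _ => ?_
    simp only [hg]
    rw [← mul_assoc (exp _), ← exp_add]
    congr 2
    ring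
  refine (h3.congr_of_eventuallyEq heq).congr_deriv ?_
  have e1 := heq.eq_of_nhds
  rw [Pi.mul_apply] at e1
  have e2 : exp (-4 * I * k ^ 2 * t) * exp (4 * I * k ^ 2 * t) = 1 := by
    rw [← exp_add]; simp
  have e3 : g t = -I * lam * (‖a t‖ ^ 2 : ℝ) * Φ₁ t k + (2 * k * a t + I * b t) * Φ₂ t k := rfl
  rw [← e3]
  rw [e1]
  linear_combination (g t) * e2

theorem IsEigenpair.hasDerivAt_snd {lam T : ℝ} {a b : ℝ → ℂ} {Φ₁ Φ₂ : ℝ → ℂ → ℂ}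
    (hΦ : IsEigenpair lam T a b Φ₁ Φ₂) (ha : ContinuousOn a (Ico 0 T))
    (hb : ContinuousOn b (Ico 0 T)) (k : ℂ) {t : ℝ} (ht : t ∈ Ioo 0 T) :
    HasDerivAt (fun τ => Φ₂ τ k) (lam * ((2 * k * starRingEnd ℂ (a t)
      - I * starRingEnd ℂ (b t)) * Φ₁ t k + I * (‖a t‖ ^ 2 : ℝ) * Φ₂ t k)) t := by
  have c1 := hΦ.continuousOn_fst k
  have c2 := hΦ.continuousOn_snd k
  have hna : ContinuousOn (fun τ => (‖a τ‖ ^ 2 : ℝ)) (Ico 0 T) := by fun_prop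
  have hgc : ContinuousOn (fun τ : ℝ => (2 * k * starRingEnd ℂ (a τ)
      - I * starRingEnd ℂ (b τ)) * Φ₁ τ k + I * (‖a τ‖ ^ 2 : ℝ) * Φ₂ τ k) (Ico 0 T) := by
    fun_prop
  refine (((hasDerivAt_primitive hgc ht).const_mul (lam : ℂ)).const_add 1).congr_of_eventuallyEq ?_
  filter_upwards [isOpen_Ioo.mem_nhds ht] with u hu
  exact hΦ.volterra_snd k u ⟨hu.1.le, hu.2⟩

/-- The coefficients α and β are the ones for which both sides solve the same linear system. In
particular the a' in β cancels the a' that arises on differentiating the factor `a` in front of M̂₂,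
and likewise for the conjugate factor in front of M̂₁. Both pairs tend to (0, 1) as t → 0⁺, so
uniqueness applies. -/
theorem IsEigenpair.eq_hat {lam T : ℝ} {a b : ℝ → ℂ} {Φ₁ Φ₂ : ℝ → ℂ → ℂ} {K : GLMKernels}
    (hΦ : IsEigenpair lam T a b Φ₁ Φ₂) (hK : K.Solves lam T a b)
    (ha : ContDiffOn ℝ 1 a (Ico 0 T)) (hb : ContinuousOn b (Ico 0 T)) (k : ℂ) {t : ℝ}
    (ht : t ∈ Ioo 0 T) :
    Φ₁ t k = hat K.L₁ t k - I / 2 * a t * hat K.M₂ t k + k * hat K.M₁ t k ∧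
    Φ₂ t k = 1 + hat K.L₂ t k + I * lam / 2 * starRingEnd ℂ (a t) * hat K.M₁ t k
      + k * hat K.M₂ t k := by
  have hT : 0 < T := ht.1.trans ht.2
  have hac := ha.continuousOn
  have had : ∀ τ ∈ Ioo 0 T, HasDerivAt a (deriv a τ) τ := fun τ hτ =>
    ((ha.differentiableOn one_ne_zero τ ⟨hτ.1.le, hτ.2⟩).differentiableAt
      (Ico_mem_nhds hτ.1 hτ.2)).hasDerivAt
  set X : ℝ → ℂ := fun t => hat K.L₁ t k - I / 2 * a t * hat K.M₂ t k + k * hat K.M₁ t k with hX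
  set Y : ℝ → ℂ := fun t => 1 + hat K.L₂ t k + I * lam / 2 * starRingEnd ℂ (a t) * hat K.M₁ t k
      + k * hat K.M₂ t k with hY
  have dX : ∀ τ ∈ Ioo 0 T, HasDerivAt X (-4 * I * k ^ 2 * X τ + (-I * lam * (‖a τ‖ ^ 2 : ℝ) * X τ
      + (2 * k * a τ + I * b τ) * Y τ)) τ := by
    intro τ hτ
    refine (((hK.hasDerivAt_hat_L₁ hτ k).sub (((had τ hτ).const_mul (I / 2)).mul
      (hK.hasDerivAt_hat_M₂ hτ k))).add ((hK.hasDerivAt_hat_M₁ hτ k).const_mul k)).congr_deriv ?_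
    simp only [hX, hY, ← mul_conj_eq_norm_sq, goursatAlpha, goursatBeta]
    ring_nf
    simp only [I_sq]
    ring
  have dY : ∀ τ ∈ Ioo 0 T, HasDerivAt Y (lam * ((2 * k * starRingEnd ℂ (a τ)
      - I * starRingEnd ℂ (b τ)) * X τ + I * (‖a τ‖ ^ 2 : ℝ) * Y τ)) τ := by
    intro τ hτ
    refine ((((hK.hasDerivAt_hat_L₂ hτ k).const_add 1).add (((hasDerivAt_conj
      (had τ hτ)).const_mul (I * lam / 2)).mul (hK.hasDerivAt_hat_M₁ hτ k))).add
      ((hK.hasDerivAt_hat_M₂ hτ k).const_mul k)).congr_deriv ?_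
    simp only [hX, hY, ← mul_conj_eq_norm_sq, goursatAlpha, goursatBeta, map_mul, map_sub,
      map_div₀, map_one, conj_I, conj_ofReal, conj_conj, map_ofNat]
    ring_nf
    simp only [I_sq]
    ring
  have hIcc : Icc 0 t ⊆ Ico 0 T := fun x hx => ⟨hx.1, hx.2.trans_lt ht.2⟩
  have hbd : ∀ {g : ℝ → ℂ}, ContinuousOn g (Ico 0 T) → ∃ C, 0 ≤ C ∧ ∀ τ ∈ Ioc 0 t, ‖g τ‖ ≤ C := by
    intro g hg
    obtain ⟨C, hC⟩ := isCompact_Icc.exists_bound_of_continuousOn (hg.mono hIcc)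
    exact ⟨C, (norm_nonneg _).trans (hC t ⟨ht.1.le, le_rfl⟩), fun τ hτ => hC τ ⟨hτ.1.le, hτ.2⟩⟩
  have hna : ContinuousOn (fun τ => (‖a τ‖ ^ 2 : ℝ)) (Ico 0 T) := by fun_prop
  obtain ⟨C₁, hC₁0, hC₁⟩ := hbd (g := fun τ => -4 * I * k ^ 2 - I * lam * (‖a τ‖ ^ 2 : ℝ))
    (by fun_prop)
  obtain ⟨C₂, hC₂0, hC₂⟩ := hbd (g := fun τ => 2 * k * a τ + I * b τ) (by fun_prop)
  obtain ⟨C₃, hC₃0, hC₃⟩ := hbd (g := fun τ => lam * (2 * k * starRingEnd ℂ (a τ)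
      - I * starRingEnd ℂ (b τ))) (by fun_prop)
  obtain ⟨C₄, hC₄0, hC₄⟩ := hbd (g := fun τ => lam * (I * (‖a τ‖ ^ 2 : ℝ))) (by fun_prop)
  have hsub : ∀ τ ∈ Ioc 0 t, τ ∈ Ioo 0 T := fun τ hτ => ⟨hτ.1, hτ.2.trans_lt ht.2⟩
  have hX0 : Tendsto X (𝓝[>] 0) (𝓝 0) := by
    have h1 := tendsto_hat_zero hT hK.contDiffOn_L₁.continuousOn k
    have h2 := tendsto_hat_zero hT hK.contDiffOn_M₂.continuousOn k
    have h3 := tendsto_hat_zero hT hK.contDiffOn_M₁.continuousOn k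
    have h4 : Tendsto a (𝓝[>] 0) (𝓝 (a 0)) := ((hac 0 ⟨le_rfl, hT⟩).mono_of_mem_nhdsWithin
      (Ico_mem_nhdsGE hT)).tendsto.mono_left (nhdsWithin_mono _ Ioi_subset_Ici_self)
    simpa using (h1.sub ((h4.const_mul (I / 2)).mul h2)).add (h3.const_mul k)
  have hY0 : Tendsto Y (𝓝[>] 0) (𝓝 1) := by
    have h1 := tendsto_hat_zero hT hK.contDiffOn_L₂.continuousOn k
    have h2 := tendsto_hat_zero hT hK.contDiffOn_M₂.continuousOn k
    have h3 := tendsto_hat_zero hT hK.contDiffOn_M₁.continuousOn k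
    have h4 : Tendsto a (𝓝[>] 0) (𝓝 (a 0)) := ((hac 0 ⟨le_rfl, hT⟩).mono_of_mem_nhdsWithin
      (Ico_mem_nhdsGE hT)).tendsto.mono_left (nhdsWithin_mono _ Ioi_subset_Ici_self)
    have h5 := (Complex.continuous_conj.tendsto _).comp h4
    simpa using ((h1.const_add 1).add ((h5.const_mul (I * lam / 2)).mul h3)).add (h2.const_mul k)
  have hΦ0 : ∀ {Ψ : ℝ → ℂ → ℂ}, ContinuousOn (fun t => Ψ t k) (Ico 0 T) →
      Tendsto (fun τ => Ψ τ k) (𝓝[>] 0) (𝓝 (Ψ 0 k)) := fun h =>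
    ((h 0 ⟨le_rfl, hT⟩).mono_of_mem_nhdsWithin
      (Ico_mem_nhdsGE hT)).tendsto.mono_left (nhdsWithin_mono _ Ioi_subset_Ici_self)
  have h10 : Φ₁ 0 k = 0 := by rw [hΦ.volterra_fst k 0 ⟨le_rfl, hT⟩]; simp
  have h20 : Φ₂ 0 k = 1 := by rw [hΦ.volterra_snd k 0 ⟨le_rfl, hT⟩]; simp
  -- The difference solves the homogeneous system. Its four coefficients are bounded on (0, t], and
  -- the sum of the bounds serves as one Gronwall constant for the sup norm of the pair.
  have key := eq_zero_of_norm_deriv_le (w := fun τ => (Φ₁ τ k - X τ, Φ₂ τ k - Y τ)) ht.1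
    (C := C₁ + C₂ + C₃ + C₄)
    (fun τ hτ => ((hΦ.hasDerivAt_fst hac hb k (hsub τ hτ)).sub (dX τ (hsub τ hτ))).prodMk
      ((hΦ.hasDerivAt_snd hac hb k (hsub τ hτ)).sub (dY τ (hsub τ hτ)))) ?_ ?_
  · simp only [Prod.mk_eq_zero] at key
    exact ⟨sub_eq_zero.1 key.1, sub_eq_zero.1 key.2⟩
  · intro τ hτ
    set z := Φ₁ τ k - X τ with hz
    set w := Φ₂ τ k - Y τ with hw
    have hzn : ‖z‖ ≤ ‖(z, w)‖ := norm_fst_le (z, w)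
    have hwn : ‖w‖ ≤ ‖(z, w)‖ := norm_snd_le (z, w)
    have b1 := hC₁ τ hτ
    have b2 := hC₂ τ hτ
    have b3 := hC₃ τ hτ
    have b4 := hC₄ τ hτ
    have hn := norm_nonneg (z, w)
    have comb : ∀ {p q : ℂ} {A B : ℝ}, 0 ≤ A → 0 ≤ B → ‖p‖ ≤ A → ‖q‖ ≤ B →
        ‖p * z + q * w‖ ≤ (A + B) * ‖(z, w)‖ := by
      intro p q A B hA hB hp hq
      refine (norm_add_le _ _).trans ?_
      rw [norm_mul, norm_mul, add_mul]
      gcongr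
    refine norm_prod_le_iff.2 ⟨?_, ?_⟩
    · refine le_trans (le_of_eq ?_) ((comb hC₁0 hC₂0 b1 b2).trans ?_)
      · congr 1; simp only [hz, hw]; ring
      · exact mul_le_mul_of_nonneg_right (by linarith) hn
    · refine le_trans (le_of_eq ?_) ((comb hC₃0 hC₄0 b3 b4).trans ?_)
      · congr 1; simp only [hz, hw]; ring
      · exact mul_le_mul_of_nonneg_right (by linarith) hn
  · have h1 := (hΦ0 (hΦ.continuousOn_fst k)).sub hX0
    have h2 := (hΦ0 (hΦ.continuousOn_snd k)).sub hY0
    rw [h10, sub_zero] at h1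
    rw [h20, sub_self] at h2
    exact h1.prodMk_nhds h2

end NLSInterval

namespace NLSInterval

open MeasureTheory Asymptotics
open scoped Interval

/-! ### Large-`k` asymptotics of the transforms -/

/-- The set of spectral parameters on which `e^{-4ik²t}` is bounded, away from `k = 0`. -/
def region (C r : ℝ) : Set ℂ := {k | (k ^ 2).im ≤ C ∧ r ≤ ‖k‖}

theorem ne_zero_of_mem_region {C r : ℝ} (hr : 0 < r) {k : ℂ} (hk : k ∈ region C r) : k ≠ 0 :=
  norm_pos_iff.1 (hr.trans_le hk.2)

/-- Integration by parts in `s`, the source of the first O(k⁻²) bound. -/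
theorem hat_mul_add_hat {T τ : ℝ} {f ft fs : ℝ → ℝ → ℂ} (h : HasPartials T f ft fs)
    (hτ : τ ∈ Ioo 0 T) (k : ℂ) :
    2 * I * k ^ 2 * hat f τ k + hat fs τ k =
      f τ τ - exp (2 * I * k ^ 2 * ((-τ : ℝ) - τ)) * f τ (-τ) := by
  have hle : -τ ≤ τ := by linarith [hτ.1]
  have c0 := continuousOn_slice h.cont hτ.1.le hτ.2
  have c1 := continuousOn_slice h.cont_s hτ.1.le hτ.2
  have key := intervalIntegral.integral_eq_sub_of_hasDerivAt_of_le hle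
    (f := fun s : ℝ => exp (2 * I * k ^ 2 * (s - τ)) * f τ s)
    (f' := fun s : ℝ => 2 * I * k ^ 2 * (exp (2 * I * k ^ 2 * (s - τ)) * f τ s)
      + exp (2 * I * k ^ 2 * (s - τ)) * fs τ s) (by fun_prop) ?_ ?_
  · rw [intervalIntegral.integral_add, intervalIntegral.integral_const_mul] at key
    · rw [hat, hat, key]; simp
    · exact (hat_intervalIntegrable hτ.1.le k c0).const_mul _
    · exact hat_intervalIntegrable hτ.1.le k c1
  · intro s hs
    have d1 := h.deriv_s τ s (abs_lt.2 hs) hτ.2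
    have d2 : HasDerivAt (fun s : ℝ => exp (2 * I * k ^ 2 * ((s : ℂ) - τ)))
        (exp (2 * I * k ^ 2 * ((s : ℂ) - τ)) * (2 * I * k ^ 2)) s := by
      refine HasDerivAt.cexp ?_
      simpa only [mul_one] using ((hasDerivAt_ofReal s).sub_const (τ : ℂ)).const_mul (2 * I * k ^ 2)
    refine (d2.mul d1).congr_deriv ?_
    ring
  · refine ContinuousOn.intervalIntegrable ?_
    rw [uIcc_of_le hle]
    fun_prop

theorem isBigO_hat {T t C r : ℝ} {f : ℝ → ℝ → ℂ} (hC : 0 ≤ C) (hr : 0 < r)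
    (hf : ContDiffOn ℝ 1 (fun p : ℝ × ℝ => f p.1 p.2) (triangle T)) (ht : t ∈ Ioo 0 T) :
    (fun x : ℝ × ℂ => hat f x.1 x.2) =O[𝓟 (Ioc 0 t ×ˢ region C r)] fun x => (x.2 ^ 2)⁻¹ := by
  obtain ⟨ft, fs, h⟩ := exists_hasPartials (ht.1.trans ht.2) hf
  obtain ⟨M, hM0, hM⟩ := exists_bound_subtriangle h.cont ht.2
  obtain ⟨M', hM'0, hM'⟩ := exists_bound_subtriangle h.cont_s ht.2
  set E := Real.exp (4 * C * t) with hE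
  rw [isBigO_principal]
  refine ⟨M + E * M + E * M' * (2 * t), ?_⟩
  rintro ⟨τ, k⟩ ⟨hτ, hk⟩
  simp only at hτ hk ⊢
  have hk0 := ne_zero_of_mem_region hr hk
  have h1 := hat_mul_add_hat h ⟨hτ.1, hτ.2.trans_lt ht.2⟩ k
  have b1 : ‖hat fs τ k‖ ≤ E * M' * (2 * t) :=
    (norm_hat_le hC hk.1 hτ.1.le hτ.2 fun s hs => hM' τ s hτ.1.le hτ.2 hs).trans (by
      have := hτ.2; gcongr)
  have hτa : |(-τ)| ≤ τ := by rw [abs_neg, abs_of_pos hτ.1]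
  have b2 : ‖f τ τ‖ ≤ M := hM τ τ hτ.1.le hτ.2 (abs_of_pos hτ.1).le
  have b3 : ‖exp (2 * I * k ^ 2 * ((-τ : ℝ) - τ)) * f τ (-τ)‖ ≤ E * M := by
    rw [norm_mul]
    exact mul_le_mul (norm_exp_kernel_le hC hk.1 hτ.2 hτa) (hM τ (-τ) hτ.1.le hτ.2 hτa)
      (norm_nonneg _) (Real.exp_pos _).le
  have b4 : ‖2 * I * k ^ 2 * hat f τ k‖ ≤ M + E * M + E * M' * (2 * t) := by
    rw [eq_sub_of_add_eq h1]
    exact (norm_sub_le _ _).trans (add_le_add ((norm_sub_le _ _).trans (add_le_add b2 b3)) b1)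
  have hk2 : 0 < ‖k‖ ^ 2 := by have := norm_pos_iff.2 hk0; positivity
  rw [norm_inv, norm_pow, ← div_eq_mul_inv, le_div_iff₀ hk2]
  refine le_trans ?_ b4
  simp only [norm_mul, norm_pow, norm_I, Complex.norm_ofNat]
  nlinarith [mul_nonneg (norm_nonneg (hat f τ k)) hk2.le]

/-- Duhamel's principle, uniform in `k`: with the bounded integrating factor e^{μ(τ-τ₀)}, the value
of `z` is controlled by its initial value and the forcing `r`. The auxiliary `p` encodes the initial
value, since `z` is within O(G) of a function that vanishes at 0⁺. -/
theorem isBigO_of_ode {t E : ℝ} {Ω : Set ℂ} {z r p : ℝ → ℂ → ℂ} {μ G : ℂ → ℂ}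
    (hE : ∀ k ∈ Ω, ∀ τ τ₀ : ℝ, 0 < τ → τ ≤ τ₀ → τ₀ ≤ t → ‖exp (μ k * (τ - τ₀))‖ ≤ E)
    (hz : ∀ k ∈ Ω, ∀ τ ∈ Ioc 0 t, HasDerivAt (fun τ => z τ k) (-μ k * z τ k + r τ k) τ)
    (hr : (fun x : ℝ × ℂ => r x.1 x.2) =O[𝓟 (Ioc 0 t ×ˢ Ω)] fun x => G x.2)
    (hp : ∀ k ∈ Ω, Tendsto (fun τ => p τ k) (𝓝[>] 0) (𝓝 0))
    (hzp : (fun x : ℝ × ℂ => z x.1 x.2 - p x.1 x.2) =O[𝓟 (Ioc 0 t ×ˢ Ω)] fun x => G x.2) :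
    (fun x : ℝ × ℂ => z x.1 x.2) =O[𝓟 (Ioc 0 t ×ˢ Ω)] fun x => G x.2 := by
  rw [isBigO_principal] at hr hzp ⊢
  obtain ⟨A, hA⟩ := hr
  obtain ⟨B, hB⟩ := hzp
  refine ⟨E * B + E * A * t, ?_⟩
  rintro ⟨τ₀, k⟩ ⟨hτ₀, hk⟩
  simp only at hτ₀ hk ⊢
  have hE0 : 0 ≤ E := (norm_nonneg _).trans (hE k hk τ₀ τ₀ hτ₀.1 le_rfl hτ₀.2)
  have hA' : ∀ τ ∈ Ioc 0 t, ‖r τ k‖ ≤ A * ‖G k‖ := fun τ hτ => hA (τ, k) ⟨hτ, hk⟩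
  have hB' : ∀ τ ∈ Ioc 0 t, ‖z τ k - p τ k‖ ≤ B * ‖G k‖ := fun τ hτ => hB (τ, k) ⟨hτ, hk⟩
  have hAG : 0 ≤ A * ‖G k‖ := (norm_nonneg _).trans (hA' τ₀ hτ₀)
  -- The estimate starts at ε because the ODE is not assumed at 0; the limit ε → 0 removes the term
  -- in `p`.
  have key : ∀ ε ∈ Ioo 0 τ₀, ‖z τ₀ k‖ ≤ E * (B * ‖G k‖ + ‖p ε k‖) + E * (A * ‖G k‖) * t := by
    intro ε hε
    have hd : ∀ τ ∈ Icc ε τ₀, HasDerivWithinAt (fun τ : ℝ => exp (μ k * (τ - τ₀)) * z τ k)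
        (exp (μ k * (τ - τ₀)) * r τ k) (Icc ε τ₀) τ := by
      intro τ hτ
      have d2 : HasDerivAt (fun τ : ℝ => exp (μ k * ((τ : ℂ) - τ₀)))
          (exp (μ k * ((τ : ℂ) - τ₀)) * μ k) τ := by
        refine HasDerivAt.cexp ?_
        simpa only [mul_one] using ((hasDerivAt_ofReal τ).sub_const (τ₀ : ℂ)).const_mul (μ k)
      refine ((d2.mul (hz k hk τ ⟨hε.1.trans_le hτ.1, hτ.2.trans hτ₀.2⟩)).congr_deriv
        ?_).hasDerivWithinAt
      ring
    have h1 := norm_image_sub_le_of_norm_deriv_le_segment' (C := E * (A * ‖G k‖)) hd (by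
      intro τ hτ
      rw [norm_mul]
      have hτ0 := hε.1.trans_le hτ.1
      exact mul_le_mul (hE k hk τ τ₀ hτ0 hτ.2.le hτ₀.2)
        (hA' τ ⟨hτ0, hτ.2.le.trans hτ₀.2⟩) (norm_nonneg _) hE0) τ₀ ⟨hε.2.le, le_rfl⟩
    simp only [sub_self, mul_zero, exp_zero, one_mul] at h1
    have h2 : ‖z τ₀ k‖ ≤ ‖exp (μ k * (ε - τ₀)) * z ε k‖ + E * (A * ‖G k‖) * (τ₀ - ε) := by
      have := norm_le_insert' (z τ₀ k) (exp (μ k * (ε - τ₀)) * z ε k)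
      linarith
    have h3 : ‖exp (μ k * (ε - τ₀)) * z ε k‖ ≤ E * (B * ‖G k‖ + ‖p ε k‖) := by
      rw [norm_mul]
      refine mul_le_mul (hE k hk ε τ₀ hε.1 hε.2.le hτ₀.2) ?_ (norm_nonneg _) hE0
      have h4 := norm_le_insert' (z ε k) (p ε k)
      linarith [hB' ε ⟨hε.1, hε.2.le.trans hτ₀.2⟩]
    refine h2.trans (add_le_add h3 ?_)
    have h5 := hτ₀.2
    have h6 := hε.1
    gcongr
    linarith
  have hlim : Tendsto (fun ε => E * (B * ‖G k‖ + ‖p ε k‖) + E * (A * ‖G k‖) * t) (𝓝[>] 0)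
      (𝓝 (E * (B * ‖G k‖ + ‖(0 : ℂ)‖) + E * (A * ‖G k‖) * t)) :=
    ((((hp k hk).norm).const_add _).const_mul E).add_const _
  have := ge_of_tendsto hlim (by
    filter_upwards [Ioo_mem_nhdsGT hτ₀.1] with ε hε using key ε hε)
  refine this.trans_eq ?_
  simp
  ring

theorem exists_second_derivative {T : ℝ} {a : ℝ → ℂ} (ha : ContDiffOn ℝ 2 a (Ico 0 T)) :
    ∃ a₁ a₂ : ℝ → ℂ, ContinuousOn a₁ (Ico 0 T) ∧ ContinuousOn a₂ (Ico 0 T) ∧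
      ∀ τ ∈ Ioo 0 T, HasDerivAt a (a₁ τ) τ ∧ HasDerivAt a₁ (a₂ τ) τ := by
  have hU : UniqueDiffOn ℝ (Ico 0 T) := uniqueDiffOn_Ico 0 T
  have h1 : ContDiffOn ℝ 1 (derivWithin a (Ico 0 T)) (Ico 0 T) := ha.derivWithin hU (by norm_num)
  have h2 : ContinuousOn (derivWithin (derivWithin a (Ico 0 T)) (Ico 0 T)) (Ico 0 T) :=
    h1.continuousOn_derivWithin hU le_rfl
  refine ⟨_, _, h1.continuousOn, h2, fun τ hτ => ⟨?_, ?_⟩⟩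
  · exact ((ha.differentiableOn (by norm_num)) τ
      ⟨hτ.1.le, hτ.2⟩).hasDerivWithinAt.hasDerivAt (Ico_mem_nhds hτ.1 hτ.2)
  · exact ((h1.differentiableOn (by norm_num)) τ
      ⟨hτ.1.le, hτ.2⟩).hasDerivWithinAt.hasDerivAt (Ico_mem_nhds hτ.1 hτ.2)

theorem exists_first_derivative {T : ℝ} {b : ℝ → ℂ} (hb : ContDiffOn ℝ 1 b (Ico 0 T)) :
    ∃ b₁ : ℝ → ℂ, ContinuousOn b₁ (Ico 0 T) ∧ ∀ τ ∈ Ioo 0 T, HasDerivAt b (b₁ τ) τ := by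
  refine ⟨_, hb.continuousOn_derivWithin (uniqueDiffOn_Ico 0 T) le_rfl, fun τ hτ => ?_⟩
  exact ((hb.differentiableOn (by norm_num)) τ
      ⟨hτ.1.le, hτ.2⟩).hasDerivWithinAt.hasDerivAt (Ico_mem_nhds hτ.1 hτ.2)

/-- The function `h` need agree with the continuous `g` only on (0, t]. This admits β, whose
two-sided `deriv a` may have the wrong value at 0. -/
theorem isBigO_coeff {T t : ℝ} {Ω : Set ℂ} {g h : ℝ → ℂ} (hg : ContinuousOn g (Ico 0 T))
    (ht : t < T) (hh : ∀ τ ∈ Ioc 0 t, h τ = g τ) :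
    (fun x : ℝ × ℂ => h x.1) =O[𝓟 (Ioc 0 t ×ˢ Ω)] fun _ => (1 : ℂ) := by
  obtain ⟨C, hC⟩ := isCompact_Icc.exists_bound_of_continuousOn
    (hg.mono fun x (hx : x ∈ Icc 0 t) => ⟨hx.1, hx.2.trans_lt ht⟩)
  rw [isBigO_principal]
  refine ⟨C, ?_⟩
  rintro ⟨τ, k⟩ ⟨hτ, -⟩
  simpa [hh τ hτ] using hC τ ⟨hτ.1.le, hτ.2⟩

theorem IsBigO.bdd_mul {α : Type*} {l : Filter α} {c f G : α → ℂ}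
    (hc : c =O[l] fun _ => (1 : ℂ)) (hf : f =O[l] G) : (fun x => c x * f x) =O[l] G := by
  simpa using hc.mul hf

section Asymptotics

variable {lam T : ℝ} {a b : ℝ → ℂ} {K : GLMKernels}

theorem isBigO_goursatAlpha {t : ℝ} {Ω : Set ℂ} (ha : ContinuousOn a (Ico 0 T))
    (hb : ContinuousOn b (Ico 0 T)) (ht : t < T) :
    (fun x : ℝ × ℂ => goursatAlpha lam a b x.1) =O[𝓟 (Ioc 0 t ×ˢ Ω)] fun _ => (1 : ℂ) := by
  refine isBigO_coeff (g := goursatAlpha lam a b) ?_ ht fun _ _ => rfl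
  unfold goursatAlpha
  fun_prop

theorem isBigO_goursatBeta {t : ℝ} {Ω : Set ℂ} {a₁ : ℝ → ℂ} (ha : ContinuousOn a (Ico 0 T))
    (ha₁ : ContinuousOn a₁ (Ico 0 T)) (h : ∀ τ ∈ Ioo 0 T, HasDerivAt a (a₁ τ) τ) (ht : t < T) :
    (fun x : ℝ × ℂ => goursatBeta lam a x.1) =O[𝓟 (Ioc 0 t ×ˢ Ω)] fun _ => (1 : ℂ) := by
  have hna : ContinuousOn (fun τ => (‖a τ‖ ^ 2 : ℝ)) (Ico 0 T) := by fun_prop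
  refine isBigO_coeff (g := fun τ => 1 / 2 * (I * a₁ τ - lam * (‖a τ‖ ^ 2 : ℝ) * a τ)) ?_ ht
    fun τ hτ => ?_
  · fun_prop
  · rw [goursatBeta, (h τ ⟨hτ.1, hτ.2.trans_lt ht⟩).deriv]

/-- The ODE reads M̂₁' = -4ik²M̂₁ + S with S = 2a + 2aL̂₂ + ibM̂₂, so M̂₁ follows S/(4ik²), whose
leading term is a/(2ik²). The initial layer e^{-4ik²t}·a(0)/k², not small in this region, is absent
because a(0) = 0. -/
theorem GLMKernels.Solves.isBigO_hat_M₁ (hK : K.Solves lam T a b)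
    (ha : ContDiffOn ℝ 2 a (Ico 0 T)) (hb : ContDiffOn ℝ 1 b (Ico 0 T)) (ha0 : a 0 = 0)
    {t C r : ℝ} (hC : 0 ≤ C) (hr : 0 < r) (ht : t ∈ Ioo 0 T) :
    (fun x : ℝ × ℂ => hat K.M₁ x.1 x.2 - a x.1 / (2 * I) * (x.2 ^ 2)⁻¹)
      =O[𝓟 (Ioc 0 t ×ˢ region C r)] fun x => (x.2 ^ 2)⁻¹ * (x.2 ^ 2)⁻¹ := by
  have hT : 0 < T := ht.1.trans ht.2
  obtain ⟨a₁, a₂, ca₁, ca₂, da⟩ := exists_second_derivative ha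
  obtain ⟨b₁, cb₁, db⟩ := exists_first_derivative hb
  have ca := ha.continuousOn
  have cb := hb.continuousOn
  have O1 := isBigO_hat hC hr hK.contDiffOn_L₁ ht
  have O2 := isBigO_hat hC hr hK.contDiffOn_L₂ ht
  have O3 := isBigO_hat hC hr hK.contDiffOn_M₁ ht
  have O4 := isBigO_hat hC hr hK.contDiffOn_M₂ ht
  have hco : ∀ {g : ℝ → ℂ}, ContinuousOn g (Ico 0 T) → (fun x : ℝ × ℂ => g x.1)
      =O[𝓟 (Ioc 0 t ×ˢ region C r)] fun _ => (1 : ℂ) := fun hg => isBigO_coeff hg ht.2 fun _ _ => rfl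
  have hα : (fun x : ℝ × ℂ => goursatAlpha lam a b x.1)
    =O[𝓟 (Ioc 0 t ×ˢ region C r)] fun _ => (1 : ℂ) := isBigO_goursatAlpha ca cb ht.2
  have hβ : (fun x : ℝ × ℂ => starRingEnd ℂ (goursatBeta lam a x.1))
      =O[𝓟 (Ioc 0 t ×ˢ region C r)] fun _ => (1 : ℂ) := by
    have h := isBigO_goursatBeta (lam := lam) (Ω := region C r) ca ca₁ (fun τ hτ => (da τ hτ).1) ht.2
    rw [← isBigO_norm_left] at h ⊢
    simpa only [RCLike.norm_conj] using h
  have hsub : ∀ τ ∈ Ioc 0 t, τ ∈ Ioo 0 T := fun τ hτ => ⟨hτ.1, hτ.2.trans_lt ht.2⟩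
  have hk2 : (fun x : ℝ × ℂ => (x.2 ^ 2)⁻¹) =O[𝓟 (Ioc 0 t ×ˢ region C r)]
    fun x => (x.2 ^ 2)⁻¹ := isBigO_refl _ _
  set l₂' : ℝ → ℂ → ℂ := fun t k => -I * lam * starRingEnd ℂ (b t) * hat K.L₁ t k
    - goursatAlpha lam a b t * hat K.M₂ t k
    + lam * starRingEnd ℂ (goursatBeta lam a t) * hat K.M₁ t k with hl₂'
  set m₂' : ℝ → ℂ → ℂ := fun t k => 2 * lam * starRingEnd ℂ (a t) * hat K.L₁ t k
        - I * lam * starRingEnd ℂ (b t) * hat K.M₁ t k with hm₂'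
  have Ol : (fun x : ℝ × ℂ => l₂' x.1 x.2) =O[𝓟 (Ioc 0 t ×ˢ region C r)]
      fun x => (x.2 ^ 2)⁻¹ := by
    refine ((IsBigO.bdd_mul (hco (g := fun τ => -I * lam * starRingEnd ℂ (b τ)) (by fun_prop))
      O1).sub (IsBigO.bdd_mul hα O4)).add (IsBigO.bdd_mul ?_ O3)
    exact hβ.const_mul_left _
  have Om : (fun x : ℝ × ℂ => m₂' x.1 x.2) =O[𝓟 (Ioc 0 t ×ˢ region C r)]
      fun x => (x.2 ^ 2)⁻¹ :=
    (IsBigO.bdd_mul (hco (g := fun τ => 2 * lam * starRingEnd ℂ (a τ)) (by fun_prop)) O1).sub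
      (IsBigO.bdd_mul (hco (g := fun τ => I * lam * starRingEnd ℂ (b τ)) (by fun_prop)) O3)
  set S : ℝ → ℂ → ℂ := fun τ k => 2 * a τ + 2 * a τ * hat K.L₂ τ k + I * b τ * hat K.M₂ τ k with hS
  set s' : ℝ → ℂ → ℂ := fun τ k => (2 * a₁ τ * hat K.L₂ τ k + 2 * a τ * l₂' τ k)
    + (I * b₁ τ * hat K.M₂ τ k + I * b τ * m₂' τ k) with hs'
  have Os : (fun x : ℝ × ℂ => s' x.1 x.2) =O[𝓟 (Ioc 0 t ×ˢ region C r)]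
      fun x => (x.2 ^ 2)⁻¹ :=
    ((IsBigO.bdd_mul (hco (g := fun τ => 2 * a₁ τ) (by fun_prop)) O2).add
      (IsBigO.bdd_mul (hco (g := fun τ => 2 * a τ) (by fun_prop)) Ol)).add
    ((IsBigO.bdd_mul (hco (g := fun τ => I * b₁ τ) (by fun_prop)) O4).add
      (IsBigO.bdd_mul (hco (g := fun τ => I * b τ) (by fun_prop)) Om))
  have O0 : (fun x : ℝ × ℂ => 2 * a₁ x.1 * (4 * I)⁻¹ ^ 2 * ((x.2 ^ 2)⁻¹ * (x.2 ^ 2)⁻¹))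
      =O[𝓟 (Ioc 0 t ×ˢ region C r)] fun x => (x.2 ^ 2)⁻¹ * (x.2 ^ 2)⁻¹ :=
    IsBigO.bdd_mul (hco (g := fun τ => 2 * a₁ τ * (4 * I)⁻¹ ^ 2) (by fun_prop)) (hk2.mul hk2)
  -- The derivative of S contains 2a', which is only O(1) and would leave a forcing of order k⁻².
  -- The extra term 2a'/((4i)²k⁴) in `z` cancels it, at the price of a'' in the forcing, which is
  -- why `a` is taken C². This extra term need not vanish at 0, so `p` omits it.
  have OZ := isBigO_of_ode (t := t) (E := Real.exp (4 * C * t)) (Ω := region C r)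
    (μ := fun k => 4 * I * k ^ 2) (G := fun k => (k ^ 2)⁻¹ * (k ^ 2)⁻¹)
    (z := fun τ k => hat K.M₁ τ k - (4 * I)⁻¹ * (k ^ 2)⁻¹ * S τ k
      + 2 * a₁ τ * (4 * I)⁻¹ ^ 2 * ((k ^ 2)⁻¹ * (k ^ 2)⁻¹))
    (p := fun τ k => hat K.M₁ τ k - (4 * I)⁻¹ * (k ^ 2)⁻¹ * S τ k)
    (r := fun τ k => -((4 * I)⁻¹ * ((k ^ 2)⁻¹ * s' τ k))
      + 2 * a₂ τ * (4 * I)⁻¹ ^ 2 * ((k ^ 2)⁻¹ * (k ^ 2)⁻¹)) ?_ ?_ ?_ ?_ ?_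
  · have O5 : (fun x : ℝ × ℂ => (4 * I)⁻¹ * ((x.2 ^ 2)⁻¹ * (2 * a x.1 * hat K.L₂ x.1 x.2
        + I * b x.1 * hat K.M₂ x.1 x.2))) =O[𝓟 (Ioc 0 t ×ˢ region C r)]
        fun x => (x.2 ^ 2)⁻¹ * (x.2 ^ 2)⁻¹ :=
      (hk2.mul ((IsBigO.bdd_mul (hco (g := fun τ => 2 * a τ) (by fun_prop)) O2).add
        (IsBigO.bdd_mul (hco (g := fun τ => I * b τ) (by fun_prop)) O4))).const_mul_left _
    refine ((OZ.add O5).sub O0).congr_left ?_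
    rintro ⟨τ, k⟩
    simp only [hS]
    have : (4 * I)⁻¹ * 2 = (2 * I)⁻¹ := by
      field_simp
      norm_num
    rw [div_eq_mul_inv, ← this]
    ring
  · intro k hk τ τ₀ h0 h1 h2
    -- With this choice s - τ in the lemma equals -2(τ₀ - τ), so the exponent is 4ik²(τ - τ₀).
    have := norm_exp_kernel_le (τ := (τ₀ - τ)) (s := -(τ₀ - τ)) hC hk.1 (by linarith : τ₀ - τ ≤ t)
      (by rw [abs_neg, abs_of_nonneg (by linarith)])
    refine le_trans (le_of_eq ?_) this
    congr 2
    push_cast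
    ring
  · intro k hk τ hτ
    have hk0 := ne_zero_of_mem_region hr hk
    have hτ' := hsub τ hτ
    have d1 := (da τ hτ').1
    have d2 := (da τ hτ').2
    have d3 := db τ hτ'
    have dS : HasDerivAt (fun τ => S τ k) (2 * a₁ τ + s' τ k) τ := by
      refine (((d1.const_mul 2).add ((d1.const_mul 2).mul (hK.hasDerivAt_hat_L₂ hτ' k))).add
        ((d3.const_mul I).mul (hK.hasDerivAt_hat_M₂ hτ' k))).congr_deriv ?_
      simp only [hs', hl₂', hm₂']
      ring
    refine (((hK.hasDerivAt_hat_M₁ hτ' k).sub (dS.const_mul _)).add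
      (((d2.const_mul 2).mul_const _).mul_const _)).congr_deriv ?_
    simp only [hS]
    field_simp
    ring
  · exact ((hk2.mul Os).const_mul_left _).neg_left.add
      (IsBigO.bdd_mul (hco (g := fun τ => 2 * a₂ τ * (4 * I)⁻¹ ^ 2) (by fun_prop)) (hk2.mul hk2))
  · intro k hk
    have h2 := tendsto_hat_zero hT hK.contDiffOn_L₂.continuousOn k
    have h3 := tendsto_hat_zero hT hK.contDiffOn_M₁.continuousOn k
    have h4 := tendsto_hat_zero hT hK.contDiffOn_M₂.continuousOn k
    have hlim : ∀ {g : ℝ → ℂ}, ContinuousOn g (Ico 0 T) → Tendsto g (𝓝[>] 0) (𝓝 (g 0)) := fun h =>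
      ((h 0 ⟨le_rfl, hT⟩).mono_of_mem_nhdsWithin
        (Ico_mem_nhdsGE hT)).tendsto.mono_left (nhdsWithin_mono _ Ioi_subset_Ici_self)
    have h5 := hlim ca
    rw [ha0] at h5
    have h6 := hlim cb
    simpa using h3.sub ((((h5.const_mul 2).add ((h5.const_mul 2).mul h2)).add
      ((h6.const_mul I).mul h4)).const_mul ((4 * I)⁻¹ * (k ^ 2)⁻¹))
  · refine O0.congr_left ?_
    rintro ⟨τ, k⟩
    ring

/-- To leading order M̂₁ contributes -λab̄/(2k²) to M̂₂', and L̂₁ contributes λāb/(2k²) plus a total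
derivative; the sum is iλ Im(āb)/k². The primitive of λ Im(āb) is the real constant `c`, and its
reality is what later makes kM̂₂ and its Schwarz conjugate have equal integrals. -/
theorem GLMKernels.Solves.isBigO_hat_M₂ (hK : K.Solves lam T a b)
    (ha : ContDiffOn ℝ 2 a (Ico 0 T)) (hb : ContDiffOn ℝ 1 b (Ico 0 T)) (ha0 : a 0 = 0)
    {t C r : ℝ} (hC : 0 ≤ C) (hr : 0 < r) (ht : t ∈ Ioo 0 T) :
    ∃ c : ℝ, (fun k : ℂ => hat K.M₂ t k - I * c * (k ^ 2)⁻¹)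
      =O[𝓟 (region C r)] fun k => (k ^ 2)⁻¹ * (k ^ 2)⁻¹ := by
  have hT : 0 < T := ht.1.trans ht.2
  obtain ⟨a₁, a₂, ca₁, ca₂, da⟩ := exists_second_derivative ha
  have ca := ha.continuousOn
  have cb := hb.continuousOn
  have O1 := isBigO_hat hC hr hK.contDiffOn_L₁ ht
  have O2 := isBigO_hat hC hr hK.contDiffOn_L₂ ht
  have O3 := isBigO_hat hC hr hK.contDiffOn_M₁ ht
  have O4 := isBigO_hat hC hr hK.contDiffOn_M₂ ht
  have O5 := hK.isBigO_hat_M₁ ha hb ha0 hC hr ht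
  have hco : ∀ {g : ℝ → ℂ}, ContinuousOn g (Ico 0 T) → (fun x : ℝ × ℂ => g x.1)
      =O[𝓟 (Ioc 0 t ×ˢ region C r)] fun _ => (1 : ℂ) := fun hg => isBigO_coeff hg ht.2 fun _ _ => rfl
  have hα : (fun x : ℝ × ℂ => goursatAlpha lam a b x.1)
    =O[𝓟 (Ioc 0 t ×ˢ region C r)] fun _ => (1 : ℂ) := isBigO_goursatAlpha ca cb ht.2
  have hβ := isBigO_goursatBeta (lam := lam) (Ω := region C r) ca ca₁ (fun τ hτ => (da τ hτ).1) ht.2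
  have hsub : ∀ τ ∈ Ioc 0 t, τ ∈ Ioo 0 T := fun τ hτ => ⟨hτ.1, hτ.2.trans_lt ht.2⟩
  have hk2 : (fun x : ℝ × ℂ => (x.2 ^ 2)⁻¹) =O[𝓟 (Ioc 0 t ×ˢ region C r)]
    fun x => (x.2 ^ 2)⁻¹ := isBigO_refl _ _
  set g : ℝ → ℂ := fun τ => ((lam * (starRingEnd ℂ (a τ) * b τ).im : ℝ) : ℂ) with hg
  have cg : ContinuousOn g (Ico 0 T) := by
    have h1 : ContinuousOn (fun τ => (starRingEnd ℂ (a τ) * b τ).im) (Ico 0 T) :=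
      Complex.continuous_im.comp_continuousOn (by fun_prop)
    simp only [hg]
    fun_prop
  set c : ℝ → ℂ := fun u => ∫ τ in (0 : ℝ)..u, g τ with hc
  have dc : ∀ τ ∈ Ioo 0 T, HasDerivAt c (g τ) τ := fun τ hτ => hasDerivAt_primitive cg hτ
  have OL : (fun x : ℝ × ℂ => (4 * I)⁻¹ * ((x.2 ^ 2)⁻¹ * (2 * lam * starRingEnd ℂ (a x.1)
      * hat K.L₁ x.1 x.2))) =O[𝓟 (Ioc 0 t ×ˢ region C r)] fun x => (x.2 ^ 2)⁻¹ * (x.2 ^ 2)⁻¹ :=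
    (hk2.mul (IsBigO.bdd_mul (hco (g := fun τ => 2 * lam * starRingEnd ℂ (a τ))
      (by fun_prop)) O1)).const_mul_left _
  -- Since b(0) may be nonzero, L̂₁ can carry an oscillating term of order k⁻², so it is not
  -- expanded pointwise. Its ODE is solved for L̂₁ instead, and the resulting -L̂₁'/(4ik²) is
  -- absorbed into `z` as a total derivative. There is no exponential factor left, so μ = 0 and E =
  -- 1.
  have OY := isBigO_of_ode (t := t) (E := 1) (Ω := region C r)
    (μ := fun _ => 0) (G := fun k => (k ^ 2)⁻¹ * (k ^ 2)⁻¹)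
    (z := fun τ k => hat K.M₂ τ k - I * c τ * (k ^ 2)⁻¹ + (4 * I)⁻¹ * ((k ^ 2)⁻¹ *
      (2 * lam * starRingEnd ℂ (a τ) * hat K.L₁ τ k)))
    (p := fun τ k => hat K.M₂ τ k - I * c τ * (k ^ 2)⁻¹ + (4 * I)⁻¹ * ((k ^ 2)⁻¹ *
      (2 * lam * starRingEnd ℂ (a τ) * hat K.L₁ τ k)))
    (r := fun τ k => -(I * lam * starRingEnd ℂ (b τ) * (hat K.M₁ τ k - a τ / (2 * I) * (k ^ 2)⁻¹))
      + (4 * I)⁻¹ * ((k ^ 2)⁻¹ * (2 * lam * starRingEnd ℂ (a₁ τ) * hat K.L₁ τ k +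
        2 * lam * starRingEnd ℂ (a τ) * (I * b τ * hat K.L₂ τ k
        + goursatAlpha lam a b τ * hat K.M₁ τ k + goursatBeta lam a τ * hat K.M₂ τ k))))
      ?_ ?_ ?_ ?_ ?_
  · refine ⟨∫ τ in (0 : ℝ)..t, lam * (starRingEnd ℂ (a τ) * b τ).im, ?_⟩
    have e1 : ((∫ τ in (0 : ℝ)..t, lam * (starRingEnd ℂ (a τ) * b τ).im : ℝ) : ℂ) = c t := by
      simp only [hc, hg]
      rw [intervalIntegral.integral_ofReal]
    rw [e1]
    have := OY.sub OL
    rw [isBigO_principal] at this ⊢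
    obtain ⟨A, hA⟩ := this
    refine ⟨A, fun k hk => ?_⟩
    have h := hA (t, k) ⟨⟨ht.1, le_rfl⟩, hk⟩
    simpa only [add_sub_cancel_right] using h
  · intro k _ τ τ₀ _ _ _
    simp
  · intro k hk τ hτ
    have hk0 := ne_zero_of_mem_region hr hk
    have hτ' := hsub τ hτ
    refine (((hK.hasDerivAt_hat_M₂ hτ' k).sub (((dc τ hτ').const_mul I).mul_const _)).add
      (((((hasDerivAt_conj (da τ hτ').1).const_mul (2 * (lam : ℂ))).mul
        (hK.hasDerivAt_hat_L₁ hτ' k)).const_mul (k ^ 2)⁻¹).const_mul (4 * I)⁻¹)).congr_deriv ?_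
    have e2 : g τ = lam * ((starRingEnd ℂ (a τ) * b τ - a τ * starRingEnd ℂ (b τ)) / (2 * I)) := by
      simp only [hg]
      rw [ofReal_mul, im_eq_sub_conj]
      simp
    rw [e2]
    field_simp
    ring
  · refine (IsBigO.bdd_mul (hco (g := fun τ => I * lam * starRingEnd ℂ (b τ)) (by fun_prop))
      O5).neg_left.add ((hk2.mul ((IsBigO.bdd_mul (hco (g := fun τ => 2 * lam * starRingEnd ℂ (a₁ τ))
      (by fun_prop)) O1).add (IsBigO.bdd_mul (hco (g := fun τ => 2 * lam * starRingEnd ℂ (a τ))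
      (by fun_prop)) (((IsBigO.bdd_mul (hco (g := fun τ => I * b τ) (by fun_prop)) O2).add
      (IsBigO.bdd_mul hα O3)).add (IsBigO.bdd_mul hβ O4))))).const_mul_left _)
  · intro k hk
    have h1 := tendsto_hat_zero hT hK.contDiffOn_L₁.continuousOn k
    have h4 := tendsto_hat_zero hT hK.contDiffOn_M₂.continuousOn k
    have h5 : Tendsto c (𝓝[>] 0) (𝓝 0) := by
      have hi : ContinuousOn c (Icc 0 t) := by
        have := intervalIntegral.continuousOn_primitive_interval (f := g) (μ := volume) (a := 0)
          (b := t) ?_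
        · rwa [uIcc_of_le ht.1.le] at this
        · rw [uIcc_of_le ht.1.le]
          exact (cg.mono fun x hx => ⟨hx.1, hx.2.trans_lt ht.2⟩).integrableOn_Icc
      have h := ((hi 0 ⟨le_rfl, ht.1.le⟩).mono_of_mem_nhdsWithin
        (Icc_mem_nhdsGE ht.1)).tendsto.mono_left (nhdsWithin_mono _ Ioi_subset_Ici_self)
      simpa [hc] using h
    have h6 : Tendsto a (𝓝[>] 0) (𝓝 (a 0)) := ((ca 0 ⟨le_rfl, hT⟩).mono_of_mem_nhdsWithin
      (Ico_mem_nhdsGE hT)).tendsto.mono_left (nhdsWithin_mono _ Ioi_subset_Ici_self)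
    have h7 := (Complex.continuous_conj.tendsto _).comp h6
    simpa using (h4.sub ((h5.const_mul I).mul_const (k ^ 2)⁻¹)).add
      ((((h7.const_mul (2 * (lam : ℂ))).mul h1).const_mul (k ^ 2)⁻¹).const_mul (4 * I)⁻¹)
  · simp only [sub_self]
    exact isBigO_zero _ _

end Asymptotics

end NLSInterval

namespace NLSInterval

open MeasureTheory Asymptotics
open scoped Interval

/-! ### An integrable weight on the half-line -/

theorem intervalIntegrable_abs_sin_rpow :
    IntervalIntegrable (fun θ : ℝ => |Real.sin θ| ^ (-(1 / 2) : ℝ)) volume (-(Real.pi / 2))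
      (-(Real.pi / 2) + Real.pi) := by
  have hm : Measurable (fun θ : ℝ => |Real.sin θ| ^ (-(1 / 2) : ℝ)) := by fun_prop
  have h1 : IntervalIntegrable (fun θ : ℝ => |Real.sin θ| ^ (-(1 / 2) : ℝ)) volume 0
      (Real.pi / 2) := by
    have h2 : IntervalIntegrable (fun θ : ℝ => (2 / Real.pi) ^ (-(1 / 2) : ℝ) * θ ^ (-(1 / 2) : ℝ))
        volume 0 (Real.pi / 2) :=
      (intervalIntegral.intervalIntegrable_rpow' (by norm_num)).const_mul _
    refine h2.mono_fun' hm.aestronglyMeasurable ?_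
    have hpi := Real.pi_pos
    rw [uIoc_of_le (by positivity)]
    refine (ae_restrict_iff' measurableSet_Ioc).2 (Eventually.of_forall fun θ hθ => ?_)
    -- Jordan's inequality sin θ ≥ 2θ/π reduces the singularity to θ^{-1/2}.
    have h3 := Real.mul_le_sin hθ.1.le hθ.2
    have h4 : 0 < 2 / Real.pi * θ := mul_pos (by positivity) hθ.1
    beta_reduce
    rw [Real.norm_of_nonneg (by positivity), abs_of_pos (h4.trans_le h3),
      ← Real.mul_rpow (by positivity) hθ.1.le]
    exact Real.rpow_le_rpow_of_nonpos h4 h3 (by norm_num)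
  have h2 : IntervalIntegrable (fun θ : ℝ => |Real.sin θ| ^ (-(1 / 2) : ℝ)) volume
      (-(Real.pi / 2)) 0 := by
    rw [IntervalIntegrable.iff_comp_neg]
    simpa using h1.symm
  have e : -(Real.pi / 2) + Real.pi = Real.pi / 2 := by ring
  rw [e]
  exact h2.trans h1

theorem periodic_abs_sin_rpow {L : ℝ} (hL : 0 < L) :
    Function.Periodic (fun x : ℝ => |Real.sin (2 * L * x)| ^ (-(1 / 2) : ℝ))
      (Real.pi / (2 * L)) := by
  intro x
  have : 2 * L * (x + Real.pi / (2 * L)) = 2 * L * x + Real.pi := by field_simp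
  simp only [this, Real.sin_add_pi, abs_neg]

theorem intervalIntegrable_abs_sin_mul_rpow {L : ℝ} (hL : 0 < L) (u v : ℝ) :
    IntervalIntegrable (fun x : ℝ => |Real.sin (2 * L * x)| ^ (-(1 / 2) : ℝ)) volume u v := by
  have h0 : ∀ u v, IntervalIntegrable (fun θ : ℝ => |Real.sin θ| ^ (-(1 / 2) : ℝ)) volume u v := by
    intro u v
    refine Function.Periodic.intervalIntegrable (T := Real.pi) (fun x => ?_) Real.pi_pos.ne'
      intervalIntegrable_abs_sin_rpow u v
    simp only [Real.sin_add_pi, abs_neg]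
  have := (h0 (2 * L * u) (2 * L * v)).comp_mul_left (c := 2 * L)
  simpa [hL.ne'] using this

/-- The sine factor is periodic and integrable over a period, while the power is decreasing; summing
over periods compares the integral with the convergent series of (1 + np)^{-3/2}. -/
theorem integrableOn_weight {L : ℝ} (hL : 0 < L) :
    IntegrableOn (fun x : ℝ => (1 + x) ^ (-(3 / 2) : ℝ) *
      |Real.sin (2 * L * x)| ^ (-(1 / 2) : ℝ)) (Ioi 0) := by
  set φ : ℝ → ℝ := fun x => |Real.sin (2 * L * x)| ^ (-(1 / 2) : ℝ) with hφ
  set w : ℝ → ℝ := fun x => (1 + x) ^ (-(3 / 2) : ℝ) with hw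
  set p := Real.pi / (2 * L) with hp
  have hp0 : 0 < p := div_pos Real.pi_pos (by positivity)
  have hφ0 : ∀ x, 0 ≤ φ x := fun x => by simp only [hφ]; positivity
  have hφi : ∀ u v, IntervalIntegrable φ volume u v := intervalIntegrable_abs_sin_mul_rpow hL
  have hwc : ContinuousOn w (Ici 0) := by
    refine ContinuousOn.rpow_const (by fun_prop) fun x hx => Or.inl ?_
    have : (0 : ℝ) ≤ x := hx
    positivity
  have hi : ∀ u v : ℝ, 0 ≤ u → u ≤ v → IntervalIntegrable (fun x => w x * φ x) volume u v := by
    intro u v hu huv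
    refine (hφi u v).continuousOn_mul ?_
    rw [uIcc_of_le huv]
    exact hwc.mono fun x hx => hu.trans hx.1
  set J := ∫ x in (0 : ℝ)..p, φ x with hJ
  have hJ0 : 0 ≤ J := intervalIntegral.integral_nonneg hp0.le fun x _ => hφ0 x
  have hnn : ∀ n : ℕ, (0 : ℝ) ≤ n * p := fun n => by positivity
  have hstep : ∀ n : ℕ, (n : ℝ) * p ≤ (n + 1 : ℕ) * p := fun n => by
    push_cast; nlinarith
  have hterm : ∀ n : ℕ, ∫ x in (n * p : ℝ)..((n + 1 : ℕ) * p : ℝ), w x * φ x ≤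
      (1 + n * p) ^ (-(3 / 2) : ℝ) * J := by
    intro n
    have e : ∫ x in (n * p : ℝ)..((n + 1 : ℕ) * p : ℝ), φ x = J := by
      have := (periodic_abs_sin_rpow hL).intervalIntegral_add_eq (n * p) 0
      rw [zero_add] at this
      rw [hJ, ← this]
      congr 1
      push_cast; ring
    rw [← e, ← intervalIntegral.integral_const_mul]
    refine intervalIntegral.integral_mono_on (hstep n) (hi _ _ (hnn n) (hstep n))
      ((hφi _ _).const_mul _) fun x hx => ?_
    refine mul_le_mul_of_nonneg_right ?_ (hφ0 x)
    have := hnn n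
    exact Real.rpow_le_rpow_of_nonpos (by positivity) (by linarith [hx.1]) (by norm_num)
  -- Chosen so that 1 + np ≥ q(n + 1), which reduces the series to Σ (n + 1)^{-3/2}.
  set q := min 1 p with hq
  have hq0 : 0 < q := lt_min one_pos hp0
  have hsum : Summable fun n : ℕ => (1 + n * p) ^ (-(3 / 2) : ℝ) * J := by
    have h1 : Summable fun n : ℕ => (((n + 1 : ℕ) : ℝ)) ^ (-(3 / 2) : ℝ) :=
      (summable_nat_add_iff 1).2 (Real.summable_nat_rpow.2 (by norm_num))
    refine Summable.of_nonneg_of_le (fun n => by have := hnn n; positivity) (fun n => ?_)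
      ((h1.mul_left (q ^ (-(3 / 2) : ℝ))).mul_right J)
    refine mul_le_mul_of_nonneg_right ?_ hJ0
    rw [← Real.mul_rpow hq0.le (by positivity)]
    refine Real.rpow_le_rpow_of_nonpos (by positivity) ?_ (by norm_num)
    have h2 : q ≤ 1 := min_le_left _ _
    have h3 : q ≤ p := min_le_right _ _
    push_cast
    nlinarith [mul_le_mul_of_nonneg_left h3 (Nat.cast_nonneg (α := ℝ) n)]
  refine integrableOn_Ioi_of_intervalIntegral_norm_bounded (l := atTop)
    (b := fun n : ℕ => (n : ℝ) * p) (∑' n : ℕ, (1 + n * p) ^ (-(3 / 2) : ℝ) * J) 0 ?_ ?_ ?_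
  · intro n
    have := hi 0 (n * p) le_rfl (hnn n)
    rwa [intervalIntegrable_iff_integrableOn_Ioc_of_le (hnn n)] at this
  · exact tendsto_natCast_atTop_atTop.atTop_mul_const hp0
  · refine Eventually.of_forall fun n => ?_
    have e1 : ∫ x in (0 : ℝ)..(n * p), ‖w x * φ x‖ = ∫ x in (0 : ℝ)..(n * p), w x * φ x := by
      refine intervalIntegral.integral_congr fun x hx => ?_
      rw [uIcc_of_le (hnn n)] at hx
      have : (0 : ℝ) ≤ 1 + x := by linarith [hx.1]
      exact Real.norm_of_nonneg (mul_nonneg (Real.rpow_nonneg this _) (hφ0 x))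
    have e2 := intervalIntegral.sum_integral_adjacent_intervals (μ := volume)
      (f := fun x => w x * φ x) (a := fun m : ℕ => (m : ℝ) * p) (n := n)
      (fun m _ => hi _ _ (hnn m) (hstep m))
    simp only [Nat.cast_zero, zero_mul] at e2
    rw [e1, ← e2]
    exact (Finset.sum_le_sum fun m _ => hterm m).trans
      (hsum.sum_le_tsum _ fun m _ => by have := hnn m; positivity)

theorem sin_ne_zero_ae {L : ℝ} (hL : 0 < L) : ∀ᵐ x : ℝ, Real.sin (2 * L * x) ≠ 0 := by
  rw [ae_iff]
  refine Set.Countable.measure_zero ?_ _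
  refine (countable_range fun n : ℤ => n * Real.pi / (2 * L)).mono fun x hx => ?_
  obtain ⟨n, hn⟩ := Real.sin_eq_zero_iff.1 (not_not.1 hx)
  exact ⟨n, by simp only; rw [hn]; field_simp⟩

/-! ### The contour and absolutely convergent integrals -/

/-- The contour `∂D₁⁰` as a set. -/
def contour (δ : ℝ → ℝ) : Set ℂ :=
  {k | (∃ y : ℝ, δ 0 ≤ y ∧ k = I * y) ∨ ∃ x : ℝ, 0 ≤ x ∧ k = x + I * δ x}

theorem IsDepth.pos {δ : ℝ → ℝ} (hδ : IsDepth δ) {x : ℝ} (hx : 0 ≤ x) : 0 < δ x := by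
  obtain ⟨c, C, hc, h⟩ := hδ.bounds
  exact pos_of_mul_pos_right (hc.trans_le (h x hx).1) (by positivity)

theorem im_pos_of_mem_contour {δ : ℝ → ℝ} (hδ : IsDepth δ) {k : ℂ} (hk : k ∈ contour δ) :
    0 < k.im := by
  rcases hk with ⟨y, hy, rfl⟩ | ⟨x, hx, rfl⟩
  · simpa using (hδ.pos le_rfl).trans_le hy
  · simpa using hδ.pos hx

theorem im_sq_nonneg_of_mem_contour {δ : ℝ → ℝ} (hδ : IsDepth δ) {k : ℂ} (hk : k ∈ contour δ) :
    0 ≤ (k ^ 2).im := by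
  rcases hk with ⟨y, hy, rfl⟩ | ⟨x, hx, rfl⟩
  · simp [sq]
  · have := hδ.pos hx
    simp only [sq, mul_im, add_re, add_im, ofReal_re, ofReal_im, I_re, I_im, mul_re]
    ring_nf
    positivity

/-- On the arm Im k² = 2xδ(x), bounded because δ(x) is at most a constant over 1 + x; on the axis it
is 0. Conjugation makes Im k² nonpositive, so the conjugate contour lies in the region as well. -/
theorem exists_contour_subset_region {δ : ℝ → ℝ} (hδ : IsDepth δ) :
    ∃ C r : ℝ, 0 ≤ C ∧ 0 < r ∧ (∀ x, 0 ≤ x → δ x ≤ C ∧ 2 * x * δ x ≤ C) ∧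
      (∀ x : ℝ, 0 ≤ x → r * (1 + x) ≤ ‖(x + I * δ x : ℂ)‖) ∧ contour δ ⊆ region C r ∧
      ∀ k ∈ contour δ, starRingEnd ℂ k ∈ region C r := by
  obtain ⟨c, C, hc, h⟩ := hδ.bounds
  have hC : 0 < C := hc.trans_le ((h 0 le_rfl).1.trans (h 0 le_rfl).2.1)
  -- The factor 2 comes from Im k² = 2xδ(x).
  have hd : ∀ x, 0 ≤ x → δ x ≤ 2 * C ∧ 2 * x * δ x ≤ 2 * C := fun x hx => by
    have := hδ.pos hx
    have h1 := (h x hx).2.1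
    constructor <;> nlinarith [mul_nonneg hx this.le]
  set r := min (1 / 4) (c / 4) with hr
  have hr0 : 0 < r := lt_min (by norm_num) (by positivity)
  have hr1 : r ≤ 1 / 4 := min_le_left _ _
  have hr2 : r ≤ c / 4 := min_le_right _ _
  have hn : ∀ x : ℝ, 0 ≤ x → r * (1 + x) ≤ ‖(x + I * δ x : ℂ)‖ := by
    intro x hx
    have h1 : x ≤ ‖(x + I * δ x : ℂ)‖ := by
      have := (le_abs_self _).trans (abs_re_le_norm (x + I * δ x : ℂ))
      simpa using this
    have h2 : δ x ≤ ‖(x + I * δ x : ℂ)‖ := by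
      have := (le_abs_self _).trans (abs_im_le_norm (x + I * δ x : ℂ))
      simpa using this
    have h3 := (h x hx).1
    -- For x ≤ 1 the imaginary part satisfies δ(x) ≥ c/2; for x ≥ 1 the real part satisfies x ≥ (1 +
    -- x)/2.
    rcases le_total x 1 with hx1 | hx1
    · refine le_trans ?_ h2
      have := hδ.pos hx
      nlinarith [mul_le_mul_of_nonneg_right hx1 this.le, mul_le_mul_of_nonneg_left hx1 hr0.le]
    · refine le_trans ?_ h1
      nlinarith [mul_le_mul_of_nonneg_left hx1 hr0.le]
  have hmem : ∀ k ∈ contour δ, (k ^ 2).im ≤ 2 * C ∧ r ≤ ‖k‖ := by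
    rintro k (⟨y, hy, rfl⟩ | ⟨x, hx, rfl⟩)
    · refine ⟨?_, ?_⟩
      · simp [sq]; positivity
      · have h0 := hδ.pos le_rfl
        have h1 := (h 0 le_rfl).1
        rw [norm_mul, norm_I, one_mul, norm_real, Real.norm_of_nonneg (h0.le.trans hy)]
        linarith
    · refine ⟨?_, ?_⟩
      · have := (hd x hx).2
        simp only [sq, mul_im, add_re, add_im, ofReal_re, ofReal_im, I_re, I_im, mul_re]
        linarith
      · exact le_trans (by nlinarith) (hn x hx)
  refine ⟨2 * C, r, by positivity, hr0, hd, hn, hmem, fun k hk => ⟨?_, ?_⟩⟩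
  · rw [← map_pow, conj_im]
    linarith [im_sq_nonneg_of_mem_contour hδ hk]
  · rw [RCLike.norm_conj]
    exact (hmem k hk).2

theorem norm_Del_eq {L : ℝ} (k : ℂ) : Real.exp (2 * k.im * L) - Real.exp (-(2 * k.im * L)) ≤ ‖Del L k‖ := by
  have h1 : ‖exp (-2 * I * k * L)‖ = Real.exp (2 * k.im * L) := by
    rw [norm_exp]; simp
  have h2 : ‖exp (2 * I * k * L)‖ = Real.exp (-(2 * k.im * L)) := by
    rw [norm_exp]; simp
  rw [← h1, ← h2, Del, norm_sub_rev]
  exact norm_sub_norm_le _ _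

theorem two_mul_le_norm_Del {L : ℝ} (hL : 0 < L) {k : ℂ} (hk : 0 < k.im) :
    2 * k.im * L ≤ ‖Del L k‖ := by
  refine le_trans ?_ (norm_Del_eq k)
  have h1 := Real.add_one_le_exp (2 * k.im * L)
  have h2 : Real.exp (-(2 * k.im * L)) ≤ 1 := Real.exp_le_one_iff.2 (by
    have : 0 < 2 * k.im * L := by positivity
    linarith)
  linarith

theorem Del_ne_zero {L : ℝ} (hL : 0 < L) {k : ℂ} (hk : 0 < k.im) : Del L k ≠ 0 := by
  have : 0 < 2 * k.im * L := by positivity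
  exact norm_pos_iff.1 (this.trans_le (two_mul_le_norm_Del hL hk))

theorem two_mul_abs_sin_le_norm_Del {L : ℝ} (k : ℂ) :
    2 * |Real.sin (2 * L * k.re)| ≤ ‖Del L k‖ := by
  refine le_trans ?_ (abs_im_le_norm _)
  have e : (Del L k).im = 2 * Real.cosh (2 * L * k.im) * Real.sin (2 * L * k.re) := by
    rw [Del, sub_im, exp_im, exp_im, Real.cosh_eq]
    have r1 : (2 * I * k * L).re = -(2 * L * k.im) := by simp; ring
    have r2 : (2 * I * k * L).im = 2 * L * k.re := by simp; ring
    have r3 : (-2 * I * k * L).re = 2 * L * k.im := by simp; ring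
    have r4 : (-2 * I * k * L).im = -(2 * L * k.re) := by simp; ring
    rw [r1, r2, r3, r4, Real.sin_neg]
    ring
  rw [e, abs_mul, abs_mul, abs_of_pos (Real.cosh_pos _), abs_of_pos (by norm_num : (0 : ℝ) < 2)]
  nlinarith [Real.one_le_cosh (2 * L * k.im), abs_nonneg (Real.sin (2 * L * k.re))]

/-- The geometric mean of the bounds |Δ| ≥ 2L Im k and |Δ| ≥ 2|sin(2L Re k)|. Alone, the first costs
a full power of 1 + x along the arm and the second is not integrable at the zeros of the sine; the
mean costs only (1 + x)^{1/2} and an integrable singularity. Zeros of the sine must be excluded,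
since there `rpow` takes the value 0 and the bound would fail. -/
theorem inv_norm_Del_le {L : ℝ} (hL : 0 < L) {k : ℂ} (hk : 0 < k.im)
    (hs : Real.sin (2 * L * k.re) ≠ 0) :
    ‖Del L k‖⁻¹ ≤ (4 * L * k.im) ^ (-(1 / 2) : ℝ) *
      |Real.sin (2 * L * k.re)| ^ (-(1 / 2) : ℝ) := by
  have h1 := two_mul_le_norm_Del hL hk
  have h2 := two_mul_abs_sin_le_norm_Del (L := L) k
  have hs' := abs_pos.2 hs
  set s := |Real.sin (2 * L * k.re)|
  have hD : 0 < ‖Del L k‖ := norm_pos_iff.2 (Del_ne_zero hL hk)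
  have h3 : 4 * L * k.im * s ≤ ‖Del L k‖ ^ (2 : ℝ) := by
    rw [Real.rpow_two]
    nlinarith [mul_le_mul h1 h2 (by positivity) hD.le]
  rw [← Real.mul_rpow (by positivity) hs'.le]
  have h4 := Real.rpow_le_rpow_of_nonpos (by positivity) h3 (by norm_num : (-(1 / 2) : ℝ) ≤ 0)
  refine le_trans (le_of_eq ?_) h4
  rw [← Real.rpow_mul hD.le]
  norm_num
  rw [Real.rpow_neg_one]

theorem arm_continuous {δ : ℝ → ℝ} (hδ : IsDepth δ) {f : ℂ → ℂ}
    (hf : ContinuousOn f {k | 0 < k.im}) :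
    ContinuousOn (fun x : ℝ => f (x + I * δ x) * (1 + I * deriv δ x)) (Ici 0) := by
  have c1 : Continuous δ := hδ.contDiff.continuous
  have c2 : Continuous (deriv δ) := hδ.contDiff.continuous_deriv le_rfl
  refine ContinuousOn.mul (hf.comp (by fun_prop) fun x hx => ?_) (by fun_prop)
  simpa using hδ.pos hx

theorem axis_continuous {f : ℂ → ℂ} (hf : ContinuousOn f {k | 0 < k.im}) :
    ContinuousOn (fun y : ℝ => f (I * y) * I) (Ioi 0) := by
  refine ContinuousOn.mul (hf.comp (by fun_prop) fun x hx => ?_) (by fun_prop)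
  simpa using hx

theorem arm_intervalIntegrable {δ : ℝ → ℝ} (hδ : IsDepth δ) {f : ℂ → ℂ}
    (hf : ContinuousOn f {k | 0 < k.im}) {R : ℝ} (hR : 0 < R) :
    IntervalIntegrable (fun x : ℝ => f (x + I * δ x) * (1 + I * deriv δ x)) volume 0 R := by
  refine ContinuousOn.intervalIntegrable ?_
  rw [uIcc_of_le hR.le]
  exact (arm_continuous hδ hf).mono fun x hx => hx.1

theorem uIcc_subset_Ioi {u v : ℝ} (hu : 0 < u) (hv : 0 < v) : uIcc u v ⊆ Ioi 0 := fun _ hx =>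
  (lt_min hu hv).trans_le hx.1

theorem axis_intervalIntegrable {f : ℂ → ℂ}
    (hf : ContinuousOn f {k | 0 < k.im}) {R S : ℝ} (hR : 0 < R) (hS : 0 < S) :
    IntervalIntegrable (fun y : ℝ => f (I * y) * I) volume R S :=
  ContinuousOn.intervalIntegrable ((axis_continuous hf).mono (uIcc_subset_Ioi hR hS))

theorem integralD₁_add {δ : ℝ → ℝ} (hδ : IsDepth δ) {f g : ℂ → ℂ}
    (hf : ContinuousOn f {k | 0 < k.im}) (hg : ContinuousOn g {k | 0 < k.im}) {R : ℝ} (hR : 0 < R) :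
    integralD₁ δ (fun k => f k + g k) R = integralD₁ δ f R + integralD₁ δ g R := by
  simp only [integralD₁, add_mul]
  rw [intervalIntegral.integral_add (axis_intervalIntegrable hf hR (hδ.pos le_rfl))
    (axis_intervalIntegrable hg hR (hδ.pos le_rfl)), intervalIntegral.integral_add
    (arm_intervalIntegrable hδ hf hR) (arm_intervalIntegrable hδ hg hR)]
  ring

theorem integralD₁_const_mul (δ : ℝ → ℝ) (c : ℂ) (f : ℂ → ℂ) (R : ℝ) :
    integralD₁ δ (fun k => c * f k) R = c * integralD₁ δ f R := by
  simp only [integralD₁, mul_add, ← intervalIntegral.integral_const_mul, mul_assoc]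

theorem integralD₁_congr {δ : ℝ → ℝ} (hδ : IsDepth δ) {f g : ℂ → ℂ}
    (h : ∀ k : ℂ, 0 < k.im → f k = g k) {R : ℝ} (hR : 0 < R) :
    integralD₁ δ f R = integralD₁ δ g R := by
  unfold integralD₁
  congr 1
  · refine intervalIntegral.integral_congr fun y hy => ?_
    have : 0 < y := uIcc_subset_Ioi hR (hδ.pos le_rfl) hy
    rw [h _ (by simpa using this)]
  · refine intervalIntegral.integral_congr fun x hx => ?_
    rw [uIcc_of_le hR.le] at hx
    rw [h _ (by simpa using hδ.pos hx.1)]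

/-- Under k ↦ -k both `f` and `dk` change sign, so the truncated integrals agree exactly. -/
theorem integralD₃_eq_of_odd (δ : ℝ → ℝ) {f : ℂ → ℂ} (hf : ∀ k, f (-k) = -f k) (R : ℝ) :
    integralD₃ δ f R = integralD₁ δ f R := by
  simp only [integralD₁, integralD₃, hf, neg_mul_neg]

theorem integralD₁_converges {δ : ℝ → ℝ} (hδ : IsDepth δ) {L : ℝ} (hL : 0 < L) {f : ℂ → ℂ}
    (hf : ContinuousOn f {k | 0 < k.im})
    (hO : f =O[𝓟 (contour δ)] fun k => (k ^ 2)⁻¹ * ((1 + ‖Del L k‖⁻¹ : ℝ) : ℂ)) :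
    ∃ v, Tendsto (integralD₁ δ f) atTop (𝓝 v) := by
  obtain ⟨A, hA⟩ := isBigO_principal.1 hO
  obtain ⟨C, r, hC, hr, hd, hn, -, -⟩ := exists_contour_subset_region hδ
  obtain ⟨c₀, C₀, hc₀, hb⟩ := hδ.bounds
  have hδ0 := hδ.pos le_rfl
  have hA' : ∀ k ∈ contour δ, ‖f k‖ ≤ |A| * ((‖k‖ ^ 2)⁻¹ * (1 + ‖Del L k‖⁻¹)) := by
    intro k hk
    refine (hA k hk).trans ?_
    rw [norm_mul, norm_inv, norm_pow, norm_real, Real.norm_of_nonneg (by positivity)]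
    exact mul_le_mul_of_nonneg_right (le_abs_self A) (by positivity)
  have i1 : IntegrableOn (fun y : ℝ => f (I * y) * I) (Ioi (δ 0)) := by
    have h1 : IntegrableOn (fun y : ℝ => |A| * (1 + (2 * δ 0 * L)⁻¹) * y ^ (-2 : ℝ)) (Ioi (δ 0)) :=
      (integrableOn_Ioi_rpow_of_lt (by norm_num) hδ0).const_mul _
    refine h1.mono' (((axis_continuous hf).mono fun y (hy : δ 0 < y) =>
      hδ0.trans hy).aestronglyMeasurable measurableSet_Ioi) ?_
    refine (ae_restrict_iff' measurableSet_Ioi).2 (Eventually.of_forall fun y (hy : δ 0 < y) => ?_)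
    have hy0 : 0 < y := hδ0.trans hy
    have h2 := hA' (I * y) (Or.inl ⟨y, hy.le, rfl⟩)
    have h3 : 2 * y * L ≤ ‖Del L (I * y)‖ := by
      simpa using two_mul_le_norm_Del hL (k := I * y) (by simpa using hy0)
    rw [norm_mul, norm_I, mul_one]
    refine h2.trans ?_
    rw [norm_mul, norm_I, one_mul, norm_real, Real.norm_of_nonneg hy0.le, Real.rpow_neg hy0.le,
      Real.rpow_two, mul_assoc]
    refine mul_le_mul_of_nonneg_left ?_ (abs_nonneg A)
    rw [mul_comm]
    refine mul_le_mul_of_nonneg_right ?_ (by positivity)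
    gcongr
    refine le_trans ?_ h3
    gcongr
  have i2 : IntegrableOn (fun x : ℝ => f (x + I * δ x) * (1 + I * deriv δ x)) (Ioi 0) := by
    set Q : ℝ := |A| * (r ^ 2)⁻¹ * (1 + C₀) with hQ
    have h1 : IntegrableOn (fun x : ℝ => Q * ((1 + x) ^ (-2 : ℝ) + (4 * L * c₀) ^ (-(1 / 2) : ℝ) *
        ((1 + x) ^ (-(3 / 2) : ℝ) * |Real.sin (2 * L * x)| ^ (-(1 / 2) : ℝ)))) (Ioi 0) := by
      refine Integrable.const_mul (Integrable.add ?_ ((integrableOn_weight hL).const_mul _)) _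
      simpa only [add_comm, IntegrableOn] using integrableOn_add_rpow_Ioi_of_lt (a := -2) (c := 0) (m := 1)
        (by norm_num) (by norm_num)
    refine h1.mono' (((arm_continuous hδ hf).mono Ioi_subset_Ici_self).aestronglyMeasurable
      measurableSet_Ioi) ?_
    filter_upwards [ae_restrict_mem measurableSet_Ioi, ae_restrict_of_ae (sin_ne_zero_ae hL)]
      with x hx hsin
    have hx0 : 0 ≤ x := le_of_lt hx
    have h2 := hA' (x + I * δ x) (Or.inr ⟨x, hx0, rfl⟩)
    have hdx := hδ.pos hx0
    have h3 := inv_norm_Del_le hL (k := x + I * δ x) (by simpa using hdx) (by simpa using hsin)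
    simp only [add_im, ofReal_im, mul_im, I_re, zero_mul, I_im, one_mul, zero_add, ofReal_re,
      add_re, mul_re, mul_zero, sub_zero, add_zero] at h3
    -- The lower bound δ(x) ≥ c₀/(1 + x). Together with |k|⁻² = O((1 + x)⁻²) it gives the exponent
    -- -3/2 of the weight.
    have h4 : (4 * L * δ x) ^ (-(1 / 2) : ℝ) ≤ (4 * L * c₀) ^ (-(1 / 2) : ℝ) * (1 + x) ^ (1 / 2 : ℝ) := by
      have e : (1 + x) ^ (1 / 2 : ℝ) = ((1 + x)⁻¹) ^ (-(1 / 2) : ℝ) := by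
        rw [Real.inv_rpow (by positivity), Real.rpow_neg (by positivity), inv_inv]
      rw [e, ← Real.mul_rpow (by positivity) (by positivity)]
      refine Real.rpow_le_rpow_of_nonpos (by positivity) ?_ (by norm_num)
      have := (hb x hx0).1
      rw [← div_eq_mul_inv, div_le_iff₀ (by positivity)]
      nlinarith
    have h5 : ‖(1 + I * deriv δ x : ℂ)‖ ≤ 1 + C₀ := by
      refine (norm_add_le _ _).trans ?_
      rw [norm_one, norm_mul, norm_I, one_mul, norm_real]
      linarith [(hb x hx0).2.2, Real.norm_eq_abs (deriv δ x)]
    have hC₀ : 0 ≤ 1 + C₀ := (norm_nonneg _).trans h5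
    have h6 : (‖(x + I * δ x : ℂ)‖ ^ 2)⁻¹ ≤ (r ^ 2)⁻¹ * (1 + x) ^ (-2 : ℝ) := by
      rw [Real.rpow_neg (by positivity), Real.rpow_two, ← mul_inv, ← mul_pow]
      have := hn x hx0
      gcongr
    set sn := |Real.sin (2 * L * x)| ^ (-(1 / 2) : ℝ) with hsn
    have hsn0 : 0 ≤ sn := by positivity
    have h7 : ‖Del L (x + I * δ x)‖⁻¹ ≤ (4 * L * c₀) ^ (-(1 / 2) : ℝ) * (1 + x) ^ (1 / 2 : ℝ) * sn :=
      h3.trans (mul_le_mul_of_nonneg_right h4 hsn0)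
    have h8 : (1 + x) ^ (-(3 / 2) : ℝ) = (1 + x) ^ (-2 : ℝ) * (1 + x) ^ (1 / 2 : ℝ) := by
      rw [← Real.rpow_add (by positivity)]
      norm_num
    rw [norm_mul]
    calc ‖f (x + I * δ x)‖ * ‖(1 + I * deriv δ x : ℂ)‖
        ≤ |A| * (((r ^ 2)⁻¹ * (1 + x) ^ (-2 : ℝ)) *
          (1 + (4 * L * c₀) ^ (-(1 / 2) : ℝ) * (1 + x) ^ (1 / 2 : ℝ) * sn)) * (1 + C₀) := by
          refine mul_le_mul (h2.trans ?_) h5 (norm_nonneg _) (by positivity)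
          gcongr
      _ = _ := by rw [h8, hQ]; ring
  refine ⟨-(∫ y in Ioi (δ 0), f (I * y) * I)
    + ∫ x in Ioi (0 : ℝ), f (x + I * δ x) * (1 + I * deriv δ x), ?_⟩
  have t1 := intervalIntegral_tendsto_integral_Ioi (δ 0) i1 tendsto_id
  have t2 := intervalIntegral_tendsto_integral_Ioi 0 i2 tendsto_id
  refine (t1.neg.add t2).congr fun R => ?_
  rw [integralD₁, intervalIntegral.integral_symm (δ 0) R]
  rfl

end NLSInterval

namespace NLSInterval

open MeasureTheory Asymptotics
open scoped Interval

/-! ### Conditionally convergent integrals -/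

theorem integralD₁_eq_sub {δ : ℝ → ℝ} (hδ : IsDepth δ) {f F : ℂ → ℂ}
    (hf : ContinuousOn f {k | 0 < k.im}) (hF : ∀ k : ℂ, 0 < k.im → HasDerivAt F (f k) k)
    {R : ℝ} (hR : 0 < R) : integralD₁ δ f R = F (R + I * δ R) - F (I * R) := by
  have h1 : ∫ y in R..(δ 0), f (I * y) * I = F (I * δ 0) - F (I * R) := by
    refine intervalIntegral.integral_eq_sub_of_hasDerivAt (f := fun y : ℝ => F (I * y))
      (fun y hy => ?_) (axis_intervalIntegrable hf hR (hδ.pos le_rfl))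
    have hy0 : 0 < y := uIcc_subset_Ioi hR (hδ.pos le_rfl) hy
    have d1 : HasDerivAt (fun y : ℝ => I * (y : ℂ)) I y := by
      simpa only [mul_one] using (hasDerivAt_ofReal y).const_mul I
    exact (hF (I * y) (by simpa using hy0)).comp y d1
  have h2 : ∫ x in (0 : ℝ)..R, f (x + I * δ x) * (1 + I * deriv δ x) =
      F (R + I * δ R) - F ((0 : ℝ) + I * δ 0) := by
    refine intervalIntegral.integral_eq_sub_of_hasDerivAt (f := fun x : ℝ => F (x + I * δ x))
      (fun x hx => ?_) (arm_intervalIntegrable hδ hf hR)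
    rw [uIcc_of_le hR.le] at hx
    have d0 : HasDerivAt δ (deriv δ x) x :=
      ((hδ.contDiff.differentiable one_ne_zero) x).hasDerivAt
    have d1 : HasDerivAt (fun x : ℝ => (x : ℂ) + I * δ x) (1 + I * deriv δ x) x :=
      (hasDerivAt_ofReal x).add (d0.ofReal_comp.const_mul I)
    exact (hF (x + I * δ x) (by simpa using hδ.pos hx.1)).comp x d1
  rw [integralD₁, h1, h2, ofReal_zero, zero_add]
  ring

/-- The two ends contribute log(R + iδ(R)) - log(iR). Because both arms are cut at the same `R`, the
divergent log R cancels. -/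
theorem tendsto_integralD₁_inv {δ : ℝ → ℝ} (hδ : IsDepth δ) :
    ∃ v, Tendsto (integralD₁ δ fun k => k⁻¹) atTop (𝓝 v) := by
  obtain ⟨C, r, hC, hr, hd, -⟩ := exists_contour_subset_region hδ
  have hne : ∀ k : ℂ, 0 < k.im → k ≠ 0 := fun k hk h => by simp [h] at hk
  have hlim : Tendsto (fun R : ℝ => (1 + I * (δ R / R : ℝ) : ℂ)) atTop (𝓝 1) := by
    have h1 : Tendsto (fun R : ℝ => δ R / R) atTop (𝓝 0) := by
      have h2 : Tendsto (fun R : ℝ => C / R) atTop (𝓝 0) := tendsto_const_nhds.div_atTop tendsto_id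
      refine squeeze_zero' ?_ ?_ h2
      · filter_upwards [eventually_gt_atTop 0] with R hR
        exact div_nonneg (hδ.pos hR.le).le hR.le
      · filter_upwards [eventually_gt_atTop 0] with R hR
        have := (hd R hR.le).1
        gcongr
    have := ((Complex.continuous_ofReal.tendsto 0).comp h1).const_mul I |>.const_add 1
    simpa using this
  have hlog : Tendsto (fun R : ℝ => log (1 + I * (δ R / R : ℝ) : ℂ) - log I) atTop
      (𝓝 (log 1 - log I)) :=
    ((continuousAt_clog (by simp)).tendsto.comp hlim).sub_const _
  refine ⟨_, hlog.congr' ?_⟩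
  filter_upwards [eventually_gt_atTop 0] with R hR
  rw [integralD₁_eq_sub hδ (F := log) (continuousOn_inv₀.mono fun k hk => hne k hk)
    (fun k hk => hasDerivAt_log (Or.inr (ne_of_gt hk))) hR]
  have hRc : (R : ℂ) ≠ 0 := ofReal_ne_zero.2 hR.ne'
  have e1 : (R + I * δ R : ℂ) = (R : ℂ) * (1 + I * (δ R / R : ℝ)) := by
    push_cast; field_simp
  have hne1 : (1 + I * (δ R / R : ℝ) : ℂ) ≠ 0 := by
    intro h
    have := congrArg Complex.re h
    simp at this
  rw [e1, log_ofReal_mul hR hne1, mul_comm I (R : ℂ), log_ofReal_mul hR I_ne_zero]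
  ring

theorem norm_sq_inv_mul {k : ℂ} : ‖(k ^ 2)⁻¹ * (k ^ 2)⁻¹‖ = (‖k‖ ^ 4)⁻¹ := by
  rw [norm_mul, norm_inv, norm_pow, ← mul_inv]
  ring_nf

/-- The points -iR and R are joined by an arc in the fourth quadrant, where Im k² ≤ 0 and the
expansion of `f` is valid; on it ic/k integrates to ic·iπ/2 = -cπ/2 and the error is O(R⁻²). The
short segment from R to R + iη(R) contributes O(R⁻¹). -/
theorem tendsto_primitive_quarter_circle {f F : ℂ → ℂ} {c C r A : ℝ} (hC : 0 ≤ C)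
    (hF : ∀ k, HasDerivAt F (f k) k)
    (hf : ∀ k ∈ region C r, ‖f k - I * c * k⁻¹‖ ≤ A * (‖k‖ ^ 3)⁻¹)
    {η : ℝ → ℝ} (hη : ∀ R, 0 ≤ R → |η R| ≤ C ∧ 2 * R * |η R| ≤ C) :
    Tendsto (fun R : ℝ => F (R + I * η R) - F (-(I * R))) atTop (𝓝 (-(c * (Real.pi / 2)))) := by
  have hb : ∀ R : ℝ, max r 1 ≤ R → ‖(F (R + I * η R) - F (-(I * R))) - (-(c * (Real.pi / 2)) : ℂ)‖
      ≤ |A| * (R ^ 2)⁻¹ * (Real.pi / 2) + (|c| * R⁻¹ + |A| * (R ^ 3)⁻¹) * C := by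
    intro R hR
    have hR1 : 1 ≤ R := (le_max_right _ _).trans hR
    have hrR : r ≤ R := (le_max_left _ _).trans hR
    have hR0 : 0 < R := by linarith
    have hpi := Real.pi_pos
    have hA : ∀ k ∈ region C r, ‖f k - I * c * k⁻¹‖ ≤ |A| * (‖k‖ ^ 3)⁻¹ := fun k hk =>
      (hf k hk).trans (mul_le_mul_of_nonneg_right (le_abs_self A) (by positivity))
    have arc : ‖(F R - F (-(I * R))) - (-(c * (Real.pi / 2)) : ℂ)‖ ≤
        |A| * (R ^ 2)⁻¹ * (Real.pi / 2) := by
      -- Adding cθ cancels the leading term of the angular derivative, since (ic/k)·ik = -c.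
      have hd : ∀ θ ∈ Icc (-(Real.pi / 2)) 0, HasDerivWithinAt
          (fun θ : ℝ => F (R * exp (I * θ)) + c * θ)
          (f (R * exp (I * θ)) * (I * (R * exp (I * θ))) + c) (Icc (-(Real.pi / 2)) 0) θ := by
        intro θ _
        have d1 : HasDerivAt (fun θ : ℝ => (R : ℂ) * exp (I * θ)) (I * (R * exp (I * θ))) θ := by
          have d2 : HasDerivAt (fun θ : ℝ => I * (θ : ℂ)) I θ := by
            simpa only [mul_one] using (hasDerivAt_ofReal θ).const_mul I
          refine (d2.cexp.const_mul (R : ℂ)).congr_deriv ?_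
          ring
        refine (((hF _).comp θ d1).add (g' := (c : ℂ)) ?_).hasDerivWithinAt
        simpa only [mul_one] using (hasDerivAt_ofReal θ).const_mul (c : ℂ)
      have h1 := norm_image_sub_le_of_norm_deriv_le_segment' (C := |A| * (R ^ 2)⁻¹) hd (by
        intro θ hθ
        set k : ℂ := R * exp (I * θ) with hk
        have hkn : ‖k‖ = R := by
          rw [hk, norm_mul, mul_comm I, norm_exp_ofReal_mul_I, norm_real, mul_one,
            Real.norm_of_nonneg hR0.le]
        have hk0 : k ≠ 0 := norm_pos_iff.1 (hkn ▸ hR0)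
        have hkm : k ∈ region C r := by
          refine ⟨le_trans ?_ hC, hkn ▸ hrR⟩
          have e : k ^ 2 = ((R ^ 2 : ℝ) : ℂ) * exp (((2 * θ : ℝ) : ℂ) * I) := by
            rw [hk, mul_pow, ← exp_nat_mul]
            push_cast
            congr 2
            ring
          rw [e, im_ofReal_mul, exp_ofReal_mul_I_im]
          refine mul_nonpos_of_nonneg_of_nonpos (by positivity) ?_
          exact Real.sin_nonpos_of_nonpos_of_neg_pi_le (by linarith [hθ.2]) (by linarith [hθ.1])
        have e : f k * (I * k) + c = (f k - I * c * k⁻¹) * (I * k) := by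
          field_simp
          linear_combination (c : ℂ) * I_sq
        rw [e, norm_mul, norm_mul, norm_I, one_mul, hkn]
        refine (mul_le_mul_of_nonneg_right (hA k hkm) hR0.le).trans_eq ?_
        rw [hkn]
        field_simp) 0 ⟨by linarith, le_rfl⟩
      have e1 : (R : ℂ) * exp (I * (0 : ℝ)) = R := by simp
      have e2 : (R : ℂ) * exp (I * (-(Real.pi / 2) : ℝ)) = -(I * R) := by
        have : exp (I * (-(Real.pi / 2) : ℝ)) = -I := by
          rw [show I * ((-(Real.pi / 2) : ℝ) : ℂ) = -(Real.pi / 2 * I) by push_cast; ring, exp_neg,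
            exp_pi_div_two_mul_I, inv_I]
        rw [this]; ring
      rw [e1, e2] at h1
      refine le_trans (le_of_eq ?_) (h1.trans_eq ?_)
      · congr 1; push_cast; ring
      · ring
    have seg : ‖F (R + I * η R) - F R‖ ≤ (|c| * R⁻¹ + |A| * (R ^ 3)⁻¹) * C := by
      obtain ⟨hη1, hη2⟩ := hη R hR0.le
      have hd : ∀ s ∈ Icc (0 : ℝ) 1, HasDerivWithinAt
          (fun s : ℝ => F (R + I * η R * s)) (f (R + I * η R * s) * (I * η R)) (Icc 0 1) s := by
        intro s _
        have d1 : HasDerivAt (fun s : ℝ => (R : ℂ) + I * η R * s) (I * η R) s := by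
          simpa only [mul_one] using ((hasDerivAt_ofReal s).const_mul (I * η R : ℂ)).const_add (R : ℂ)
        exact ((hF _).comp s d1).hasDerivWithinAt
      have h1 := norm_image_sub_le_of_norm_deriv_le_segment'
        (C := (|c| * R⁻¹ + |A| * (R ^ 3)⁻¹) * C) hd (by
        intro s hs
        set k : ℂ := R + I * η R * s with hk
        have hre : k.re = R := by simp [hk]
        have him : k.im = η R * s := by simp [hk]
        have hkn : R ≤ ‖k‖ := hre ▸ (le_abs_self _).trans (abs_re_le_norm k)
        have hkm : k ∈ region C r := by
          refine ⟨?_, hrR.trans hkn⟩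
          rw [sq, mul_im, hre, him]
          have h3 : η R * s ≤ |η R| := by
            refine (le_abs_self _).trans ?_
            rw [abs_mul, abs_of_nonneg hs.1]
            exact mul_le_of_le_one_right (abs_nonneg _) hs.2.le
          nlinarith
        have hfk : ‖f k‖ ≤ |c| * R⁻¹ + |A| * (R ^ 3)⁻¹ := by
          have h4 := norm_le_insert' (f k) (I * c * k⁻¹)
          have h5 := hA k hkm
          have h6 : ‖I * c * k⁻¹‖ ≤ |c| * R⁻¹ := by
            rw [norm_mul, norm_mul, norm_I, one_mul, norm_real, Real.norm_eq_abs, norm_inv]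
            gcongr
          have h7 : |A| * (‖k‖ ^ 3)⁻¹ ≤ |A| * (R ^ 3)⁻¹ := by gcongr
          linarith
        rw [norm_mul, norm_mul, norm_I, one_mul, norm_real, Real.norm_eq_abs]
        exact mul_le_mul hfk hη1 (abs_nonneg _) (by positivity)) 1 ⟨zero_le_one, le_rfl⟩
      simpa using h1
    have e : (F (R + I * η R) - F (-(I * R))) - (-(c * (Real.pi / 2)) : ℂ) =
      ((F R - F (-(I * R))) - (-(c * (Real.pi / 2)) : ℂ)) + (F (R + I * η R) - F R) := by ring
    rw [e]
    exact (norm_add_le _ _).trans (add_le_add arc seg)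
  have hz : Tendsto (fun R : ℝ => |A| * (R ^ 2)⁻¹ * (Real.pi / 2)
      + (|c| * R⁻¹ + |A| * (R ^ 3)⁻¹) * C) atTop (𝓝 0) := by
    have t1 : Tendsto (fun R : ℝ => R⁻¹) atTop (𝓝 0) := tendsto_inv_atTop_zero
    have t2 : Tendsto (fun R : ℝ => (R ^ 2)⁻¹) atTop (𝓝 0) :=
      tendsto_inv_atTop_zero.comp (tendsto_pow_atTop two_ne_zero)
    have t3 : Tendsto (fun R : ℝ => (R ^ 3)⁻¹) atTop (𝓝 0) :=
      tendsto_inv_atTop_zero.comp (tendsto_pow_atTop three_ne_zero)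
    simpa using ((t2.const_mul |A|).mul_const (Real.pi / 2)).add
      (((t1.const_mul |c|).add (t3.const_mul |A|)).mul_const C)
  rw [tendsto_iff_norm_sub_tendsto_zero]
  refine squeeze_zero' (Eventually.of_forall fun _ => norm_nonneg _) ?_ hz
  filter_upwards [eventually_ge_atTop (max r 1)] with R hR using hb R hR

/-- The endpoints iR and R + iδ(R) cannot be joined by an arc through the first quadrant, where Im
k² is unbounded. Since k·m(k) is odd, its primitive F is even, and F(iR) = F(-iR) moves the arc to
the fourth quadrant. For `bar m` the primitive is the Schwarz conjugate of F, so the endpoint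
difference is the conjugate of F(R - iδ(R)) - F(-iR); its limit is the same because `c` is real. -/
theorem tendsto_integralD₁_entire {δ : ℝ → ℝ} (hδ : IsDepth δ) {m : ℂ → ℂ} {c C r : ℝ} (hC : 0 ≤ C)
    (hr : 0 < r) (hd : ∀ x, 0 ≤ x → δ x ≤ C ∧ 2 * x * δ x ≤ C)
    (hm : Differentiable ℂ m) (hev : ∀ k, m (-k) = m k)
    (hO : (fun k => m k - I * c * (k ^ 2)⁻¹) =O[𝓟 (region C r)] fun k => (k ^ 2)⁻¹ * (k ^ 2)⁻¹) :
    Tendsto (integralD₁ δ fun k => k * m k) atTop (𝓝 (-(c * (Real.pi / 2)))) ∧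
    Tendsto (integralD₁ δ fun k => k * bar m k) atTop (𝓝 (-(c * (Real.pi / 2)))) := by
  have hfd : Differentiable ℂ fun k => k * m k := differentiable_id.mul hm
  obtain ⟨F, hF⟩ := hfd.isExactOn_univ
  have hF' : ∀ k, HasDerivAt F (k * m k) k := fun k => hF k (mem_univ k)
  have hFe : ∀ k, F (-k) = F k := by
    intro k
    have h1 : ∀ k, HasDerivAt (fun k => F (-k) - F k) 0 k := by
      intro k
      have h2 : HasDerivAt (fun k : ℂ => F (-k)) ((-k * m (-k)) * (-1)) k :=
        (hF' (-k)).comp k (hasDerivAt_neg k)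
      refine (h2.sub (hF' k)).congr_deriv ?_
      rw [hev]; ring
    have h3 := is_const_of_deriv_eq_zero (fun k => (h1 k).differentiableAt)
      (fun k => (h1 k).deriv) k 0
    simpa [sub_eq_zero] using h3
  obtain ⟨A, hA⟩ := isBigO_principal.1 hO
  have hA' : ∀ k ∈ region C r, ‖k * m k - I * c * k⁻¹‖ ≤ A * (‖k‖ ^ 3)⁻¹ := by
    intro k hk
    have hk0 := ne_zero_of_mem_region hr hk
    have hkn := norm_pos_iff.2 hk0
    have e : k * m k - I * c * k⁻¹ = k * (m k - I * c * (k ^ 2)⁻¹) := by field_simp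
    have h1 := hA k hk
    rw [norm_sq_inv_mul] at h1
    rw [e, norm_mul]
    refine (mul_le_mul_of_nonneg_left h1 hkn.le).trans_eq ?_
    field_simp
  have hcont : ContinuousOn (fun k => k * m k) {k : ℂ | 0 < k.im} := hfd.continuous.continuousOn
  constructor
  · refine (tendsto_primitive_quarter_circle hC hF' hA' (η := δ) fun R hR => ?_).congr' ?_
    · rw [abs_of_pos (hδ.pos hR)]; exact hd R hR
    · filter_upwards [eventually_gt_atTop 0] with R hR
      rw [integralD₁_eq_sub hδ hcont (fun k _ => hF' k) hR, hFe]
  · have hlim := tendsto_primitive_quarter_circle hC hF' hA' (η := fun R => -δ R) fun R hR => by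
      rw [abs_neg, abs_of_pos (hδ.pos hR)]; exact hd R hR
    have h1 := (Complex.continuous_conj.tendsto _).comp hlim
    have e : starRingEnd ℂ (-(c * (Real.pi / 2)) : ℂ) = -(c * (Real.pi / 2)) := by
      have : (-(c * (Real.pi / 2)) : ℂ) = ((-(c * (Real.pi / 2)) : ℝ) : ℂ) := by push_cast; rfl
      rw [this, conj_ofReal]
    rw [e] at h1
    refine h1.congr' ?_
    filter_upwards [eventually_gt_atTop 0] with R hR
    have hG : ∀ k : ℂ, 0 < k.im → HasDerivAt (fun k => starRingEnd ℂ (F (starRingEnd ℂ k)))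
        (k * bar m k) k := by
      intro k _
      have := (hF' (starRingEnd ℂ k)).conj_conj
      rw [conj_conj] at this
      refine this.congr_deriv ?_
      simp [bar]
    have hcont' : ContinuousOn (fun k => k * bar m k) {k : ℂ | 0 < k.im} := by
      refine continuousOn_id.mul (Continuous.continuousOn ?_)
      exact Complex.continuous_conj.comp (hm.continuous.comp Complex.continuous_conj)
    rw [integralD₁_eq_sub hδ hcont' hG hR]
    simp [map_sub, map_add, map_mul]

theorem differentiable_hat {f : ℝ → ℝ → ℂ} {t : ℝ} (ht : 0 ≤ t)
    (hf : ContinuousOn (f t) (Icc (-t) t)) : Differentiable ℂ (hat f t) := by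
  intro k₀
  have hle : -t ≤ t := by linarith
  have hu : Ι (-t) t ⊆ Icc (-t) t := by
    rw [uIoc_of_le hle]; exact Ioc_subset_Icc_self
  have hF : ∀ k : ℂ, ContinuousOn (fun s : ℝ => exp (2 * I * k ^ 2 * (s - t)) * f t s)
      (Icc (-t) t) := fun k => by fun_prop
  set F' : ℂ → ℝ → ℂ := fun k s => exp (2 * I * k ^ 2 * (s - t)) * (4 * I * k * (s - t)) * f t s
    with hF'
  have hbd : ContinuousOn (fun p : ℂ × ℝ => F' p.1 p.2) (Metric.closedBall k₀ 1 ×ˢ Icc (-t) t) := by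
    have h1 : ContinuousOn (fun p : ℂ × ℝ => f t p.2) (Metric.closedBall k₀ 1 ×ˢ Icc (-t) t) :=
      hf.comp continuousOn_snd fun p hp => hp.2
    simp only [hF']
    refine ContinuousOn.mul ?_ h1
    fun_prop
  obtain ⟨C, hC⟩ := ((isCompact_closedBall k₀ 1).prod isCompact_Icc).exists_bound_of_continuousOn hbd
  have key := intervalIntegral.hasDerivAt_integral_of_dominated_loc_of_deriv_le (μ := volume)
    (a := -t) (b := t) (F' := F') (bound := fun _ => C) (s := Metric.ball k₀ 1) (x₀ := k₀)
    (F := fun (k : ℂ) (s : ℝ) => exp (2 * I * k ^ 2 * (s - t)) * f t s)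
    (Metric.ball_mem_nhds k₀ one_pos) ?_ ?_ ?_ ?_ ?_ ?_
  · exact key.2.differentiableAt
  · exact Eventually.of_forall fun k =>
      ((hF k).mono hu).aestronglyMeasurable measurableSet_uIoc
  · exact hat_intervalIntegrable ht k₀ hf
  · refine ContinuousOn.aestronglyMeasurable (ContinuousOn.mono ?_ hu) measurableSet_uIoc
    simp only [hF']
    fun_prop
  · exact Eventually.of_forall fun s hs k hk => hC (k, s) ⟨Metric.ball_subset_closedBall hk, hu hs⟩
  · exact intervalIntegrable_const
  · refine Eventually.of_forall fun s _ k _ => ?_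
    have d1 : HasDerivAt (fun k : ℂ => 2 * I * k ^ 2 * ((s : ℂ) - t)) (4 * I * k * (s - t)) k := by
      refine (((hasDerivAt_pow 2 k).const_mul (2 * I)).mul_const ((s : ℂ) - t)).congr_deriv ?_
      push_cast
      ring
    exact (d1.cexp.mul_const (f t s))

end NLSInterval

namespace NLSInterval

open MeasureTheory Asymptotics

/-! ### Orders of decay on the contour -/

/-- `f = O(kⁿ)` on the contour. -/
def HasOrder (δ : ℝ → ℝ) (n : ℤ) (f : ℂ → ℂ) : Prop :=
  f =O[𝓟 (contour δ)] fun k => k ^ n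

section HasOrder

variable {δ : ℝ → ℝ} {m n : ℤ} {f g : ℂ → ℂ}

theorem ne_zero_of_im_pos {k : ℂ} (hk : 0 < k.im) : k ≠ 0 := fun h => by simp [h] at hk

theorem HasOrder.add (hf : HasOrder δ n f) (hg : HasOrder δ n g) :
    HasOrder δ n (fun k => f k + g k) := IsBigO.add hf hg

theorem HasOrder.sub (hf : HasOrder δ n f) (hg : HasOrder δ n g) :
    HasOrder δ n (fun k => f k - g k) := IsBigO.sub hf hg

theorem HasOrder.const_mul (hf : HasOrder δ n f) (c : ℂ) :
    HasOrder δ n (fun k => c * f k) := hf.const_mul_left c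

theorem HasOrder.congr (hδ : IsDepth δ) (hf : HasOrder δ n f)
    (h : ∀ k : ℂ, 0 < k.im → f k = g k) : HasOrder δ n g := by
  rw [HasOrder, isBigO_principal] at hf ⊢
  obtain ⟨A, hA⟩ := hf
  exact ⟨A, fun k hk => h k (im_pos_of_mem_contour hδ hk) ▸ hA k hk⟩

theorem HasOrder.mul (hδ : IsDepth δ) (hf : HasOrder δ m f) (hg : HasOrder δ n g) :
    HasOrder δ (m + n) (fun k => f k * g k) := by
  have h := IsBigO.mul hf hg
  rw [HasOrder]
  refine h.congr' EventuallyEq.rfl ?_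
  refine eventually_principal.2 fun k hk => ?_
  exact (zpow_add₀ (ne_zero_of_im_pos (im_pos_of_mem_contour hδ hk)) m n).symm

theorem hasOrder_zpow (δ : ℝ → ℝ) (n : ℤ) : HasOrder δ n fun k => k ^ n := isBigO_refl _ _

theorem hasOrder_pow (δ : ℝ → ℝ) (n : ℕ) : HasOrder δ n fun k => k ^ n := by
  simpa using hasOrder_zpow δ n

theorem HasOrder.mono (hδ : IsDepth δ) (hf : HasOrder δ m f) (hmn : m ≤ n) : HasOrder δ n f := by
  refine IsBigO.trans hf ?_
  obtain ⟨C, r, hC, hr, -, -, hreg, -⟩ := exists_contour_subset_region hδ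
  rw [isBigO_principal]
  refine ⟨r ^ (m - n), fun k hk => ?_⟩
  have hk0 := ne_zero_of_im_pos (im_pos_of_mem_contour hδ hk)
  have hkn := norm_pos_iff.2 hk0
  have e : m = (m - n) + n := by ring
  rw [norm_zpow, norm_zpow]
  conv_lhs => rw [e, zpow_add₀ hkn.ne']
  refine mul_le_mul_of_nonneg_right ?_ (by positivity)
  obtain ⟨j, hj⟩ := Int.eq_ofNat_of_zero_le (sub_nonneg.2 hmn)
  have e2 : m - n = -(j : ℤ) := by omega
  rw [e2, zpow_neg, zpow_neg, zpow_natCast, zpow_natCast]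
  have := (hreg hk).2
  gcongr

/-- A remainder estimate `f = O(kᵐ)` on a region that contains the contour and its conjugate. -/
theorem hasOrder_of_region {C r : ℝ} (hreg : contour δ ⊆ region C r) {j : ℕ}
    (hf : f =O[𝓟 (region C r)] fun k => ((k ^ j)⁻¹ : ℂ)) : HasOrder δ (-j) f := by
  refine (hf.mono (principal_mono.2 hreg)).congr_right fun k => ?_
  rw [zpow_neg, zpow_natCast]

theorem hasOrder_bar_of_region {C r : ℝ}
    (hreg : ∀ k ∈ contour δ, starRingEnd ℂ k ∈ region C r) {j : ℕ}
    (hf : f =O[𝓟 (region C r)] fun k => ((k ^ j)⁻¹ : ℂ)) : HasOrder δ (-j) (bar f) := by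
  rw [isBigO_principal] at hf
  obtain ⟨A, hA⟩ := hf
  rw [HasOrder, isBigO_principal]
  refine ⟨A, fun k hk => ?_⟩
  have := hA _ (hreg k hk)
  rw [bar, RCLike.norm_conj]
  refine this.trans_eq ?_
  rw [norm_inv, norm_pow, RCLike.norm_conj, norm_zpow, zpow_neg, zpow_natCast]

end HasOrder

/-! ### Convergence for integrands of the form (Σ/Δ)X + Y/Δ + Z -/

theorem continuous_Sig (L : ℝ) : Continuous (Sig L) := by unfold Sig; fun_prop

theorem continuous_Del (L : ℝ) : Continuous (Del L) := by unfold Del; fun_prop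

/-- Σ/Δ = -1 + 2e^{2ikL}/Δ, where the exponential is bounded by 1 in the upper half-plane; each of Σ
and Δ alone grows exponentially along the imaginary axis. -/
theorem norm_Sig_div_Del_le {L : ℝ} (hL : 0 < L) {k : ℂ} (hk : 0 < k.im) :
    ‖Sig L k / Del L k‖ ≤ 2 * (1 + ‖Del L k‖⁻¹) := by
  have hD := Del_ne_zero hL hk
  have e : Sig L k / Del L k = -1 + 2 * exp (2 * I * k * L) * (Del L k)⁻¹ := by
    field_simp
    simp only [Sig, Del]
    ring
  have h1 : ‖exp (2 * I * k * L)‖ ≤ 1 := by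
    rw [norm_exp, Real.exp_le_one_iff]
    have : (2 * I * k * L).re = -(2 * (k.im * L)) := by simp; ring
    rw [this]
    have : 0 < k.im * L := by positivity
    linarith
  rw [e]
  refine (norm_add_le _ _).trans ?_
  rw [norm_neg, norm_one, norm_mul, norm_mul, Complex.norm_ofNat, norm_inv]
  have h2 : 0 ≤ ‖Del L k‖⁻¹ := by positivity
  nlinarith [mul_le_mul_of_nonneg_right h1 h2]

theorem exists_integral_of_decomposition {δ : ℝ → ℝ} (hδ : IsDepth δ) {L : ℝ} (hL : 0 < L)
    {X Y Z : ℂ → ℂ} {c : ℂ} (cX : Continuous X) (cY : Continuous Y) (cZ : Continuous Z)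
    (hX : HasOrder δ (-2) X) (hY : HasOrder δ (-2) Y)
    (hZ : HasOrder δ (-2) fun k => Z k - c * k⁻¹) :
    ContinuousOn (fun k => Sig L k / Del L k * X k + (Del L k)⁻¹ * Y k + Z k) {k | 0 < k.im} ∧
    ∃ v, Tendsto (integralD₁ δ fun k => Sig L k / Del L k * X k + (Del L k)⁻¹ * Y k + Z k) atTop
      (𝓝 v) := by
  have hD : ∀ k ∈ {k : ℂ | 0 < k.im}, Del L k ≠ 0 := fun k hk => Del_ne_zero hL hk
  have cD := (continuous_Del L).continuousOn (s := {k : ℂ | 0 < k.im})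
  have c1 : ContinuousOn (fun k => Sig L k / Del L k * X k + (Del L k)⁻¹ * Y k) {k | 0 < k.im} :=
    (((continuous_Sig L).continuousOn.div cD hD).mul cX.continuousOn).add
      ((cD.inv₀ hD).mul cY.continuousOn)
  have ci : ContinuousOn (fun k : ℂ => c * k⁻¹) {k | 0 < k.im} :=
    continuousOn_const.mul (continuousOn_inv₀.mono fun k hk => ne_zero_of_im_pos hk)
  have c2 : ContinuousOn (fun k => Sig L k / Del L k * X k + (Del L k)⁻¹ * Y k
      + (Z k - c * k⁻¹)) {k | 0 < k.im} := c1.add (cZ.continuousOn.sub ci)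
  refine ⟨c1.add cZ.continuousOn, ?_⟩
  have e2 : ∀ k : ℂ, ‖k ^ (-2 : ℤ)‖ = (‖k‖ ^ 2)⁻¹ := fun k => by
    rw [norm_zpow, zpow_neg]; norm_cast
  obtain ⟨v, hv⟩ := integralD₁_converges hδ hL c2 (by
    obtain ⟨A₁, h₁⟩ := isBigO_principal.1 hX
    obtain ⟨A₂, h₂⟩ := isBigO_principal.1 hY
    obtain ⟨A₃, h₃⟩ := isBigO_principal.1 hZ
    rw [isBigO_principal]
    refine ⟨2 * |A₁| + |A₂| + |A₃|, fun k hk => ?_⟩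
    have hk0 := im_pos_of_mem_contour hδ hk
    have b1 := h₁ k hk
    have b2 := h₂ k hk
    have b3 := h₃ k hk
    rw [e2] at b1 b2 b3
    rw [norm_mul, norm_inv, norm_pow, norm_real]
    set κ := (‖k‖ ^ 2)⁻¹ with hκ
    have hκ0 : 0 ≤ κ := by positivity
    have hd0 : 0 ≤ ‖Del L k‖⁻¹ := by positivity
    set d := ‖Del L k‖⁻¹ with hd
    rw [Real.norm_of_nonneg (by positivity)]
    have b1' : ‖Sig L k / Del L k * X k‖ ≤ 2 * (1 + d) * (|A₁| * κ) := by
      rw [norm_mul]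
      exact mul_le_mul (norm_Sig_div_Del_le hL hk0)
        (b1.trans (mul_le_mul_of_nonneg_right (le_abs_self _) hκ0)) (norm_nonneg _) (by positivity)
    have b2' : ‖(Del L k)⁻¹ * Y k‖ ≤ (1 + d) * (|A₂| * κ) := by
      rw [norm_mul, norm_inv]
      exact mul_le_mul (by linarith)
        (b2.trans (mul_le_mul_of_nonneg_right (le_abs_self _) hκ0)) (norm_nonneg _) (by positivity)
    have b3' : ‖Z k - c * k⁻¹‖ ≤ (1 + d) * (|A₃| * κ) := by
      refine b3.trans ?_
      have : 0 ≤ |A₃| * κ := by positivity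
      nlinarith [mul_le_mul_of_nonneg_right (le_abs_self A₃) hκ0, mul_nonneg hd0 this]
    refine (norm_add_le _ _).trans ((add_le_add ((norm_add_le _ _).trans
      (add_le_add b1' b2')) b3').trans_eq ?_)
    ring)
  obtain ⟨w, hw⟩ := tendsto_integralD₁_inv hδ
  refine ⟨v + c * w, (hv.add (hw.const_mul c)).congr' ?_⟩
  filter_upwards [eventually_gt_atTop 0] with R hR
  rw [← integralD₁_const_mul, ← integralD₁_add hδ c2 ci hR]
  exact integralD₁_congr hδ (fun k _ => by ring) hR

/-- The common frame of the four equalities: convergence comes from the decomposition, oddness of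
`dir` transfers its integral from `∂D₃⁰` to `∂D₁⁰`, and `corr` is the part of the GLM integrand that
integrates to zero. -/
theorem exists_common_integral {δ : ℝ → ℝ} (hδ : IsDepth δ) {L : ℝ} (hL : 0 < L)
    {X Y Z dir glm corr : ℂ → ℂ} {c : ℂ} (cX : Continuous X) (cY : Continuous Y)
    (cZ : Continuous Z) (hX : HasOrder δ (-2) X) (hY : HasOrder δ (-2) Y)
    (hZ : HasOrder δ (-2) fun k => Z k - c * k⁻¹) (hodd : ∀ k, dir (-k) = -dir k)
    (hdir : ∀ k : ℂ, 0 < k.im → dir k = Sig L k / Del L k * X k + (Del L k)⁻¹ * Y k + Z k)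
    (hglm : ∀ k : ℂ, 0 < k.im → glm k = dir k + corr k)
    (ccorr : Continuous corr) (hcorr : Tendsto (integralD₁ δ corr) atTop (𝓝 0)) (C : ℂ) :
    ∃ v, HasIntegralD₁ δ C glm v ∧ HasIntegralD₃ δ C dir v := by
  obtain ⟨hc, v, hv⟩ := exists_integral_of_decomposition hδ hL cX cY cZ hX hY hZ
  refine ⟨C * v, ?_, ?_⟩
  · have := (hv.add hcorr).const_mul C
    rw [add_zero] at this
    refine this.congr' ?_
    filter_upwards [eventually_gt_atTop 0] with R hR
    rw [← integralD₁_add hδ hc ccorr.continuousOn hR]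
    congr 1
    exact integralD₁_congr hδ (fun k hk => by rw [hglm k hk, hdir k hk]) hR
  · refine (hv.const_mul C).congr' ?_
    filter_upwards [eventually_gt_atTop 0] with R hR
    rw [integralD₃_eq_of_odd δ hodd]
    congr 1
    exact integralD₁_congr hδ (fun k hk => (hdir k hk).symm) hR

/-! ### Parity of the integrands -/

theorem plusPart_neg (f : ℂ → ℂ) (k : ℂ) : plusPart f (-k) = plusPart f k := by
  simp [plusPart, add_comm]

theorem minusPart_neg (f : ℂ → ℂ) (k : ℂ) : minusPart f (-k) = -minusPart f k := by
  simp [minusPart]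

theorem Del_neg (L : ℝ) (k : ℂ) : Del L (-k) = -Del L k := by
  simp [Del]

theorem Sig_neg (L : ℝ) (k : ℂ) : Sig L (-k) = Sig L k := by
  simp [Sig, add_comm]

section Parity

variable (L : ℝ) (g₀ h₀ : ℂ) (Φ₁ Φ₂ φ₁ φ₂ : ℂ → ℂ) (k : ℂ)

theorem directG₁_neg : directG₁ L g₀ h₀ Φ₁ Φ₂ φ₁ φ₂ (-k) = -directG₁ L g₀ h₀ Φ₁ Φ₂ φ₁ φ₂ k := by
  simp only [directG₁, minusPart_neg, Del_neg, Sig_neg, mul_neg, div_neg]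
  ring

theorem directH₁_neg : directH₁ L g₀ h₀ Φ₁ Φ₂ φ₁ φ₂ (-k) = -directH₁ L g₀ h₀ Φ₁ Φ₂ φ₁ φ₂ k := by
  simp only [directH₁, minusPart_neg, Del_neg, Sig_neg, mul_neg, div_neg]
  ring

theorem directG₀_neg : directG₀ L Φ₁ Φ₂ φ₁ φ₂ (-k) = -directG₀ L Φ₁ Φ₂ φ₁ φ₂ k := by
  simp only [directG₀, plusPart_neg, Del_neg, Sig_neg, div_neg]
  ring

theorem directH₀_neg : directH₀ L Φ₁ Φ₂ φ₁ φ₂ (-k) = -directH₀ L Φ₁ Φ₂ φ₁ φ₂ k := by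
  simp only [directH₀, plusPart_neg, Del_neg, Sig_neg, div_neg]
  ring

end Parity

/-! ### Expansion of the integrands in even coefficient functions -/

/-- `Φ₁ = A + kM`, `bar Φ₂ = 1 + B + kD`, `Φ₂₋ = 2kN` with even continuous coefficients that decay
on the contour. -/
structure EvenExpansion (δ : ℝ → ℝ) (Φ₁ Φ₂ : ℂ → ℂ) (g c : ℂ) (A M B D N : ℂ → ℂ) : Prop where
  fst : ∀ k, Φ₁ k = A k + k * M k
  bar_snd : ∀ k, bar Φ₂ k = 1 + B k + k * D k
  minus_snd : ∀ k, minusPart Φ₂ k = 2 * k * N k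
  even_A : ∀ k, A (-k) = A k
  even_M : ∀ k, M (-k) = M k
  even_B : ∀ k, B (-k) = B k
  even_D : ∀ k, D (-k) = D k
  cont_A : Continuous A
  cont_M : Continuous M
  cont_B : Continuous B
  cont_D : Continuous D
  cont_N : Continuous N
  order_A : HasOrder δ (-2) A
  order_B : HasOrder δ (-2) B
  order_M : HasOrder δ (-4) fun k => M k - g / (2 * I) * (k ^ 2)⁻¹
  order_D : HasOrder δ (-4) fun k => D k - -(I * c) * (k ^ 2)⁻¹
  order_N : HasOrder δ (-4) fun k => N k - I * c * (k ^ 2)⁻¹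

section Expansion

variable {δ : ℝ → ℝ} {Φ₁ Φ₂ φ₁ φ₂ : ℂ → ℂ} {g h c d : ℂ} {A M B D N A' M' B' D' N' : ℂ → ℂ} {L : ℝ}

/-- Write the product Φ₁(bar φ₂ - 1) as E + O with E even and O odd. Symmetrizing with the
exponentials gives e^{-2ikL}(E + O) + e^{2ikL}(E - O) = ΣE - ΔO, so division by Δ leaves a Σ/Δ term
and a term without denominator. The antisymmetric variant ΣO - ΔE governs the `g₁` and `h₁`
formulas. -/
theorem directG₀_eq (S : EvenExpansion δ Φ₁ Φ₂ g c A M B D N)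
    (S' : EvenExpansion δ φ₁ φ₂ h d A' M' B' D' N') (hL : 0 < L) {k : ℂ} (hk : 0 < k.im) :
    directG₀ L Φ₁ Φ₂ φ₁ φ₂ k =
      Sig L k / Del L k * (A k + (A k * B' k + k ^ 2 * (M k * D' k)))
      + (Del L k)⁻¹ * (-2 * (A' k + (A' k * B k + k ^ 2 * (M' k * D k))))
      + -1 * (k ^ 1 * (A k * D' k + M k * B' k)) := by
  have hD := Del_ne_zero hL hk
  have e1 : exp (-2 * I * -k * L) = exp (2 * I * k * L) := by congr 1; ring
  simp only [directG₀, plusPart, S.fst, S'.fst, S.bar_snd, S'.bar_snd, S.even_A, S.even_M, S.even_B,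
    S.even_D, S'.even_A, S'.even_M, S'.even_B, S'.even_D, e1]
  simp only [Sig, Del] at hD ⊢
  generalize exp (2 * I * k * L) = p at hD ⊢
  generalize exp (-2 * I * k * L) = q at hD ⊢
  field_simp
  ring

theorem directH₀_eq (S : EvenExpansion δ Φ₁ Φ₂ g c A M B D N)
    (S' : EvenExpansion δ φ₁ φ₂ h d A' M' B' D' N') (hL : 0 < L) {k : ℂ} (hk : 0 < k.im) :
    directH₀ L Φ₁ Φ₂ φ₁ φ₂ k =
      Sig L k / Del L k * (-1 * (A' k + (A' k * B k + k ^ 2 * (M' k * D k))))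
      + (Del L k)⁻¹ * (2 * (A k + (A k * B' k + k ^ 2 * (M k * D' k))))
      + -1 * (k ^ 1 * (A' k * D k + M' k * B k)) := by
  have hD := Del_ne_zero hL hk
  have e1 : exp (2 * I * -k * L) = exp (-2 * I * k * L) := by congr 1; ring
  simp only [directH₀, plusPart, S.fst, S'.fst, S.bar_snd, S'.bar_snd, S.even_A, S.even_M, S.even_B,
    S.even_D, S'.even_A, S'.even_M, S'.even_B, S'.even_D, e1]
  simp only [Sig, Del] at hD ⊢
  generalize exp (2 * I * k * L) = p at hD ⊢
  generalize exp (-2 * I * k * L) = q at hD ⊢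
  field_simp
  ring

theorem div_two_mul_I (z : ℂ) : z / (2 * I) = -(I / 2) * z := by
  rw [mul_comm 2 I, ← div_div, div_I]; ring

theorem div_four_mul_I (z : ℂ) : z / (4 * I) = -(I / 4) * z := by
  rw [mul_comm 4 I, ← div_div, div_I]; ring

theorem directG₁_eq (S : EvenExpansion δ Φ₁ Φ₂ g c A M B D N)
    (S' : EvenExpansion δ φ₁ φ₂ h d A' M' B' D' N') (hL : 0 < L) {k : ℂ} (hk : 0 < k.im) :
    directG₁ L g h Φ₁ Φ₂ φ₁ φ₂ k =
      Sig L k / Del L k * ((k ^ 2 * M k + I / 2 * g) + k ^ 2 * (A k * D' k + M k * B' k))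
      + (Del L k)⁻¹ * (-2 * ((k ^ 2 * M' k + I / 2 * h) + k ^ 2 * (A' k * D k + M' k * B k)))
      + (-(I / 2) * g * (k ^ 1 * N' k) + I * g * (k ^ 1 * N k)
        - (k ^ 1 * (A k * B' k) + k ^ 3 * (M k * D' k))) := by
  have hD := Del_ne_zero hL hk
  have e1 : exp (-2 * I * -k * L) = exp (2 * I * k * L) := by congr 1; ring
  simp only [directG₁, S.minus_snd, S'.minus_snd, div_four_mul_I]
  simp only [minusPart, S.fst, S'.fst, S.bar_snd, S'.bar_snd, S.even_A, S.even_M, S.even_B,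
    S.even_D, S'.even_A, S'.even_M, S'.even_B, S'.even_D, e1]
  simp only [Sig, Del] at hD ⊢
  generalize exp (2 * I * k * L) = p at hD ⊢
  generalize exp (-2 * I * k * L) = q at hD ⊢
  field_simp
  ring

theorem directH₁_eq (S : EvenExpansion δ Φ₁ Φ₂ g c A M B D N)
    (S' : EvenExpansion δ φ₁ φ₂ h d A' M' B' D' N') (hL : 0 < L) {k : ℂ} (hk : 0 < k.im) :
    directH₁ L g h Φ₁ Φ₂ φ₁ φ₂ k =
      Sig L k / Del L k * (-1 * ((k ^ 2 * M' k + I / 2 * h) + k ^ 2 * (A' k * D k + M' k * B k)))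
      + (Del L k)⁻¹ * (2 * ((k ^ 2 * M k + I / 2 * g) + k ^ 2 * (A k * D' k + M k * B' k)))
      + (-(I / 2) * h * (k ^ 1 * N k) + I * h * (k ^ 1 * N' k)
        - (k ^ 1 * (A' k * B k) + k ^ 3 * (M' k * D k))) := by
  have hD := Del_ne_zero hL hk
  have e1 : exp (2 * I * -k * L) = exp (-2 * I * k * L) := by congr 1; ring
  simp only [directH₁, S.minus_snd, S'.minus_snd, div_four_mul_I]
  simp only [minusPart, S.fst, S'.fst, S.bar_snd, S'.bar_snd, S.even_A, S.even_M, S.even_B,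
    S.even_D, S'.even_A, S'.even_M, S'.even_B, S'.even_D, e1]
  simp only [Sig, Del] at hD ⊢
  generalize exp (2 * I * k * L) = p at hD ⊢
  generalize exp (-2 * I * k * L) = q at hD ⊢
  field_simp
  ring

theorem hasOrder_const_mul_sq_inv (δ : ℝ → ℝ) (c : ℂ) : HasOrder δ (-2) fun k => c * (k ^ 2)⁻¹ := by
  refine HasOrder.const_mul ?_ c
  simpa [zpow_neg] using hasOrder_zpow δ (-2)

theorem HasOrder.of_sub_sq_inv {f : ℂ → ℂ} (hδ : IsDepth δ)
    (hf : HasOrder δ (-4) fun k => f k - c * (k ^ 2)⁻¹) : HasOrder δ (-2) f :=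
  ((hf.mono hδ (by norm_num : (-4 : ℤ) ≤ -2)).add (hasOrder_const_mul_sq_inv δ c)).congr hδ
    fun k _ => by ring

theorem HasOrder.mul_mul {f₁ f₂ : ℂ → ℂ} (hδ : IsDepth δ) {p : ℕ} (hp : p ≤ 2)
    (h₁ : HasOrder δ (-2) f₁) (h₂ : HasOrder δ (-2) f₂) :
    HasOrder δ (-2) fun k => k ^ p * (f₁ k * f₂ k) :=
  ((hasOrder_pow δ p).mul hδ (h₁.mul hδ h₂)).mono hδ (by omega)

theorem HasOrder.mul_sub_inv {f : ℂ → ℂ} (hδ : IsDepth δ)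
    (hf : HasOrder δ (-4) fun k => f k - c * (k ^ 2)⁻¹) :
    HasOrder δ (-2) fun k => k ^ 1 * f k - c * k⁻¹ := by
  refine (((hasOrder_pow δ 1).mul hδ hf).mono hδ (n := -2) (by norm_num)).congr hδ fun k hk => ?_
  have := ne_zero_of_im_pos hk
  field_simp

/-- From f₁f₂ - cd/k⁴ = (f₁ - c/k²)f₂ + (c/k²)(f₂ - d/k²), where both terms are O(k⁻⁶). -/
theorem HasOrder.cube_mul_sub_inv {f₁ f₂ : ℂ → ℂ} (hδ : IsDepth δ)
    (h₁ : HasOrder δ (-4) fun k => f₁ k - c * (k ^ 2)⁻¹)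
    (h₂ : HasOrder δ (-4) fun k => f₂ k - d * (k ^ 2)⁻¹) :
    HasOrder δ (-2) fun k => k ^ 3 * (f₁ k * f₂ k) - c * d * k⁻¹ := by
  have h3 := (hasOrder_pow δ 3).mul hδ ((h₁.mul hδ (h₂.of_sub_sq_inv hδ)).add
    (((hasOrder_const_mul_sq_inv δ c).mul hδ h₂).mono hδ (by norm_num)))
  refine (h3.mono hδ (n := -2) (by norm_num)).congr hδ fun k hk => ?_
  have := ne_zero_of_im_pos hk
  field_simp
  ring

theorem HasOrder.sq_mul_add {f : ℂ → ℂ} (hδ : IsDepth δ)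
    (hf : HasOrder δ (-4) fun k => f k - g / (2 * I) * (k ^ 2)⁻¹) :
    HasOrder δ (-2) fun k => k ^ 2 * f k + I / 2 * g := by
  refine (((hasOrder_pow δ 2).mul hδ hf).mono hδ (n := -2) (by norm_num)).congr hδ fun k hk => ?_
  have := ne_zero_of_im_pos hk
  rw [div_two_mul_I]
  field_simp
  ring

theorem EvenExpansion.order_even (hδ : IsDepth δ) (S : EvenExpansion δ Φ₁ Φ₂ g c A M B D N)
    (S' : EvenExpansion δ φ₁ φ₂ h d A' M' B' D' N') :
    HasOrder δ (-2) fun k => A k + (A k * B' k + k ^ 2 * (M k * D' k)) := by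
  have h1 := HasOrder.mul_mul hδ (p := 0) (by norm_num) S.order_A S'.order_B
  simp only [pow_zero, one_mul] at h1
  exact S.order_A.add (h1.add (HasOrder.mul_mul hδ le_rfl
    (S.order_M.of_sub_sq_inv hδ) (S'.order_D.of_sub_sq_inv hδ)))

theorem EvenExpansion.order_odd (hδ : IsDepth δ) (S : EvenExpansion δ Φ₁ Φ₂ g c A M B D N)
    (S' : EvenExpansion δ φ₁ φ₂ h d A' M' B' D' N') {p : ℕ} (hp : p ≤ 2) :
    HasOrder δ (-2) fun k => k ^ p * (A k * D' k + M k * B' k) :=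
  ((HasOrder.mul_mul hδ hp S.order_A (S'.order_D.of_sub_sq_inv hδ)).add
    (HasOrder.mul_mul hδ hp (S.order_M.of_sub_sq_inv hδ) S'.order_B)).congr hδ fun k _ => by ring

/-- The denominator-free part of the `g₁` and `h₁` integrands is only O(k⁻¹): k·N, k·N' and k³·M·D'
each have a 1/k term. This is why the sharp expansions of M̂₁ and M̂₂ are needed. -/
theorem EvenExpansion.order_conditional (hδ : IsDepth δ) (S : EvenExpansion δ Φ₁ Φ₂ g c A M B D N)
    (S' : EvenExpansion δ φ₁ φ₂ h d A' M' B' D' N') :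
    ∃ e : ℂ, HasOrder δ (-2) fun k => (-(I / 2) * g * (k ^ 1 * N' k) + I * g * (k ^ 1 * N k)
        - (k ^ 1 * (A k * B' k) + k ^ 3 * (M k * D' k))) - e * k⁻¹ :=
  ⟨-(I / 2) * g * (I * d) + I * g * (I * c) - g / (2 * I) * -(I * d),
    ((((HasOrder.mul_sub_inv hδ S'.order_N).const_mul (-(I / 2) * g)).add
    ((HasOrder.mul_sub_inv hδ S.order_N).const_mul (I * g))).sub
    ((HasOrder.mul_mul hδ (p := 1) (by norm_num) S.order_A S'.order_B).add
      (HasOrder.cube_mul_sub_inv hδ S.order_M S'.order_D))).congr hδ fun k _ => by ring⟩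

end Expansion

end NLSInterval

namespace NLSInterval

open MeasureTheory Asymptotics

/-! ### The expansion of an eigenpair -/

theorem bar_neg_of_even {f : ℂ → ℂ} (hf : ∀ k, f (-k) = f k) (k : ℂ) : bar f (-k) = bar f k := by
  simp [bar, hf]

theorem continuous_bar {f : ℂ → ℂ} (hf : Continuous f) : Continuous (bar f) :=
  continuous_conj.comp (hf.comp continuous_conj)

theorem isBigO_section {f : ℝ × ℂ → ℂ} {g : ℝ × ℂ → ℂ} {t : ℝ} (ht : 0 < t)
    {s : Set ℂ} (h : f =O[𝓟 (Ioc 0 t ×ˢ s)] g) :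
    (fun k => f (t, k)) =O[𝓟 s] fun k => g (t, k) := by
  rw [isBigO_principal] at h ⊢
  obtain ⟨A, hA⟩ := h
  exact ⟨A, fun k hk => hA (t, k) ⟨⟨ht, le_rfl⟩, hk⟩⟩

theorem sq_inv_mul_sq_inv (k : ℂ) : (k ^ 2)⁻¹ * (k ^ 2)⁻¹ = (k ^ 4)⁻¹ := by
  rw [← mul_inv]; ring

/-- The even part of `Φ₁`. -/
noncomputable def evenPartFst (K : GLMKernels) (a : ℝ → ℂ) (t : ℝ) (k : ℂ) : ℂ :=
  hat K.L₁ t k - I / 2 * a t * hat K.M₂ t k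

/-- The even part of `bar Φ₂ - 1`. -/
noncomputable def evenPartBarSnd (lam : ℝ) (K : GLMKernels) (a : ℝ → ℂ) (t : ℝ) (k : ℂ) : ℂ :=
  bar (hat K.L₂ t) k - I * lam * (a t / 2) * bar (hat K.M₁ t) k

theorem evenPartFst_neg (K : GLMKernels) (a : ℝ → ℂ) (t : ℝ) (k : ℂ) :
    evenPartFst K a t (-k) = evenPartFst K a t k := by
  simp only [evenPartFst, hat_even]

theorem evenPartBarSnd_neg (lam : ℝ) (K : GLMKernels) (a : ℝ → ℂ) (t : ℝ) (k : ℂ) :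
    evenPartBarSnd lam K a t (-k) = evenPartBarSnd lam K a t k := by
  simp only [evenPartBarSnd, bar_neg_of_even (hat_even _ _)]

/-- The representation of `(Φ₁, Φ₂)` by the kernels of the Goursat problem is an expansion in
even coefficients, and the odd functions `k ↦ k M̂₂(k)` and its conjugate have the same integral. -/
theorem IsEigenpair.exists_evenExpansion {lam T : ℝ} {a b : ℝ → ℂ} {Φ₁ Φ₂ : ℝ → ℂ → ℂ}
    {K : GLMKernels} {δ : ℝ → ℝ} (hδ : IsDepth δ) (hΦ : IsEigenpair lam T a b Φ₁ Φ₂)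
    (hK : K.Solves lam T a b) (ha : ContDiffOn ℝ 2 a (Ico 0 T)) (hb : ContDiffOn ℝ 1 b (Ico 0 T))
    (ha0 : a 0 = 0) {t : ℝ} (ht : t ∈ Ioo 0 T) :
    (∃ c : ℝ, EvenExpansion δ (Φ₁ t) (Φ₂ t) (a t) c (evenPartFst K a t) (hat K.M₁ t)
      (evenPartBarSnd lam K a t) (bar (hat K.M₂ t)) (hat K.M₂ t)) ∧
    (Continuous fun k => k * bar (hat K.M₂ t) k - k * hat K.M₂ t k) ∧
    Tendsto (integralD₁ δ fun k => k * bar (hat K.M₂ t) k - k * hat K.M₂ t k) atTop (𝓝 0) := by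
  obtain ⟨C, r, hC, hr, hd, -, hreg, hreg'⟩ := exists_contour_subset_region hδ
  have hdiff : ∀ {f : ℝ → ℝ → ℂ}, ContDiffOn ℝ 1 (fun p : ℝ × ℝ => f p.1 p.2) (triangle T) →
      Differentiable ℂ (hat f t) := fun hf =>
    differentiable_hat ht.1.le (continuousOn_slice hf.continuousOn ht.1.le ht.2)
  have dL₁ := hdiff hK.contDiffOn_L₁
  have dL₂ := hdiff hK.contDiffOn_L₂
  have dM₁ := hdiff hK.contDiffOn_M₁
  have dM₂ := hdiff hK.contDiffOn_M₂
  have O1 := isBigO_section ht.1 (isBigO_hat hC hr hK.contDiffOn_L₁ ht)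
  have O2 := isBigO_section ht.1 (isBigO_hat hC hr hK.contDiffOn_L₂ ht)
  have O3 := isBigO_section ht.1 (isBigO_hat hC hr hK.contDiffOn_M₁ ht)
  have O4 := isBigO_section ht.1 (isBigO_hat hC hr hK.contDiffOn_M₂ ht)
  have O5 := isBigO_section ht.1 (hK.isBigO_hat_M₁ ha hb ha0 hC hr ht)
  obtain ⟨c, O6⟩ := hK.isBigO_hat_M₂ ha hb ha0 hC hr ht
  obtain ⟨E1, E2⟩ := tendsto_integralD₁_entire hδ hC hr hd dM₂ (hat_even _ _) O6
  have cM₂ := dM₂.continuous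
  have cM₂' := continuous_bar cM₂
  simp only [sq_inv_mul_sq_inv] at O5 O6
  have hrep := fun k => hΦ.eq_hat hK (ha.of_le (by norm_num)) hb.continuousOn k ht
  refine ⟨⟨c, ?_⟩, by fun_prop, ?_⟩
  · exact
    { fst := fun k => (hrep k).1
      bar_snd := fun k => by
        rw [bar, (hrep _).2]
        simp only [evenPartBarSnd, bar, map_add, map_mul, map_one, map_div₀, conj_I, conj_ofReal,
          conj_conj, map_ofNat]
        ring
      minus_snd := fun k => by
        simp only [minusPart, (hrep _).2, hat_even]
        ring
      even_A := evenPartFst_neg _ _ _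
      even_M := hat_even _ _
      even_B := evenPartBarSnd_neg _ _ _ _
      even_D := bar_neg_of_even (hat_even _ _)
      cont_A := dL₁.continuous.sub (continuous_const.mul cM₂)
      cont_M := dM₁.continuous
      cont_B := (continuous_bar dL₂.continuous).sub
        (continuous_const.mul (continuous_bar dM₁.continuous))
      cont_D := cM₂'
      cont_N := cM₂
      order_A := (hasOrder_of_region hreg (j := 2) O1).sub
        ((hasOrder_of_region hreg (j := 2) O4).const_mul _)
      order_B := (hasOrder_bar_of_region hreg' (j := 2) O2).sub
        ((hasOrder_bar_of_region hreg' (j := 2) O3).const_mul _)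
      order_M := hasOrder_of_region hreg (j := 4) O5
      order_D := (hasOrder_bar_of_region hreg' (j := 4) O6).congr hδ fun k _ => by
        simp only [bar, map_sub, map_mul, map_inv₀, map_pow, conj_I, conj_ofReal, conj_conj]
        ring
      order_N := hasOrder_of_region hreg (j := 4) O6 }
  · have := E2.add (E1.const_mul (-1))
    rw [neg_one_mul, add_neg_cancel] at this
    refine this.congr' ?_
    filter_upwards [eventually_gt_atTop 0] with R hR
    rw [← integralD₁_const_mul, ← integralD₁_add hδ (by fun_prop) (by fun_prop) hR]
    exact integralD₁_congr hδ (fun k _ => by ring) hR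

/-! ### Expansion of the integrands built from the kernels -/

section Expansion

variable (lam L : ℝ) (g₀ h₀ : ℝ → ℂ) (K N : GLMKernels) (t : ℝ) (k : ℂ)

theorem glmF_eq : glmF lam L g₀ h₀ K N t k =
    I / 2 * h₀ t * exp (2 * I * k * L) * hat N.M₂ t k - I / 2 * g₀ t * hat K.M₂ t k
    + (evenPartBarSnd lam N h₀ t k + k * bar (hat N.M₂ t) k)
      * (evenPartFst K g₀ t k + k * hat K.M₁ t k)
    - exp (2 * I * k * L) * (evenPartBarSnd lam K g₀ t k + k * bar (hat K.M₂ t) k)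
      * (evenPartFst N h₀ t k + k * hat N.M₁ t k) := rfl

theorem glmF_neg : glmF lam L g₀ h₀ K N t (-k) =
    I / 2 * h₀ t * exp (-2 * I * k * L) * hat N.M₂ t k - I / 2 * g₀ t * hat K.M₂ t k
    + (evenPartBarSnd lam N h₀ t k - k * bar (hat N.M₂ t) k)
      * (evenPartFst K g₀ t k - k * hat K.M₁ t k)
    - exp (-2 * I * k * L) * (evenPartBarSnd lam K g₀ t k - k * bar (hat K.M₂ t) k)
      * (evenPartFst N h₀ t k - k * hat N.M₁ t k) := by
  have e : exp (2 * I * -k * L) = exp (-2 * I * k * L) := by congr 1; ring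
  simp only [glmF_eq, e, hat_even, bar_neg_of_even (hat_even _ _), evenPartFst_neg,
    evenPartBarSnd_neg]
  ring

theorem exp_mul_exp_neg : exp (-2 * I * k * L) * exp (2 * I * k * L) = 1 := by
  rw [← exp_add, ← exp_zero]; congr 1; ring

theorem exp_mul_glmF : exp (-2 * I * k * L) * glmF lam L g₀ h₀ K N t k =
    I / 2 * h₀ t * hat N.M₂ t k - I / 2 * g₀ t * exp (-2 * I * k * L) * hat K.M₂ t k
    + exp (-2 * I * k * L) * (evenPartBarSnd lam N h₀ t k + k * bar (hat N.M₂ t) k)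
      * (evenPartFst K g₀ t k + k * hat K.M₁ t k)
    - (evenPartBarSnd lam K g₀ t k + k * bar (hat K.M₂ t) k)
      * (evenPartFst N h₀ t k + k * hat N.M₁ t k) := by
  rw [glmF_eq]
  linear_combination (I / 2 * h₀ t * hat N.M₂ t k
    - (evenPartBarSnd lam K g₀ t k + k * bar (hat K.M₂ t) k)
      * (evenPartFst N h₀ t k + k * hat N.M₁ t k)) * exp_mul_exp_neg L k

theorem exp_mul_glmF_neg : exp (-2 * I * -k * L) * glmF lam L g₀ h₀ K N t (-k) =
    I / 2 * h₀ t * hat N.M₂ t k - I / 2 * g₀ t * exp (2 * I * k * L) * hat K.M₂ t k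
    + exp (2 * I * k * L) * (evenPartBarSnd lam N h₀ t k - k * bar (hat N.M₂ t) k)
      * (evenPartFst K g₀ t k - k * hat K.M₁ t k)
    - (evenPartBarSnd lam K g₀ t k - k * bar (hat K.M₂ t) k)
      * (evenPartFst N h₀ t k - k * hat N.M₁ t k) := by
  have e : exp (-2 * I * -k * L) = exp (2 * I * k * L) := by congr 1; ring
  rw [exp_mul_glmF]
  simp only [e, hat_even, bar_neg_of_even (hat_even _ _), evenPartFst_neg, evenPartBarSnd_neg]
  ring

variable {δ : ℝ → ℝ} {Φ₁ Φ₂ φ₁ φ₂ : ℂ → ℂ} {c d : ℂ} {lam L g₀ h₀ K N t k}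

theorem glmG₀_eq (S : EvenExpansion δ Φ₁ Φ₂ (g₀ t) c (evenPartFst K g₀ t) (hat K.M₁ t)
      (evenPartBarSnd lam K g₀ t) (bar (hat K.M₂ t)) (hat K.M₂ t))
    (S' : EvenExpansion δ φ₁ φ₂ (h₀ t) d (evenPartFst N h₀ t) (hat N.M₁ t)
      (evenPartBarSnd lam N h₀ t) (bar (hat N.M₂ t)) (hat N.M₂ t)) (hL : 0 < L) (hk : 0 < k.im) :
    glmG₀ lam L g₀ h₀ K N t k = directG₀ L Φ₁ Φ₂ φ₁ φ₂ k := by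
  have hD := Del_ne_zero hL hk
  have e1 : hat K.L₁ t k = evenPartFst K g₀ t k + I / 2 * g₀ t * hat K.M₂ t k := by
    rw [evenPartFst]; ring
  have e2 : hat N.L₁ t k = evenPartFst N h₀ t k + I / 2 * h₀ t * hat N.M₂ t k := by
    rw [evenPartFst]; ring
  rw [directG₀_eq S S' hL hk, glmG₀, plusPart, exp_mul_glmF, exp_mul_glmF_neg, e1, e2]
  simp only [Sig, Del] at hD ⊢
  generalize exp (2 * I * k * L) = p at hD ⊢
  generalize exp (-2 * I * k * L) = q at hD ⊢
  field_simp
  ring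

theorem glmH₀_eq (S : EvenExpansion δ Φ₁ Φ₂ (g₀ t) c (evenPartFst K g₀ t) (hat K.M₁ t)
      (evenPartBarSnd lam K g₀ t) (bar (hat K.M₂ t)) (hat K.M₂ t))
    (S' : EvenExpansion δ φ₁ φ₂ (h₀ t) d (evenPartFst N h₀ t) (hat N.M₁ t)
      (evenPartBarSnd lam N h₀ t) (bar (hat N.M₂ t)) (hat N.M₂ t)) (hL : 0 < L) (hk : 0 < k.im) :
    glmH₀ lam L g₀ h₀ K N t k = directH₀ L Φ₁ Φ₂ φ₁ φ₂ k := by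
  have hD := Del_ne_zero hL hk
  have e1 : hat K.L₁ t k = evenPartFst K g₀ t k + I / 2 * g₀ t * hat K.M₂ t k := by
    rw [evenPartFst]; ring
  have e2 : hat N.L₁ t k = evenPartFst N h₀ t k + I / 2 * h₀ t * hat N.M₂ t k := by
    rw [evenPartFst]; ring
  rw [directH₀_eq S S' hL hk, glmH₀, plusPart, glmF_neg, glmF_eq, e1, e2]
  simp only [Sig, Del] at hD ⊢
  generalize exp (2 * I * k * L) = p at hD ⊢
  generalize exp (-2 * I * k * L) = q at hD ⊢
  field_simp
  ring

theorem div_two_mul_I_mul_sq (z : ℂ) (hk : k ≠ 0) :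
    k ^ 2 * (z / (2 * I * k ^ 2)) = -(I / 2) * z := by
  rw [← div_two_mul_I]
  have := I_ne_zero
  field_simp

/-- All terms match except one: the GLM integrand has the Schwarz conjugate of the transform of
`N.M₂` where φ₂₋ supplies the transform itself. The g₀M̂₂ term of F passes through the minus part as
(q - p)/Δ = -1 and combines with the explicit one. -/
theorem glmG₁_eq (S : EvenExpansion δ Φ₁ Φ₂ (g₀ t) c (evenPartFst K g₀ t) (hat K.M₁ t)
      (evenPartBarSnd lam K g₀ t) (bar (hat K.M₂ t)) (hat K.M₂ t))
    (S' : EvenExpansion δ φ₁ φ₂ (h₀ t) d (evenPartFst N h₀ t) (hat N.M₁ t)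
      (evenPartBarSnd lam N h₀ t) (bar (hat N.M₂ t)) (hat N.M₂ t)) (hL : 0 < L) (hk : 0 < k.im) :
    glmG₁ lam L g₀ h₀ K N t k = directG₁ L (g₀ t) (h₀ t) Φ₁ Φ₂ φ₁ φ₂ k
      + -(I / 2) * g₀ t * (k * bar (hat N.M₂ t) k - k * hat N.M₂ t k) := by
  have hD := Del_ne_zero hL hk
  have hk0 := ne_zero_of_im_pos hk
  have e1 := div_two_mul_I_mul_sq (g₀ t) hk0
  have e2 := div_two_mul_I_mul_sq (h₀ t) hk0
  rw [directG₁_eq S S' hL hk, glmG₁, minusPart, exp_mul_glmF, exp_mul_glmF_neg, div_two_mul_I]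
  generalize g₀ t / (2 * I * k ^ 2) = u at e1 ⊢
  generalize h₀ t / (2 * I * k ^ 2) = w at e2 ⊢
  simp only [Sig, Del] at hD ⊢
  generalize exp (2 * I * k * L) = p at hD ⊢
  generalize exp (-2 * I * k * L) = q at hD ⊢
  field_simp
  linear_combination 4 * e2 - 2 * (p + q) * e1

theorem glmH₁_eq (S : EvenExpansion δ Φ₁ Φ₂ (g₀ t) c (evenPartFst K g₀ t) (hat K.M₁ t)
      (evenPartBarSnd lam K g₀ t) (bar (hat K.M₂ t)) (hat K.M₂ t))
    (S' : EvenExpansion δ φ₁ φ₂ (h₀ t) d (evenPartFst N h₀ t) (hat N.M₁ t)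
      (evenPartBarSnd lam N h₀ t) (bar (hat N.M₂ t)) (hat N.M₂ t)) (hL : 0 < L) (hk : 0 < k.im) :
    glmH₁ lam L g₀ h₀ K N t k = directH₁ L (g₀ t) (h₀ t) Φ₁ Φ₂ φ₁ φ₂ k
      + -(I / 2) * h₀ t * (k * bar (hat K.M₂ t) k - k * hat K.M₂ t k) := by
  have hD := Del_ne_zero hL hk
  have hk0 := ne_zero_of_im_pos hk
  have e1 := div_two_mul_I_mul_sq (g₀ t) hk0
  have e2 := div_two_mul_I_mul_sq (h₀ t) hk0
  rw [directH₁_eq S S' hL hk, glmH₁, minusPart, glmF_neg, glmF_eq, div_two_mul_I]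
  generalize g₀ t / (2 * I * k ^ 2) = u at e1 ⊢
  generalize h₀ t / (2 * I * k ^ 2) = w at e2 ⊢
  simp only [Sig, Del] at hD ⊢
  generalize exp (2 * I * k * L) = p at hD ⊢
  generalize exp (-2 * I * k * L) = q at hD ⊢
  field_simp
  linear_combination 2 * (p + q) * e2 - 4 * e1

end Expansion

end NLSInterval

/-! ### The four equalities -/

theorem mainTheorem3
    (lam L T : ℝ) (hlam : lam = 1 ∨ lam = -1) (hL : 0 < L) (hT : 0 < T)
    (g₀ g₁ h₀ h₁ : ℝ → ℂ)
    (hg₀ : ContDiffOn ℝ 2 g₀ (Set.Ico 0 T)) (hh₀ : ContDiffOn ℝ 2 h₀ (Set.Ico 0 T))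
    (hg₁ : ContDiffOn ℝ 1 g₁ (Set.Ico 0 T)) (hh₁ : ContDiffOn ℝ 1 h₁ (Set.Ico 0 T))
    (hg₀0 : g₀ 0 = 0) (hh₀0 : h₀ 0 = 0)
    (Φ₁ Φ₂ φ₁ φ₂ : ℝ → ℂ → ℂ)
    (hΦ : NLSInterval.IsEigenpair lam T g₀ g₁ Φ₁ Φ₂)
    (hφ : NLSInterval.IsEigenpair lam T h₀ h₁ φ₁ φ₂)
    (K N : NLSInterval.GLMKernels)
    (hK : K.Solves lam T g₀ g₁) (hN : N.Solves lam T h₀ h₁)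
    (δ : ℝ → ℝ) (hδ : NLSInterval.IsDepth δ)
    (t : ℝ) (ht : t ∈ Set.Ioo 0 T) :
    (∃ v : ℂ,
      NLSInterval.HasIntegralD₁ δ (4 / (Complex.I * Real.pi))
        (NLSInterval.glmG₁ lam L g₀ h₀ K N t) v ∧
      NLSInterval.HasIntegralD₃ δ (4 / (Real.pi * Complex.I))
        (NLSInterval.directG₁ L (g₀ t) (h₀ t) (Φ₁ t) (Φ₂ t) (φ₁ t) (φ₂ t)) v) ∧
    (∃ v : ℂ,
      NLSInterval.HasIntegralD₁ δ (4 / (Complex.I * Real.pi))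
        (NLSInterval.glmH₁ lam L g₀ h₀ K N t) v ∧
      NLSInterval.HasIntegralD₃ δ (4 / (Real.pi * Complex.I))
        (NLSInterval.directH₁ L (g₀ t) (h₀ t) (Φ₁ t) (Φ₂ t) (φ₁ t) (φ₂ t)) v) ∧
    (∃ v : ℂ,
      NLSInterval.HasIntegralD₁ δ (2 / Real.pi)
        (NLSInterval.glmG₀ lam L g₀ h₀ K N t) v ∧
      NLSInterval.HasIntegralD₃ δ (2 / Real.pi)
        (NLSInterval.directG₀ L (Φ₁ t) (Φ₂ t) (φ₁ t) (φ₂ t)) v) ∧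
    (∃ v : ℂ,
      NLSInterval.HasIntegralD₁ δ (2 / Real.pi)
        (NLSInterval.glmH₀ lam L g₀ h₀ K N t) v ∧
      NLSInterval.HasIntegralD₃ δ (2 / Real.pi)
        (NLSInterval.directH₀ L (Φ₁ t) (Φ₂ t) (φ₁ t) (φ₂ t)) v) := by
  obtain ⟨⟨c, S⟩, hcont, hcorr⟩ := hΦ.exists_evenExpansion hδ hK hg₀ hg₁ hg₀0 ht
  obtain ⟨⟨d, S'⟩, hcont', hcorr'⟩ := hφ.exists_evenExpansion hδ hN hh₀ hh₁ hh₀0 ht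
  have cA := S.cont_A
  have cM := S.cont_M
  have cB := S.cont_B
  have cD := S.cont_D
  have cN := S.cont_N
  have cA' := S'.cont_A
  have cM' := S'.cont_M
  have cB' := S'.cont_B
  have cD' := S'.cont_D
  have cN' := S'.cont_N
  have hcorr_mul : ∀ {f : ℂ → ℂ} (z : ℂ), Tendsto (NLSInterval.integralD₁ δ f) atTop (𝓝 0) →
      Tendsto (NLSInterval.integralD₁ δ fun k => z * f k) atTop (𝓝 0) := fun {f} z hf => by
    have := hf.const_mul z
    rw [mul_zero] at this
    exact this.congr fun R => (NLSInterval.integralD₁_const_mul ..).symm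
  -- For `g₀` and `h₀` the two integrands agree identically in the upper half-plane, so the
  -- correction is zero.
  have hzero : Tendsto (NLSInterval.integralD₁ δ fun _ => 0) atTop (𝓝 0) := by
    simpa using hcorr_mul 0 hcorr
  rw [mul_comm (Real.pi : ℂ) I]
  refine ⟨?_, ?_, ?_, ?_⟩
  -- The correction for `g₁` involves the kernels at the other endpoint, hence `hcorr'`; for `h₁`
  -- the roles of the endpoints are exchanged.
  · obtain ⟨e, he⟩ := S.order_conditional hδ S'
    exact NLSInterval.exists_common_integral hδ hL (by fun_prop) (by fun_prop) (by fun_prop)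
      ((S.order_M.sq_mul_add hδ).add (S.order_odd hδ S' le_rfl))
      (((S'.order_M.sq_mul_add hδ).add (S'.order_odd hδ S le_rfl)).const_mul (-2)) he
      (NLSInterval.directG₁_neg _ _ _ _ _ _ _) (fun k hk => NLSInterval.directG₁_eq S S' hL hk)
      (fun k hk => NLSInterval.glmG₁_eq S S' hL hk) (continuous_const.mul hcont')
      (hcorr_mul _ hcorr') _
  · obtain ⟨e, he⟩ := S'.order_conditional hδ S
    exact NLSInterval.exists_common_integral hδ hL (by fun_prop) (by fun_prop) (by fun_prop)
      (((S'.order_M.sq_mul_add hδ).add (S'.order_odd hδ S le_rfl)).const_mul (-1))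
      (((S.order_M.sq_mul_add hδ).add (S.order_odd hδ S' le_rfl)).const_mul 2) he
      (NLSInterval.directH₁_neg _ _ _ _ _ _ _) (fun k hk => NLSInterval.directH₁_eq S S' hL hk)
      (fun k hk => NLSInterval.glmH₁_eq S S' hL hk) (continuous_const.mul hcont)
      (hcorr_mul _ hcorr) _
  · exact NLSInterval.exists_common_integral hδ hL (c := 0) (by fun_prop) (by fun_prop)
      (by fun_prop) (S.order_even hδ S') ((S'.order_even hδ S).const_mul (-2))
      (by simpa using (S.order_odd hδ S' (p := 1) (by norm_num)).const_mul (-1))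
      (NLSInterval.directG₀_neg _ _ _ _ _) (fun k hk => NLSInterval.directG₀_eq S S' hL hk)
      (fun k hk => by rw [add_zero, NLSInterval.glmG₀_eq S S' hL hk]) continuous_const hzero _
  · exact NLSInterval.exists_common_integral hδ hL (c := 0) (by fun_prop) (by fun_prop)
      (by fun_prop) ((S'.order_even hδ S).const_mul (-1)) ((S.order_even hδ S').const_mul 2)
      (by simpa using (S'.order_odd hδ S (p := 1) (by norm_num)).const_mul (-1))
      (NLSInterval.directH₀_neg _ _ _ _ _) (fun k hk => NLSInterval.directH₀_eq S S' hL hk)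
      (fun k hk => by rw [add_zero, NLSInterval.glmH₀_eq S S' hL hk]) continuous_const hzero _
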